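/- Let $d\ge 1$, $s\in(0,1)$, $\nu>0$, $T>0$, and let $\Omega$ be the open unit ball of $\mathbb{R}^d$, with outward unit normal $n(x)=x$ on $\partial\Omega$. For $f:\mathbb{R}^d\to\mathbb{R}$ put $$(-\Delta_v)^s f(v)=c_{d,s}\,\mathrm{P.V.}\!\int_{\mathbb{R}^d}\frac{f(v)-f(w)}{|v-w|^{d+2s}}\,dw,\qquad c_{d,s}=\Big(\int_{\mathbb{R}^d}\frac{1-\cos\zeta_1}{|\zeta|^{d+2s}}\,d\zeta\Big)^{-1}.$$ Let $F$ be the normalized equilibrium of the fractional Fokker--Planck operator, i.e. the probability density on $\mathbb{R}^d$ that solves $\nu\nabla_v\cdot(vF)-(-\Delta_v)^sF=0$ in the sense of distributions. Let $L^p_{F(v)}(\Omega\times\mathbb{R}^d)$ be the $L^p$ space for the measure $F(v)\,dx\,dv$. For $x\in\Omega$ and $v\in\mathbb{R}^d$ let $\eta(x,v)\in\overline\Omega$ be the position at time $1$ of the particle that starts at $x$ with velocity $v$, moves in straight lines at constant speed, and is reflected specularly, $w\mapsto w-2(n(z)\cdot w)\,n(z)$, whenever it hits $\partial\Omega$, at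 the point $z$ of impact. Let $\mathfrak{D}_T$ be the set of all $\psi\in C^\infty([0,T)\times\overline\Omega)$ with $\psi(T,\cdot)=0$ and $\nabla_x\psi(t,x)\cdot n(x)=0$ for all $t\in[0,T)$ and $x\in\partial\Omega$. Then for every $\psi\in\mathfrak{D}_T$ there exists $p\in(2,\infty)$ such that for every $t\in[0,T)$ the principal value defining $$(-\Delta_v)^s\big[\psi(t,\eta(x,\cdot))\big](v)$$ exists for all $(x,v)\in\Omega\times\mathbb{R}^d$, and, as a function of $(x,v)$, it belongs to $L^p_{F(v)}(\Omega\times\mathbb{R}^d)$. -/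

import Mathlib

open Set Filter Topology MeasureTheory Metric
open scoped ContDiff

noncomputable section

namespace SpecularBall

/-- The Euclidean space `ℝ^d`. -/
abbrev E (d : ℕ) : Type := EuclideanSpace ℝ (Fin d)

/-! ### The fractional Laplacian -/

/-- The normalising constant `c_{d,s} = (∫ (1 - cos ζ₁) / |ζ|^{d+2s} dζ)⁻¹`. -/
def fracConst (d : ℕ) [NeZero d] (s : ℝ) : ℝ :=
  (∫ ζ : E d, (1 - Real.cos (ζ 0)) / ‖ζ‖ ^ ((d : ℝ) + 2 * s))⁻¹

/-- The truncated singular integral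
`c_{d,s} ∫_{|v - w| > ε} (f(v) - f(w)) / |v - w|^{d+2s} dw`. -/
def truncFracLaplacian {d : ℕ} [NeZero d] (s : ℝ) (f : E d → ℝ) (v : E d) (ε : ℝ) : ℝ :=
  fracConst d s *
    ∫ w in {w : E d | ε < ‖v - w‖}, (f v - f w) / ‖v - w‖ ^ ((d : ℝ) + 2 * s)

/-- `(-Δ)^s f (v) = c_{d,s} P.V. ∫ (f(v) - f(w)) / |v - w|^{d+2s} dw`, the principal value being
the limit of the truncated integrals (it is meaningful when `FracLaplacianExists s f v`). -/
def fracLaplacian {d : ℕ} [NeZero d] (s : ℝ) (f : E d → ℝ) (v : E d) : ℝ :=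
  limUnder (𝓝[>] (0 : ℝ)) (truncFracLaplacian s f v)

/-- The truncated integrals converge absolutely and have a limit: the principal value that
defines `(-Δ)^s f (v)` exists, and its value is `fracLaplacian s f v`. -/
def FracLaplacianExists {d : ℕ} [NeZero d] (s : ℝ) (f : E d → ℝ) (v : E d) : Prop :=
  (∀ ε : ℝ, 0 < ε →
    IntegrableOn (fun w : E d => (f v - f w) / ‖v - w‖ ^ ((d : ℝ) + 2 * s))
      {w : E d | ε < ‖v - w‖}) ∧
  Tendsto (truncFracLaplacian s f v) (𝓝[>] (0 : ℝ)) (𝓝 (fracLaplacian s f v))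

/-! ### The equilibrium of the fractional Fokker-Planck operator -/

/-- `F` is a normalised equilibrium distribution function of the fractional Fokker-Planck
operator: a probability density that solves `ν ∇·(v F) - (-Δ)^s F = 0` in the sense of
distributions. -/
structure IsEquilibrium {d : ℕ} [NeZero d] (s ν : ℝ) (F : E d → ℝ) : Prop where
  nonneg : ∀ v, 0 ≤ F v
  integrable : Integrable F
  integral_eq_one : ∫ v, F v = 1
  weak_eq : ∀ φ : E d → ℝ, ContDiff ℝ ∞ φ → HasCompactSupport φ →
    ∫ v, F v * (-(ν * fderiv ℝ φ v v) - fracLaplacian s φ v) = 0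

/-! ### Specularly reflected trajectories in the unit ball -/

/-- Specular reflection `R_n(w) = w - 2 (n · w) n`. On the unit sphere the outward unit normal
at `z` is `z` itself. -/
def reflect {d : ℕ} (n w : E d) : E d := w - (2 * inner ℝ n w) • n

/-- The first positive time at which the straight line issued from `y` with velocity `w` is on
the unit sphere. -/
def hitTime {d : ℕ} (y w : E d) : ℝ := sInf {t : ℝ | 0 < t ∧ ‖y + t • w‖ = 1}

/-- The data `(τ_k, x(τ_k), w(τ_k))` at the `k`-th reflection of the trajectory issued from
`(x, v)`: the time, the position and the velocity just after the reflection, with the convention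
`τ_0 = 0`. For `v = 0` the trajectory rests at `x`, and all entries are `(0, x, 0)`. -/
def reflectionData {d : ℕ} (x v : E d) : ℕ → ℝ × E d × E d
  | 0 => (0, x, v)
  | k + 1 =>
    let τ := (reflectionData x v k).1
    let y := (reflectionData x v k).2.1
    let w := (reflectionData x v k).2.2
    let z := y + hitTime y w • w
    (τ + hitTime y w, z, reflect z w)

/-- The number `M` of reflections up to time `1`, that is, the largest `k` with `τ_k ≤ 1`. -/
def numReflections {d : ℕ} (x v : E d) : ℕ := sSup {k : ℕ | (reflectionData x v k).1 ≤ 1}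

/-- The end point `η(x, v) = x(τ_M) + (1 - τ_M) w(τ_M)` at time `1` of the trajectory issued from
`x` with velocity `v` and specularly reflected at the unit sphere. -/
def eta {d : ℕ} (x v : E d) : E d :=
  let q := reflectionData x v (numReflections x v)
  q.2.1 + (1 - q.1) • q.2.2

/-! ### Test functions and the weighted space -/

/-- The class `𝔇_T` of test functions on the unit ball: smooth on `[0,T) × closedBall`, zero at
time `T`, with vanishing normal derivative on the unit sphere. -/
structure IsTestFunction {d : ℕ} (T : ℝ) (ψ : ℝ → E d → ℝ) : Prop where
  smooth : ContDiffOn ℝ ∞ (fun q : ℝ × E d => ψ q.1 q.2) (Ico 0 T ×ˢ closedBall 0 1)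
  final : ∀ x ∈ closedBall (0 : E d) 1, ψ T x = 0
  neumann : ∀ t ∈ Ico 0 T, ∀ x ∈ sphere (0 : E d) 1,
    fderivWithin ℝ (ψ t) (closedBall 0 1) x x = 0

/-- The measure `F(v) dx dv` on `Ω × ℝ^d`, with `Ω` the open unit ball. -/
def weightedMeasure {d : ℕ} (F : E d → ℝ) : Measure (E d × E d) :=
  (volume.restrict (ball (0 : E d) 1)).prod
    (volume.withDensity fun v => ENNReal.ofReal (F v))

end SpecularBall

end

/-! Write r = |v|, b = ⟨x,v⟩, δ = 1 - |x|² and D = √(b² + δr²). In a ball, one isometry R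
(`chordRot`) maps every chord of a trajectory to the next one. Hence after N reflections the end
point is R^N applied to a point of the line x + ℝv (`reflectionData_succ`, `eta_eq_branch`). So η is
a patchwork of explicit smooth branches in v, and two things have to be controlled along lines v +
sk: second derivatives on a branch, and the passage from one branch to the next.

On a branch, the second derivative of η can be as large as (r/D)², for instance for grazing
trajectories with many short chords. The large part is radial, though, and stays bounded after
multiplication by 1 - |η|²; the rest is O(r/D), which is O(1/√δ) since D² ≥ δr² (`TameJet`,
`tameJet_branch`). The Neumann condition makes the radial derivative of a test function O(1 - |y|²)
(`exists_neumannExpansion`), so the composition has second derivatives O(1/√δ)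
(`NeumannExpansion.comp_tameJet`). Tameness is proved in separate regimes: no reflection, one
reflection of a slow particle, chords near the centre, and chords away from the centre. The last one
uses polar coordinates in the plane of motion, where the contributions of the N reflections to the
angular velocity almost cancel.

At a switch of branches the particle is on the sphere, both branches agree there, and their
derivatives differ by a normal vector, which the Neumann condition annihilates
(`hasDerivAt_branch_succ`). Thus at every velocity there is a first order expansion with quadratic
remainder and a constant depending only on δ and the test function. A maximum principle turns this
into a global bound O(|k|²/√δ) for second differences (`NeumannExpansion.abs_secondDiff_le`).

Interpolation with the boundedness of the test function gives second differences O(δ^(-γ/4)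
min(1,|k|^γ)) for 2s < γ ≤ 2. The symmetrized singular integral then converges and is O(δ^(-γ/4))
uniformly in v (`fracLaplacianExists_of_secondDiff`). This is in L^p over the ball when pγ/4 < 1,
and some γ > 2s allows p > 2 because s < 1. Of the equilibrium, only integrability is needed. -/

namespace SpecularBall

open scoped RealInnerProductSpace

/-! ### Second order jets at `0` of curves in normed spaces -/

section Jets

variable {V W U : Type*} [NormedAddCommGroup V] [NormedSpace ℝ V] [NormedAddCommGroup W]
  [NormedSpace ℝ W] [NormedAddCommGroup U] [NormedSpace ℝ U]

/-- `f` is differentiable near `0` and twice differentiable at `0`, with derivatives `m`, `q`. -/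
def HasJet (f : ℝ → V) (m q : V) : Prop :=
  ∃ f' : ℝ → V, (∀ᶠ s in 𝓝 0, HasDerivAt f (f' s) s) ∧ f' 0 = m ∧ HasDerivAt f' q 0

/-- `f` is differentiable at `0`, with bounds for the value and the derivative. -/
def JetBound₁ (f : ℝ → V) (a b : ℝ) : Prop :=
  ‖f 0‖ ≤ a ∧ ∃ m, ‖m‖ ≤ b ∧ HasDerivAt f m 0

/-- `f` has a second order jet at `0`, with bounds for the value and both derivatives. -/
def JetBound (f : ℝ → V) (a b c : ℝ) : Prop :=
  ‖f 0‖ ≤ a ∧ ∃ m q, ‖m‖ ≤ b ∧ ‖q‖ ≤ c ∧ HasJet f m q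

theorem HasJet.hasDerivAt {f : ℝ → V} {m q : V} (h : HasJet f m q) : HasDerivAt f m 0 := by
  obtain ⟨f', h1, rfl, -⟩ := h
  exact h1.self_of_nhds

theorem HasJet.congr {f g : ℝ → V} {m q : V} (h : HasJet f m q) (hfg : g =ᶠ[𝓝 0] f) :
    HasJet g m q := by
  obtain ⟨f', h1, h2, h3⟩ := h
  refine ⟨f', ?_, h2, h3⟩
  filter_upwards [h1, hfg.eventually_nhds] with s hs hs'
  exact hs.congr_of_eventuallyEq hs'

theorem hasJet_const (u : V) : HasJet (fun _ => u) 0 0 :=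
  ⟨fun _ => 0, Eventually.of_forall fun s => hasDerivAt_const s u, rfl, hasDerivAt_const 0 0⟩

theorem hasJet_line (u k : V) : HasJet (fun s : ℝ => u + s • k) k 0 :=
  ⟨fun _ => k, Eventually.of_forall fun s => by
    simpa using ((hasDerivAt_id s).smul_const k).const_add u, rfl, hasDerivAt_const 0 k⟩

theorem HasJet.add {f g : ℝ → V} {m q m' q' : V} (hf : HasJet f m q) (hg : HasJet g m' q') :
    HasJet (fun s => f s + g s) (m + m') (q + q') := by
  obtain ⟨f', h1, rfl, h3⟩ := hf
  obtain ⟨g', k1, rfl, k3⟩ := hg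
  exact ⟨fun s => f' s + g' s, by filter_upwards [h1, k1] with s a b using a.add b, rfl, h3.add k3⟩

theorem HasJet.bilin {f : ℝ → V} {g : ℝ → W} {m q : V} {m' q' : W} (B : V →L[ℝ] W →L[ℝ] U)
    (hf : HasJet f m q) (hg : HasJet g m' q') :
    HasJet (fun s => B (f s) (g s)) (B (f 0) m' + B m (g 0))
      (B (f 0) q' + (2 : ℝ) • B m m' + B q (g 0)) := by
  have hf0 := hf.hasDerivAt
  have hg0 := hg.hasDerivAt
  obtain ⟨f', h1, rfl, h3⟩ := hf
  obtain ⟨g', k1, rfl, k3⟩ := hg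
  refine ⟨fun s => B (f s) (g' s) + B (f' s) (g s), ?_, rfl, ?_⟩
  · filter_upwards [h1, k1] with s a b
    exact B.hasDerivAt_of_bilinear (fun _ => a) (fun _ => b)
  · refine ((B.hasDerivAt_of_bilinear (fun _ => hf0) (fun _ => k3)).add
      (B.hasDerivAt_of_bilinear (fun _ => h3) (fun _ => hg0))).congr_deriv ?_
    rw [two_smul]; abel

theorem HasJet.smul {f : ℝ → ℝ} {g : ℝ → V} {m q : ℝ} {m' q' : V}
    (hf : HasJet f m q) (hg : HasJet g m' q') :
    HasJet (fun s => f s • g s) (f 0 • m' + m • g 0) (f 0 • q' + (2 : ℝ) • m • m' + q • g 0) :=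
  hf.bilin (ContinuousLinearMap.lsmul ℝ ℝ) hg

theorem HasJet.clm (A : V →L[ℝ] W) {f : ℝ → V} {m q : V} (hf : HasJet f m q) :
    HasJet (fun s => A (f s)) (A m) (A q) := by
  obtain ⟨f', h1, rfl, h3⟩ := hf
  exact ⟨fun s => A (f' s), by
    filter_upwards [h1] with s a using A.hasFDerivAt.comp_hasDerivAt s a, rfl,
    A.hasFDerivAt.comp_hasDerivAt 0 h3⟩

/-- Composition with a twice differentiable function of a real variable. -/
theorem HasJet.scomp {f : ℝ → ℝ} {m q : ℝ} (hf : HasJet f m q) {H H' : ℝ → ℝ} {H'' : ℝ}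
    (h1 : ∀ᶠ y in 𝓝 (f 0), HasDerivAt H (H' y) y) (h2 : HasDerivAt H' H'' (f 0)) :
    HasJet (fun s => H (f s)) (H' (f 0) * m) (H'' * m * m + H' (f 0) * q) := by
  have hf0 := hf.hasDerivAt
  obtain ⟨f', k1, rfl, k3⟩ := hf
  refine ⟨fun s => H' (f s) * f' s, ?_, rfl, ?_⟩
  · filter_upwards [k1, hf0.continuousAt.eventually h1] with s a b
    exact b.comp s a
  · exact (h2.comp (0 : ℝ) hf0).mul k3

theorem HasJet.inv {f : ℝ → ℝ} {m q : ℝ} (hf : HasJet f m q) (h : f 0 ≠ 0) :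
    HasJet (fun s => (f s)⁻¹) (-m / f 0 ^ 2) (2 * m ^ 2 / f 0 ^ 3 - q / f 0 ^ 2) := by
  have h2 : HasDerivAt (fun y : ℝ => -(y ^ 2)⁻¹) (2 / f 0 ^ 3) (f 0) := by
    have h3 := ((hasDerivAt_pow 2 (f 0)).fun_inv (pow_ne_zero 2 h)).fun_neg
    refine h3.congr_deriv ?_
    push_cast
    field_simp
  have := hf.scomp (H := fun y => y⁻¹) (H' := fun y => -(y ^ 2)⁻¹)
    (by filter_upwards [isOpen_ne.mem_nhds h] with y hy using hasDerivAt_inv hy) h2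
  convert this using 1
  · field_simp
  · field_simp
    ring

theorem HasJet.sqrt {f : ℝ → ℝ} {m q : ℝ} (hf : HasJet f m q) (h : 0 < f 0) :
    HasJet (fun s => √(f s)) (m / (2 * √(f 0)))
      (q / (2 * √(f 0)) - m ^ 2 / (4 * √(f 0) ^ 3)) := by
  have h0 : √(f 0) ≠ 0 := (Real.sqrt_pos.2 h).ne'
  have h2 : HasDerivAt (fun y : ℝ => 1 / (2 * √y)) (-1 / (4 * √(f 0) ^ 3)) (f 0) := by
    have h3 := (((Real.hasDerivAt_sqrt h.ne').const_mul 2).fun_inv (mul_ne_zero two_ne_zero h0))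
    simp only [one_div]
    refine h3.congr_deriv ?_
    field_simp
    norm_num
  have := hf.scomp (H := fun y => √y) (H' := fun y => 1 / (2 * √y))
    (by filter_upwards [lt_mem_nhds h] with y hy using Real.hasDerivAt_sqrt hy.ne') h2
  convert this using 1
  · ring
  · field_simp
    ring

theorem JetBound.mono {f : ℝ → V} {a b c a' b' c' : ℝ} (h : JetBound f a b c) (ha : a ≤ a')
    (hb : b ≤ b') (hc : c ≤ c') : JetBound f a' b' c' := by
  obtain ⟨h0, m, q, h1, h2, h3⟩ := h
  exact ⟨h0.trans ha, m, q, h1.trans hb, h2.trans hc, h3⟩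

theorem JetBound.nonneg {f : ℝ → V} {a b c : ℝ} (h : JetBound f a b c) :
    0 ≤ a ∧ 0 ≤ b ∧ 0 ≤ c := by
  obtain ⟨h0, m, q, h1, h2, -⟩ := h
  exact ⟨(norm_nonneg _).trans h0, (norm_nonneg _).trans h1, (norm_nonneg _).trans h2⟩

/-- The bound for the value may be replaced by any other one. -/
theorem JetBound.of_norm_le {f : ℝ → V} {a b c a' : ℝ} (h : JetBound f a b c) (ha : ‖f 0‖ ≤ a') :
    JetBound f a' b c :=
  ⟨ha, h.2⟩

theorem JetBound.jetBound₁ {f : ℝ → V} {a b c : ℝ} (h : JetBound f a b c) : JetBound₁ f a b := by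
  obtain ⟨h0, m, q, h1, h2, h3⟩ := h
  exact ⟨h0, m, h1, h3.hasDerivAt⟩

/-- The derivative near `0` of a function with a bounded jet. -/
theorem JetBound.exists_deriv {f : ℝ → V} {a b c : ℝ} (h : JetBound f a b c) :
    ∃ f' : ℝ → V, (∀ᶠ s in 𝓝 0, HasDerivAt f (f' s) s) ∧ JetBound₁ f' b c := by
  obtain ⟨h0, m, q, h1, h2, f', k1, rfl, k3⟩ := h
  exact ⟨f', k1, h1, q, h2, k3⟩

theorem JetBound.of_deriv {f f' : ℝ → V} {a b c : ℝ} (h0 : ‖f 0‖ ≤ a)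
    (h : ∀ᶠ s in 𝓝 0, HasDerivAt f (f' s) s) (h' : JetBound₁ f' b c) : JetBound f a b c := by
  obtain ⟨h1, q, h2, h3⟩ := h'
  exact ⟨h0, f' 0, q, h1, h2, f', h, rfl, h3⟩

theorem jetBound_const (u : V) : JetBound (fun _ => u) ‖u‖ 0 0 :=
  ⟨le_rfl, 0, 0, by simp, by simp, hasJet_const u⟩

theorem jetBound_line (u k : V) : JetBound (fun s : ℝ => u + s • k) ‖u‖ ‖k‖ 0 :=
  ⟨by simp, k, 0, le_rfl, by simp, hasJet_line u k⟩

theorem JetBound.add {f g : ℝ → V} {a b c a' b' c' : ℝ} (hf : JetBound f a b c)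
    (hg : JetBound g a' b' c') : JetBound (fun s => f s + g s) (a + a') (b + b') (c + c') := by
  obtain ⟨h0, m, q, h1, h2, h3⟩ := hf
  obtain ⟨k0, n, p, k1, k2, k3⟩ := hg
  exact ⟨norm_add_le_of_le h0 k0, _, _, norm_add_le_of_le h1 k1, norm_add_le_of_le h2 k2,
    h3.add k3⟩

theorem JetBound.clm (A : V →L[ℝ] W) (hA : ‖A‖ ≤ 1) {f : ℝ → V} {a b c : ℝ}
    (hf : JetBound f a b c) : JetBound (fun s => A (f s)) a b c := by
  obtain ⟨h0, m, q, h1, h2, h3⟩ := hf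
  have key : ∀ (y : V) (e : ℝ), ‖y‖ ≤ e → ‖A y‖ ≤ e := fun y e hy =>
    (A.le_of_opNorm_le hA y).trans (by simpa using hy)
  exact ⟨key _ _ h0, _, _, key _ _ h1, key _ _ h2, h3.clm A⟩

theorem JetBound.neg {f : ℝ → V} {a b c : ℝ} (hf : JetBound f a b c) :
    JetBound (fun s => -f s) a b c := by
  have := hf.clm (-ContinuousLinearMap.id ℝ V)
    (by rw [norm_neg]; exact ContinuousLinearMap.norm_id_le)
  simpa using! this

theorem JetBound.sub {f g : ℝ → V} {a b c a' b' c' : ℝ} (hf : JetBound f a b c)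
    (hg : JetBound g a' b' c') : JetBound (fun s => f s - g s) (a + a') (b + b') (c + c') := by
  simpa only [sub_eq_add_neg] using hf.add hg.neg

theorem JetBound.bilin {f : ℝ → V} {g : ℝ → W} {a b c a' b' c' : ℝ} (B : V →L[ℝ] W →L[ℝ] U)
    (hB : ‖B‖ ≤ 1) (hf : JetBound f a b c) (hg : JetBound g a' b' c') :
    JetBound (fun s => B (f s) (g s)) (a * a') (a * b' + b * a')
      (a * c' + 2 * (b * b') + c * a') := by
  obtain ⟨h0, m, q, h1, h2, h3⟩ := hf
  obtain ⟨k0, n, p, k1, k2, k3⟩ := hg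
  have key : ∀ (y : V) (z : W) (e e' : ℝ), ‖y‖ ≤ e → ‖z‖ ≤ e' → ‖B y z‖ ≤ e * e' := by
    intro y z e e' hy hz
    calc ‖B y z‖ ≤ 1 * ‖y‖ * ‖z‖ := B.le_of_opNorm₂_le_of_le hB le_rfl le_rfl
      _ ≤ e * e' := by
        rw [one_mul]
        exact mul_le_mul hy hz (norm_nonneg _) ((norm_nonneg _).trans hy)
  refine ⟨key _ _ _ _ h0 k0, _, _, norm_add_le_of_le (key _ _ _ _ h0 k1) (key _ _ _ _ h1 k0),
    norm_add_le_of_le (norm_add_le_of_le (key _ _ _ _ h0 k2) ?_) (key _ _ _ _ h2 k0),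
    h3.bilin B k3⟩
  rw [norm_smul]
  simpa using key _ _ _ _ h1 k1

theorem JetBound.smul {f : ℝ → ℝ} {g : ℝ → V} {a b c a' b' c' : ℝ} (hf : JetBound f a b c)
    (hg : JetBound g a' b' c') : JetBound (fun s => f s • g s) (a * a') (a * b' + b * a')
      (a * c' + 2 * (b * b') + c * a') :=
  hf.bilin (ContinuousLinearMap.lsmul ℝ ℝ) ContinuousLinearMap.opNorm_lsmul_le hg

theorem JetBound.mul {f g : ℝ → ℝ} {a b c a' b' c' : ℝ} (hf : JetBound f a b c)
    (hg : JetBound g a' b' c') : JetBound (fun s => f s * g s) (a * a') (a * b' + b * a')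
      (a * c' + 2 * (b * b') + c * a') :=
  hf.smul hg

theorem JetBound.const_mul {f : ℝ → ℝ} {a b c : ℝ} (hf : JetBound f a b c) (k : ℝ) :
    JetBound (fun s => k * f s) (|k| * a) (|k| * b) (|k| * c) := by
  have := (jetBound_const k).mul hf
  simpa using this

theorem JetBound.inner {X : Type*} [NormedAddCommGroup X] [InnerProductSpace ℝ X]
    {f g : ℝ → X} {a b c a' b' c' : ℝ} (hf : JetBound f a b c)
    (hg : JetBound g a' b' c') : JetBound (fun s => inner ℝ (f s) (g s)) (a * a')
      (a * b' + b * a') (a * c' + 2 * (b * b') + c * a') :=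
  hf.bilin (innerSL ℝ) (norm_innerSL_le ℝ) hg

theorem JetBound.inv {f : ℝ → ℝ} {a b c n : ℝ} (hf : JetBound f a b c) (hn : 0 < n)
    (h : n ≤ |f 0|) :
    JetBound (fun s => (f s)⁻¹) (1 / n) (b / n ^ 2) (2 * b ^ 2 / n ^ 3 + c / n ^ 2) := by
  obtain ⟨h0, m, q, h1, h2, h3⟩ := hf
  have hpos : 0 < |f 0| := hn.trans_le h
  refine ⟨?_, _, _, ?_, ?_, h3.inv (abs_pos.1 hpos)⟩
  · rw [norm_inv, Real.norm_eq_abs, ← one_div]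
    exact one_div_le_one_div_of_le hn h
  · rw [norm_div, norm_neg, norm_pow, Real.norm_eq_abs (f 0)]
    have : 0 ≤ b := (norm_nonneg _).trans h1
    gcongr
  · refine (norm_sub_le _ _).trans ?_
    rw [norm_div, norm_div, norm_pow, norm_pow, norm_mul, norm_pow, Real.norm_eq_abs (f 0),
      Real.norm_ofNat]
    have hb : 0 ≤ b := (norm_nonneg _).trans h1
    have hc : 0 ≤ c := (norm_nonneg _).trans h2
    gcongr

theorem JetBound.sqrt {f : ℝ → ℝ} {a b c n : ℝ} (hf : JetBound f a b c) (hn : 0 < n)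
    (h : n ^ 2 ≤ f 0) :
    JetBound (fun s => √(f s)) √(f 0) (b / (2 * n)) (c / (2 * n) + b ^ 2 / (4 * n ^ 3)) := by
  obtain ⟨h0, m, q, h1, h2, h3⟩ := hf
  have hpos : 0 < f 0 := (by positivity : 0 < n ^ 2).trans_le h
  have hns : n ≤ √(f 0) := Real.le_sqrt_of_sq_le h
  have hb : 0 ≤ b := (norm_nonneg _).trans h1
  have hc : 0 ≤ c := (norm_nonneg _).trans h2
  refine ⟨?_, _, _, ?_, ?_, h3.sqrt hpos⟩
  · rw [Real.norm_of_nonneg (Real.sqrt_nonneg _)]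
  · rw [norm_div, norm_mul, Real.norm_ofNat, Real.norm_of_nonneg (Real.sqrt_nonneg _)]
    gcongr
  · refine (norm_sub_le _ _).trans ?_
    rw [norm_div, norm_div, norm_mul, norm_mul, norm_pow, norm_pow, Real.norm_ofNat,
      Real.norm_ofNat, Real.norm_of_nonneg (Real.sqrt_nonneg _)]
    gcongr

/-- Powers of a curve in the unit ball of a normed algebra. -/
theorem JetBound.pow {X : Type*} [NormedRing X] [NormOneClass X] [NormedAlgebra ℝ X] {f : ℝ → X}
    {b c : ℝ} (hf : JetBound f 1 b c) (n : ℕ) :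
    JetBound (fun s => f s ^ n) 1 (n * b) (n * c + n ^ 2 * b ^ 2) := by
  obtain ⟨-, hb, hc⟩ := hf.nonneg
  induction n with
  | zero => simpa using jetBound_const (1 : X)
  | succ n ih =>
    have := ih.bilin (ContinuousLinearMap.mul ℝ X) (ContinuousLinearMap.opNorm_mul_le ℝ X) hf
    simp only [ContinuousLinearMap.mul_apply'] at this
    simp only [pow_succ (f _)]
    refine this.mono (by simp) (by push_cast; linarith) ?_
    push_cast
    -- The induction adds c + 2nb² to the second order bound, which is less than the increment c +
    -- (2n+1)b² of the claimed one.
    nlinarith [sq_nonneg b, (Nat.cast_nonneg n : (0 : ℝ) ≤ n)]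

theorem JetBound₁.mono {f : ℝ → V} {a b a' b' : ℝ} (h : JetBound₁ f a b) (ha : a ≤ a')
    (hb : b ≤ b') : JetBound₁ f a' b' := by
  obtain ⟨h0, m, h1, h3⟩ := h
  exact ⟨h0.trans ha, m, h1.trans hb, h3⟩

theorem JetBound₁.add {f g : ℝ → V} {a b a' b' : ℝ} (hf : JetBound₁ f a b)
    (hg : JetBound₁ g a' b') : JetBound₁ (fun s => f s + g s) (a + a') (b + b') := by
  obtain ⟨h0, m, h1, h3⟩ := hf
  obtain ⟨k0, n, k1, k3⟩ := hg
  exact ⟨norm_add_le_of_le h0 k0, _, norm_add_le_of_le h1 k1, h3.add k3⟩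

theorem JetBound₁.smul {f : ℝ → ℝ} {g : ℝ → V} {a b a' b' : ℝ} (hf : JetBound₁ f a b)
    (hg : JetBound₁ g a' b') : JetBound₁ (fun s => f s • g s) (a * a') (a * b' + b * a') := by
  obtain ⟨h0, m, h1, h3⟩ := hf
  obtain ⟨k0, n, k1, k3⟩ := hg
  have ha := (norm_nonneg _).trans h0
  have hb := (norm_nonneg _).trans h1
  refine ⟨?_, _, norm_add_le_of_le ?_ ?_, h3.smul k3⟩ <;> rw [norm_smul] <;> gcongr

theorem JetBound₁.mul {f g : ℝ → ℝ} {a b a' b' : ℝ} (hf : JetBound₁ f a b)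
    (hg : JetBound₁ g a' b') : JetBound₁ (fun s => f s * g s) (a * a') (a * b' + b * a') :=
  hf.smul hg

theorem JetBound₁.of_norm_le {f : ℝ → V} {a b a' : ℝ} (h : JetBound₁ f a b) (ha : ‖f 0‖ ≤ a') :
    JetBound₁ f a' b :=
  ⟨ha, h.2⟩

/-- In the Wronskian of two functions the products of their derivatives cancel. -/
theorem JetBound₁.wronskian {p l p' l' : ℝ → ℝ} {p₀ p₁ p₂ l₀ l₁ l₂ : ℝ}
    (hp : ∀ᶠ s in 𝓝 0, HasDerivAt p (p' s) s) (hl : ∀ᶠ s in 𝓝 0, HasDerivAt l (l' s) s)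
    (hp0 : |p 0| ≤ p₀) (hl0 : |l 0| ≤ l₀) (hp' : JetBound₁ p' p₁ p₂) (hl' : JetBound₁ l' l₁ l₂) :
    JetBound₁ (fun s => p' s * l s - p s * l' s) (p₁ * l₀ + p₀ * l₁) (p₂ * l₀ + p₀ * l₂) := by
  obtain ⟨h0, m, h1, h3⟩ := hp'
  obtain ⟨k0, n, k1, k3⟩ := hl'
  have hp00 := (abs_nonneg _).trans hp0
  have hl00 := (abs_nonneg _).trans hl0
  have hp11 := (norm_nonneg _).trans h0
  have hp22 := (norm_nonneg _).trans h1
  have h := (h3.mul hl.self_of_nhds).sub (hp.self_of_nhds.mul k3)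
  refine ⟨?_, m * l 0 - p 0 * n, ?_, h.congr_deriv (by ring)⟩
  all_goals
    refine (norm_sub_le _ _).trans ?_
    rw [norm_mul, norm_mul]
    simp only [← Real.norm_eq_abs] at hp0 hl0
    gcongr

end Jets


/-! ### Explicit form of the reflected trajectories -/

section Billiard

variable {d : ℕ}

/-- The square root of the reduced discriminant of `t ↦ ‖x + t v‖² - 1`. -/
noncomputable def disc (x v : E d) : ℝ := √(⟪x, v⟫ ^ 2 + (1 - ‖x‖ ^ 2) * ‖v‖ ^ 2)

/-- The operator `w ↦ w - κ ⟨z, w⟩ z`. -/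
noncomputable def householder (κ : ℝ) (z : E d) : E d →L[ℝ] E d :=
  ContinuousLinearMap.id ℝ (E d) - κ • (innerSL ℝ z).smulRight z

/-- The point at which the half line from `x` in direction `v` leaves the unit ball. -/
noncomputable def exitPoint (x v : E d) : E d := x + ((disc x v - ⟪x, v⟫) / ‖v‖ ^ 2) • v

/-- The isometry that maps every chord of a trajectory to the next one. -/
noncomputable def chordRot (x v : E d) : E d →L[ℝ] E d :=
  -(householder 2 (exitPoint x v) * householder (2 / ‖v‖ ^ 2) v)

/-- The position at time `1` of a trajectory after `N` reflections. -/
noncomputable def branch (N : ℕ) (x v : E d) : E d :=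
  (chordRot x v ^ N) (x + (1 - 2 * N * disc x v / ‖v‖ ^ 2) • v)

/-- The number of reflections up to time `1`. -/
noncomputable def branchIndex (x v : E d) : ℕ :=
  ⌊(⟪x, v⟫ + ‖v‖ ^ 2 + disc x v) / (2 * disc x v)⌋₊

theorem householder_apply (κ : ℝ) (z w : E d) :
    householder κ z w = w - (κ * ⟪z, w⟫) • z := by
  simp [householder, smul_smul]

/-- The hypothesis on κ is exactly what cancels the two cross terms. It covers both reflections used
in `chordRot`: κ = 2 with a unit vector, and κ = 2/|v|² with v itself. -/
theorem inner_householder {κ : ℝ} {z : E d} (h : κ ^ 2 * ‖z‖ ^ 2 = 2 * κ) (u w : E d) :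
    ⟪householder κ z u, householder κ z w⟫ = ⟪u, w⟫ := by
  simp only [householder_apply, inner_sub_left, inner_sub_right, real_inner_smul_left,
    real_inner_smul_right, real_inner_self_eq_norm_sq, real_inner_comm z u]
  linear_combination ⟪z, u⟫ * ⟪z, w⟫ * h

variable {x v : E d}

theorem disc_nonneg (x v : E d) : 0 ≤ disc x v := Real.sqrt_nonneg _

theorem disc_sq (hx : ‖x‖ < 1) : disc x v ^ 2 = ⟪x, v⟫ ^ 2 + (1 - ‖x‖ ^ 2) * ‖v‖ ^ 2 := by
  rw [disc, Real.sq_sqrt]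
  have : 0 ≤ 1 - ‖x‖ ^ 2 := by nlinarith [norm_nonneg x]
  positivity

theorem one_sub_norm_sq_pos (hx : ‖x‖ < 1) : 0 < 1 - ‖x‖ ^ 2 := by nlinarith [norm_nonneg x]

theorem abs_inner_lt_disc (hx : ‖x‖ < 1) (hv : v ≠ 0) : |⟪x, v⟫| < disc x v := by
  apply abs_lt_of_sq_lt_sq _ (disc_nonneg x v)
  rw [disc_sq hx]
  have := one_sub_norm_sq_pos hx
  have : 0 < ‖v‖ := norm_pos_iff.2 hv
  have : 0 < (1 - ‖x‖ ^ 2) * ‖v‖ ^ 2 := by positivity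
  linarith

theorem disc_pos (hx : ‖x‖ < 1) (hv : v ≠ 0) : 0 < disc x v :=
  (abs_nonneg _).trans_lt (abs_inner_lt_disc hx hv)

theorem norm_add_smul_sq (x v : E d) (t : ℝ) :
    ‖x + t • v‖ ^ 2 = ‖x‖ ^ 2 + 2 * t * ⟪x, v⟫ + t ^ 2 * ‖v‖ ^ 2 := by
  rw [norm_add_sq_real, real_inner_smul_right, norm_smul, mul_pow, Real.norm_eq_abs, sq_abs]
  ring

theorem norm_exitPoint (hx : ‖x‖ < 1) (hv : v ≠ 0) : ‖exitPoint x v‖ = 1 := by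
  have hc : ‖v‖ ≠ 0 := norm_ne_zero_iff.2 hv
  have : ‖exitPoint x v‖ ^ 2 = 1 := by
    rw [exitPoint, norm_add_smul_sq]
    field_simp
    linear_combination disc_sq hx (v := v)
  exact (pow_eq_one_iff_of_nonneg (norm_nonneg _) two_ne_zero).1 this

theorem inner_exitPoint (hv : v ≠ 0) : ⟪exitPoint x v, v⟫ = disc x v := by
  have hc : ‖v‖ ≠ 0 := norm_ne_zero_iff.2 hv
  rw [exitPoint, inner_add_left, real_inner_smul_left, real_inner_self_eq_norm_sq]
  field_simp
  ring

theorem inner_chordRot (hx : ‖x‖ < 1) (hv : v ≠ 0) (u w : E d) :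
    ⟪chordRot x v u, chordRot x v w⟫ = ⟪u, w⟫ := by
  have hc : ‖v‖ ≠ 0 := norm_ne_zero_iff.2 hv
  simp only [chordRot, neg_apply, mul_apply_eq_comp,
    inner_neg_neg]
  rw [inner_householder (by rw [norm_exitPoint hx hv]; norm_num), inner_householder]
  field_simp

theorem inner_chordRot_pow (hx : ‖x‖ < 1) (hv : v ≠ 0) (k : ℕ) (u w : E d) :
    ⟪(chordRot x v ^ k) u, (chordRot x v ^ k) w⟫ = ⟪u, w⟫ := by
  induction k with
  | zero => simp
  | succ k ih => rw [pow_succ', mul_apply_eq_comp, mul_apply_eq_comp,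
      inner_chordRot hx hv, ih]

theorem norm_chordRot_pow (hx : ‖x‖ < 1) (hv : v ≠ 0) (k : ℕ) (u : E d) :
    ‖(chordRot x v ^ k) u‖ = ‖u‖ := by
  rw [← sq_eq_sq₀ (norm_nonneg _) (norm_nonneg _), ← real_inner_self_eq_norm_sq,
    ← real_inner_self_eq_norm_sq, inner_chordRot_pow hx hv]

/-- The inner reflection sends v to -v and the outer sign restores it, so what remains is the
specular reflection at the exit point. Therefore the powers of `chordRot` produce the successive
velocities. -/
theorem chordRot_apply_self (hv : v ≠ 0) :
    chordRot x v v = v - (2 * disc x v) • exitPoint x v := by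
  have hc : ‖v‖ ≠ 0 := norm_ne_zero_iff.2 hv
  simp only [chordRot, neg_apply, mul_apply_eq_comp]
  rw [householder_apply _ v v, real_inner_self_eq_norm_sq]
  have : v - (2 / ‖v‖ ^ 2 * ‖v‖ ^ 2) • v = -v := by
    rw [div_mul_cancel₀ _ (pow_ne_zero 2 hc), two_smul]; abel
  rw [this, map_neg, neg_neg, householder_apply, inner_exitPoint hv]

/-- The isometry maps the entry point of a chord to its exit point. -/
theorem chordRot_entryPoint (hx : ‖x‖ < 1) (hv : v ≠ 0) :
    chordRot x v (exitPoint x v - (2 * disc x v / ‖v‖ ^ 2) • v) = exitPoint x v := by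
  have hc : ‖v‖ ≠ 0 := norm_ne_zero_iff.2 hv
  simp only [chordRot, neg_apply, mul_apply_eq_comp]
  have h1 : householder (2 / ‖v‖ ^ 2) v (exitPoint x v - (2 * disc x v / ‖v‖ ^ 2) • v)
      = exitPoint x v := by
    rw [householder_apply, inner_sub_right, real_inner_comm, inner_exitPoint hv,
      real_inner_smul_right, real_inner_self_eq_norm_sq, sub_sub, ← add_smul]
    have : 2 * disc x v / ‖v‖ ^ 2 +
        2 / ‖v‖ ^ 2 * (disc x v - 2 * disc x v / ‖v‖ ^ 2 * ‖v‖ ^ 2) = 0 := by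
      field_simp
      ring
    rw [this, zero_smul, sub_zero]
  rw [h1, householder_apply, real_inner_self_eq_norm_sq, norm_exitPoint hx hv]
  module

theorem hitTime_eq {y w : E d} {t : ℝ} (ht : 0 < t) (h : ‖y + t • w‖ = 1)
    (huniq : ∀ t', 0 < t' → ‖y + t' • w‖ = 1 → t' = t) : hitTime y w = t := by
  have : {t : ℝ | 0 < t ∧ ‖y + t • w‖ = 1} = {t} := by
    ext t'
    exact ⟨fun h' => huniq t' h'.1 h'.2, fun h' => by rw [h']; exact ⟨ht, h⟩⟩
  rw [hitTime, this, csInf_singleton]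

theorem hitTime_interior (hx : ‖x‖ < 1) (hv : v ≠ 0) :
    hitTime x v = (disc x v - ⟪x, v⟫) / ‖v‖ ^ 2 := by
  have hc : 0 < ‖v‖ := norm_pos_iff.2 hv
  have hb := abs_lt.1 (abs_inner_lt_disc hx hv)
  have hd := disc_sq hx (v := v)
  refine hitTime_eq (by apply div_pos <;> [linarith; positivity]) (norm_exitPoint hx hv) ?_
  intro t ht h
  have h2 : ‖x + t • v‖ ^ 2 = 1 := by rw [h]; norm_num
  rw [norm_add_smul_sq] at h2
  rw [eq_div_iff (by positivity)]
  have h3 : (t * ‖v‖ ^ 2 - (disc x v - ⟪x, v⟫)) * (t * ‖v‖ ^ 2 + (disc x v + ⟪x, v⟫)) = 0 := by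
    linear_combination ‖v‖ ^ 2 * h2 - hd
  rcases mul_eq_zero.1 h3 with h4 | h4
  · linarith
  · have : 0 < t * ‖v‖ ^ 2 := by positivity
    linarith

/-- Starting on the sphere, the quadratic equation has the root 0, which is not a positive time; the
other root is positive because w points inwards. -/
theorem hitTime_sphere {y w : E d} (hy : ‖y‖ = 1) (h : ⟪y, w⟫ < 0) :
    hitTime y w = -2 * ⟪y, w⟫ / ‖w‖ ^ 2 := by
  have hw : w ≠ 0 := by rintro rfl; simp at h
  have hc : 0 < ‖w‖ := norm_pos_iff.2 hw
  have key : ∀ t, ‖y + t • w‖ ^ 2 = 1 + t * (2 * ⟪y, w⟫ + t * ‖w‖ ^ 2) := fun t => by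
    rw [norm_add_smul_sq, hy]; ring
  refine hitTime_eq (by apply div_pos <;> [linarith; positivity]) ?_ ?_
  · have : ‖y + (-2 * ⟪y, w⟫ / ‖w‖ ^ 2) • w‖ ^ 2 = 1 := by
      rw [key, div_mul_cancel₀ _ (by positivity)]
      ring
    exact (pow_eq_one_iff_of_nonneg (norm_nonneg _) two_ne_zero).1 this
  · intro t ht h'
    have h2 := key t
    rw [h'] at h2
    have h3 : t * (2 * ⟪y, w⟫ + t * ‖w‖ ^ 2) = 0 := by linarith
    rw [eq_div_iff (by positivity)]
    rcases mul_eq_zero.1 h3 with h4 | h4 <;> linarith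

/-- Linear isometries commute with reflection and with free flight, so the induction only has to
know how R acts on the first chord. The first impact takes time (D - b)/r², each later chord takes
2D/r². -/
theorem reflectionData_succ (hx : ‖x‖ < 1) (hv : v ≠ 0) (k : ℕ) :
    reflectionData x v (k + 1) =
      (((2 * k + 1) * disc x v - ⟪x, v⟫) / ‖v‖ ^ 2, (chordRot x v ^ k) (exitPoint x v),
        (chordRot x v ^ (k + 1)) v) := by
  have hc : ‖v‖ ≠ 0 := norm_ne_zero_iff.2 hv
  have hD := disc_pos hx hv
  have hcomm : ∀ (k : ℕ), reflect ((chordRot x v ^ k) (exitPoint x v)) ((chordRot x v ^ k) v)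
      = (chordRot x v ^ (k + 1)) v := fun k => by
    rw [reflect, inner_chordRot_pow hx hv, inner_exitPoint hv, pow_succ,
      mul_apply_eq_comp, chordRot_apply_self hv, map_sub, map_smul]
  induction k with
  | zero =>
    have h0 := hcomm 0
    simp only [pow_zero, one_apply_eq_self] at h0
    simp only [reflectionData, hitTime_interior hx hv]
    rw [← exitPoint, h0]
    simp
  | succ k ih =>
    have h1 : ⟪(chordRot x v ^ k) (exitPoint x v), (chordRot x v ^ (k + 1)) v⟫ = -disc x v := by
      rw [pow_succ, mul_apply_eq_comp, chordRot_apply_self hv,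
        inner_chordRot_pow hx hv, inner_sub_right, inner_exitPoint hv, real_inner_smul_right,
        real_inner_self_eq_norm_sq, norm_exitPoint hx hv]
      ring
    have h2 : hitTime ((chordRot x v ^ k) (exitPoint x v)) ((chordRot x v ^ (k + 1)) v)
        = 2 * disc x v / ‖v‖ ^ 2 := by
      rw [hitTime_sphere (by rw [norm_chordRot_pow hx hv, norm_exitPoint hx hv])
        (by rw [h1]; linarith), h1, norm_chordRot_pow hx hv]
      ring
    have h3 : (chordRot x v ^ k) (exitPoint x v) +
        (2 * disc x v / ‖v‖ ^ 2) • (chordRot x v ^ (k + 1)) v =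
          (chordRot x v ^ (k + 1)) (exitPoint x v) := by
      conv_lhs => rw [← chordRot_entryPoint hx hv, ← mul_apply_eq_comp, ← pow_succ,
        map_sub, map_smul]
      abel
    rw [reflectionData, ih]
    simp only [h2, h3]
    rw [hcomm (k + 1)]
    congr 1
    push_cast
    field_simp
    ring

theorem branchIndex_spec (hx : ‖x‖ < 1) (hv : v ≠ 0) :
    (2 * branchIndex x v - 1) * disc x v ≤ ⟪x, v⟫ + ‖v‖ ^ 2 ∧
      ⟪x, v⟫ + ‖v‖ ^ 2 < (2 * branchIndex x v + 1) * disc x v := by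
  have hD := disc_pos hx hv
  have hb := abs_lt.1 (abs_inner_lt_disc hx hv)
  have h0 : 0 ≤ (⟪x, v⟫ + ‖v‖ ^ 2 + disc x v) / (2 * disc x v) := by
    apply div_nonneg <;> nlinarith [norm_nonneg v]
  have h1 := Nat.floor_le h0
  have h2 := Nat.lt_floor_add_one ((⟪x, v⟫ + ‖v‖ ^ 2 + disc x v) / (2 * disc x v))
  rw [le_div_iff₀ (by positivity)] at h1
  rw [div_lt_iff₀ (by positivity)] at h2
  rw [branchIndex]
  constructor <;> linarith

theorem branchIndex_eq (hx : ‖x‖ < 1) (hv : v ≠ 0) {N : ℕ}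
    (h1 : (2 * N - 1) * disc x v ≤ ⟪x, v⟫ + ‖v‖ ^ 2)
    (h2 : ⟪x, v⟫ + ‖v‖ ^ 2 < (2 * N + 1) * disc x v) : branchIndex x v = N := by
  have hD := disc_pos hx hv
  rw [branchIndex, Nat.floor_eq_iff (by
    apply div_nonneg <;> nlinarith [norm_nonneg v, abs_lt.1 (abs_inner_lt_disc hx hv)]),
    le_div_iff₀ (by positivity), div_lt_iff₀ (by positivity)]
  constructor <;> linarith

theorem numReflections_eq (hx : ‖x‖ < 1) (hv : v ≠ 0) :
    numReflections x v = branchIndex x v := by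
  have hD := disc_pos hx hv
  have hc : 0 < ‖v‖ := norm_pos_iff.2 hv
  have : {k : ℕ | (reflectionData x v k).1 ≤ 1} = Set.Iic (branchIndex x v) := by
    ext k
    rw [Set.mem_ofPred_eq, mem_Iic]
    rcases k with - | k
    · simp [reflectionData]
    · rw [reflectionData_succ hx hv, div_le_one (by positivity), branchIndex, Nat.le_floor_iff
        (by apply div_nonneg <;> nlinarith [norm_nonneg v, abs_lt.1 (abs_inner_lt_disc hx hv)]),
        le_div_iff₀ (by positivity)]
      push_cast
      constructor <;> intro h <;> linarith
  rw [numReflections, this, csSup_Iic]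

theorem eta_eq_branch (hx : ‖x‖ < 1) (hv : v ≠ 0) :
    eta x v = branch (branchIndex x v) x v := by
  have hc : ‖v‖ ≠ 0 := norm_ne_zero_iff.2 hv
  rw [eta, numReflections_eq hx hv]
  generalize branchIndex x v = N
  rcases N with - | k
  · simp [reflectionData, branch]
  · rw [reflectionData_succ hx hv, branch]
    dsimp only
    -- The last reflection point is R of the entry point of the chord through x, so position and
    -- velocity are both pulled back by the same power of R.
    conv_lhs => rw [← chordRot_entryPoint hx hv, ← mul_apply_eq_comp, ← pow_succ,
      ← map_smul, ← map_add]
    congr 1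
    rw [exitPoint]
    match_scalars
    · ring
    · field_simp
      ring

/-- A particle at rest hits the sphere at all positive times or at none; the infimum is 0 in both
cases, by the convention for the empty set in the second. The recursion is therefore constant,
whatever number of reflections is used. -/
theorem eta_zero (x : E d) : eta x 0 = x := by
  have h : ∀ k, reflectionData x (0 : E d) k = (0, x, 0) := by
    intro k
    induction k with
    | zero => rfl
    | succ k ih =>
      have h0 : hitTime x (0 : E d) = 0 := by
        by_cases h : ‖x‖ = 1
        · simp only [hitTime, smul_zero, add_zero, h, and_true]
          exact csInf_Ioi
        · simp [hitTime, h]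
      rw [reflectionData, ih]
      simp [h0, reflect]
  rw [eta, h]
  simp

/-- The distance of the end point of a branch to the sphere. -/
theorem one_sub_norm_branch_sq (hx : ‖x‖ < 1) (hv : v ≠ 0) (N : ℕ) :
    1 - ‖branch N x v‖ ^ 2 =
      (disc x v ^ 2 - (⟪x, v⟫ + ‖v‖ ^ 2 - 2 * N * disc x v) ^ 2) / ‖v‖ ^ 2 := by
  have hc : ‖v‖ ≠ 0 := norm_ne_zero_iff.2 hv
  have hd := disc_sq hx (v := v)
  rw [branch, norm_chordRot_pow hx hv, norm_add_smul_sq]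
  field_simp
  linear_combination -hd

theorem norm_branch_le_one (hx : ‖x‖ < 1) (hv : v ≠ 0) {N : ℕ}
    (h : |⟪x, v⟫ + ‖v‖ ^ 2 - 2 * N * disc x v| ≤ disc x v) : ‖branch N x v‖ ≤ 1 := by
  have h1 := one_sub_norm_branch_sq hx hv N
  have h2 : (⟪x, v⟫ + ‖v‖ ^ 2 - 2 * N * disc x v) ^ 2 ≤ disc x v ^ 2 :=
    sq_le_sq' (abs_le.1 h).1 (abs_le.1 h).2
  have h3 : 0 ≤ 1 - ‖branch N x v‖ ^ 2 := by
    rw [h1]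
    apply div_nonneg <;> [linarith; positivity]
  nlinarith [norm_nonneg (branch N x v)]

theorem norm_eta_le_one (hx : ‖x‖ < 1) (v : E d) : ‖eta x v‖ ≤ 1 := by
  by_cases hv : v = 0
  · rw [hv, eta_zero]; exact hx.le
  · rw [eta_eq_branch hx hv]
    have := branchIndex_spec hx hv
    exact norm_branch_le_one hx hv (abs_le.2 ⟨by linarith, by linarith⟩)

/-- Consecutive branches differ by a multiple of the reflection point. -/
theorem branch_succ_sub (hx : ‖x‖ < 1) (hv : v ≠ 0) (k : ℕ) :
    branch (k + 1) x v = branch k x v -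
      (2 * disc x v * ((⟪x, v⟫ + ‖v‖ ^ 2 - (2 * k + 1) * disc x v) / ‖v‖ ^ 2)) •
        (chordRot x v ^ k) (exitPoint x v) := by
  have hc : ‖v‖ ≠ 0 := norm_ne_zero_iff.2 hv
  -- This is 1 - τ_{k+1}, the signed time left after the reflection that distinguishes the two
  -- branches.
  set l := (⟪x, v⟫ + ‖v‖ ^ 2 - (2 * k + 1) * disc x v) / ‖v‖ ^ 2 with hl
  have h1 : x + (1 - 2 * k * disc x v / ‖v‖ ^ 2) • v = exitPoint x v + l • v := by
    rw [exitPoint, hl]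
    match_scalars
    · ring
    · field_simp
      ring
  have h2 : x + (1 - 2 * ((k + 1 : ℕ) : ℝ) * disc x v / ‖v‖ ^ 2) • v =
      (exitPoint x v - (2 * disc x v / ‖v‖ ^ 2) • v) + l • v := by
    rw [exitPoint, hl]
    match_scalars
    · ring
    · field_simp
      ring
  rw [branch, branch, h1, h2, pow_succ, mul_apply_eq_comp, map_add (chordRot x v),
    chordRot_entryPoint hx hv, map_smul, chordRot_apply_self hv, ← map_smul, ← map_sub]
  congr 1
  module

end Billiard


/-! ### Jets of the invariants of a trajectory along a line of velocities -/

section Invariants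

/-- The square root of a nonnegative quadratic polynomial with leading coefficient at most `1`. -/
theorem jetBound_sqrt_quadratic {A B C : ℝ} (hA : 0 < A) (hC : C ≤ 1)
    (h : B ^ 2 ≤ A * C) :
    JetBound (fun s : ℝ => √(A + 2 * B * s + C * s ^ 2)) √A 1 (1 / √A) := by
  have hp : HasJet (fun s : ℝ => A + 2 * B * s + C * s ^ 2) (2 * B) (2 * C) := by
    refine ⟨fun s => 2 * B + 2 * C * s, Eventually.of_forall fun s => ?_, by simp, ?_⟩
    · have := (((hasDerivAt_id s).const_mul (2 * B)).const_add A).add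
        ((hasDerivAt_pow 2 s).const_mul C)
      refine this.congr_deriv ?_
      push_cast
      ring
    · simpa using ((hasDerivAt_id (0 : ℝ)).const_mul (2 * C)).const_add (2 * B)
  have hA0 : A + 2 * B * 0 + C * 0 ^ 2 = A := by ring
  have h1 := hp.sqrt (by rw [hA0]; exact hA)
  simp only [hA0] at h1
  have hs : 0 < √A := Real.sqrt_pos.2 hA
  have hss : √A ^ 2 = A := Real.sq_sqrt hA.le
  -- The numerator AC - B² lies between 0 and A, which gives the bound 1/√A without any loss from
  -- the separate terms.
  have hq : 2 * C / (2 * √A) - (2 * B) ^ 2 / (4 * √A ^ 3) = (A * C - B ^ 2) / √A ^ 3 := by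
    field_simp
    rw [hss]
    ring
  refine ⟨by simp [abs_of_pos hs], _, _, ?_, ?_, h1⟩
  · rw [mul_div_mul_left _ _ two_ne_zero, norm_div, Real.norm_of_nonneg hs.le,
      div_le_one hs, Real.norm_eq_abs]
    exact Real.abs_le_sqrt (by nlinarith)
  · rw [hq, Real.norm_of_nonneg (div_nonneg (by linarith) (by positivity)),
      div_le_div_iff₀ (by positivity) hs]
    have : √A ^ 3 = A * √A := by rw [pow_succ, hss]
    rw [this, one_mul]
    exact mul_le_mul_of_nonneg_right (by nlinarith [sq_nonneg B]) hs.le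

variable {d : ℕ} {x v k : E d}

/-- The value is measured by D instead of |v|: for grazing trajectories D is much smaller, and that
gain is essential later. -/
theorem jetBound_inner_line (hx : ‖x‖ < 1) (hv : v ≠ 0) (hk : ‖k‖ ≤ 1) :
    JetBound (fun s : ℝ => ⟪x, v + s • k⟫) (disc x v) 1 0 := by
  have h := ((jetBound_line v k).mono le_rfl hk le_rfl).clm (innerSL ℝ x)
    (by rw [innerSL_apply_norm]; exact hx.le)
  simp only [innerSL_apply_apply] at h
  refine h.of_norm_le ?_
  simpa using (abs_inner_lt_disc hx hv).le

theorem jetBound_norm_sq_line (hk : ‖k‖ ≤ 1) :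
    JetBound (fun s : ℝ => ‖v + s • k‖ ^ 2) (‖v‖ ^ 2) (2 * ‖v‖) 2 := by
  have h := (jetBound_line v k).mono le_rfl hk le_rfl
  have h2 := h.inner h
  simp only [real_inner_self_eq_norm_sq] at h2
  exact h2.mono (by rw [sq]) (by linarith) (by linarith)

theorem inner_sq_le (x v : E d) : ⟪x, v⟫ ^ 2 ≤ ‖x‖ ^ 2 * ‖v‖ ^ 2 := by
  rw [← mul_pow]
  exact sq_le_sq.2 ((abs_real_inner_le_norm x v).trans (le_abs_self _))

theorem norm_line_sq (v k : E d) (s : ℝ) :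
    ‖v + s • k‖ ^ 2 = ‖v‖ ^ 2 + 2 * s * ⟪v, k⟫ + s ^ 2 * ‖k‖ ^ 2 := norm_add_smul_sq v k s

theorem inner_line (x v k : E d) (s : ℝ) : ⟪x, v + s • k⟫ = ⟪x, v⟫ + s * ⟪x, k⟫ := by
  rw [inner_add_right, real_inner_smul_right]

/-- D² is a nonnegative quadratic form in the velocity with norm at most 1. The discriminant
condition is the Cauchy–Schwarz inequality for this form. -/
theorem jetBound_disc_line (hx : ‖x‖ < 1) (hv : v ≠ 0) (hk : ‖k‖ ≤ 1) :
    JetBound (fun s : ℝ => disc x (v + s • k)) (disc x v) 1 (1 / disc x v) := by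
  have hδ := one_sub_norm_sq_pos hx
  have hD := disc_pos hx hv
  have hk2 : ‖k‖ ^ 2 ≤ 1 := pow_le_one₀ (norm_nonneg _) hk
  have h := jetBound_sqrt_quadratic (A := disc x v ^ 2)
    (B := ⟪x, v⟫ * ⟪x, k⟫ + (1 - ‖x‖ ^ 2) * ⟪v, k⟫)
    (C := ⟪x, k⟫ ^ 2 + (1 - ‖x‖ ^ 2) * ‖k‖ ^ 2) (by positivity)
    (by nlinarith [inner_sq_le x k]) (by
      rw [disc_sq hx]
      nlinarith [mul_le_mul_of_nonneg_left (inner_sq_le v k) (sq_nonneg (1 - ‖x‖ ^ 2)),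
        mul_nonneg hδ.le (sq_nonneg (⟪x, v⟫ * ‖k‖)),
        mul_nonneg hδ.le (real_inner_self_nonneg (x := ⟪x, v⟫ • k - ⟪x, k⟫ • v)),
        (by rw [real_inner_self_eq_norm_sq, norm_sub_sq_real, norm_smul, norm_smul, mul_pow,
          mul_pow, real_inner_smul_left, real_inner_smul_right, real_inner_comm v k,
          Real.norm_eq_abs, Real.norm_eq_abs, sq_abs, sq_abs]; ring :
          ⟪⟪x, v⟫ • k - ⟪x, k⟫ • v, ⟪x, v⟫ • k - ⟪x, k⟫ • v⟫ = ⟪x, v⟫ ^ 2 * ‖k‖ ^ 2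
            - 2 * ⟪x, v⟫ * ⟪x, k⟫ * ⟪v, k⟫ + ⟪x, k⟫ ^ 2 * ‖v‖ ^ 2)])
  rw [Real.sqrt_sq hD.le] at h
  convert h using 2 with s
  rw [disc_sq hx, disc, norm_line_sq, inner_line]
  congr 1
  ring

/-- The norm of the angular momentum `x ∧ v`. -/
noncomputable def angMom (x v : E d) : ℝ := √(‖x‖ ^ 2 * ‖v‖ ^ 2 - ⟪x, v⟫ ^ 2)

theorem angMom_nonneg (x v : E d) : 0 ≤ angMom x v := Real.sqrt_nonneg _

theorem angMom_sq (x v : E d) : angMom x v ^ 2 = ‖x‖ ^ 2 * ‖v‖ ^ 2 - ⟪x, v⟫ ^ 2 := by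
  rw [angMom, Real.sq_sqrt]
  linarith [inner_sq_le x v]

/-- The square of the angular momentum is again a nonnegative quadratic form, by Cauchy–Schwarz in
the Euclidean space. Its own Cauchy–Schwarz inequality is read off from the sign of the
discriminant. -/
theorem jetBound_angMom_line (hx : ‖x‖ < 1) (hv : 0 < angMom x v) (hk : ‖k‖ ≤ 1) :
    JetBound (fun s : ℝ => angMom x (v + s • k)) (angMom x v) 1 (1 / angMom x v) := by
  have hk2 : ‖k‖ ^ 2 ≤ 1 := pow_le_one₀ (norm_nonneg _) hk
  have hx2 : ‖x‖ ^ 2 ≤ 1 := pow_le_one₀ (norm_nonneg _) hx.le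
  have hform : ∀ (u w : E d) (t : ℝ), 0 ≤ angMom x u ^ 2 +
      2 * t * (‖x‖ ^ 2 * ⟪u, w⟫ - ⟪x, u⟫ * ⟪x, w⟫) + t ^ 2 * angMom x w ^ 2 := by
    intro u w t
    have := inner_sq_le x (u + t • w)
    rw [norm_line_sq, inner_line] at this
    rw [angMom_sq, angMom_sq]
    linarith
  have hCS : (‖x‖ ^ 2 * ⟪v, k⟫ - ⟪x, v⟫ * ⟪x, k⟫) ^ 2 ≤ angMom x v ^ 2 * angMom x k ^ 2 := by
    have := discrim_le_zero (a := angMom x k ^ 2)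
      (b := 2 * (‖x‖ ^ 2 * ⟪v, k⟫ - ⟪x, v⟫ * ⟪x, k⟫)) (c := angMom x v ^ 2)
      (fun t => by linarith [hform v k t])
    rw [discrim] at this
    linarith
  have h := jetBound_sqrt_quadratic (A := angMom x v ^ 2)
    (B := ‖x‖ ^ 2 * ⟪v, k⟫ - ⟪x, v⟫ * ⟪x, k⟫)
    (C := angMom x k ^ 2) (by positivity)
    (by rw [angMom_sq]; nlinarith [sq_nonneg ⟪x, k⟫]) hCS
  rw [Real.sqrt_sq hv.le] at h
  convert h using 2 with s
  rw [angMom_sq, angMom_sq, angMom, norm_line_sq, inner_line]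
  congr 1
  ring

theorem angMom_sq_add_disc_sq (hx : ‖x‖ < 1) (v : E d) :
    angMom x v ^ 2 + disc x v ^ 2 = ‖v‖ ^ 2 := by
  rw [angMom_sq, disc_sq hx]
  ring

theorem disc_le_norm (hx : ‖x‖ < 1) (v : E d) : disc x v ≤ ‖v‖ := by
  rw [← sq_le_sq₀ (disc_nonneg x v) (norm_nonneg v), ← angMom_sq_add_disc_sq hx]
  linarith [sq_nonneg (angMom x v)]

theorem eventually_line_ne_zero (hv : v ≠ 0) (k : E d) : ∀ᶠ s : ℝ in 𝓝 0, v + s • k ≠ 0 := by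
  have : Continuous fun s : ℝ => v + s • k := by fun_prop
  exact this.continuousAt.eventually_ne (by simpa using hv)

end Invariants

/-! ### Bounds for the jets of the branches -/

section Regimes

variable {d : ℕ} {x v k : E d}

/-- A second order jet whose second derivative is bounded up to a radial part that is controlled
by the distance to the unit sphere. -/
def TameJet (η : ℝ → E d) (K : ℝ) : Prop :=
  ∃ m q, HasJet η m q ∧ ‖m‖ ^ 2 ≤ K ∧
    ∃ (α : ℝ) (w : E d), q = α • η 0 + w ∧ |α| * (1 - ‖η 0‖ ^ 2) ≤ K ∧ ‖w‖ ≤ K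

theorem TameJet.congr {η η' : ℝ → E d} {K : ℝ} (h : TameJet η K) (h' : η' =ᶠ[𝓝 0] η) :
    TameJet η' K := by
  obtain ⟨m, q, h1, h2, α, w, h3, h4, h5⟩ := h
  have h0 := h'.self_of_nhds
  exact ⟨m, q, h1.congr h', h2, α, w, by rw [h0, h3], by rwa [h0], h5⟩

theorem TameJet.mono {η : ℝ → E d} {K K' : ℝ} (h : TameJet η K) (h' : K ≤ K') :
    TameJet η K' := by
  obtain ⟨m, q, h1, h2, α, w, h3, h4, h5⟩ := h
  exact ⟨m, q, h1, h2.trans h', α, w, h3, h4.trans h', h5.trans h'⟩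

theorem JetBound.tameJet {η : ℝ → E d} {a b c K : ℝ} (h : JetBound η a b c) (hb : b ^ 2 ≤ K)
    (hc : c ≤ K) : TameJet η K := by
  have h0 := h.nonneg
  obtain ⟨-, m, q, h1, h2, h3⟩ := h
  refine ⟨m, q, h3, (pow_le_pow_left₀ (norm_nonneg _) h1 2).trans hb, 0, q, by simp, ?_,
    h2.trans hc⟩
  simpa using (sq_nonneg b).trans hb

theorem branch_zero (x v : E d) : branch 0 x v = x + v := by
  simp [branch]

theorem tameJet_branch_zero (x v : E d) (hk : ‖k‖ ≤ 1) :
    TameJet (fun s : ℝ => branch 0 x (v + s • k)) 1 := by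
  have h := (jetBound_const x).add ((jetBound_line v k).mono le_rfl hk le_rfl)
  refine (h.tameJet (by norm_num) (by norm_num)).congr (Eventually.of_forall fun s => ?_)
  simp only [branch_zero]

/-- The reflection formula with a factor `P` that is small together with the distance of the end
point to the sphere. -/
theorem tameJet_of_reflection {P : ℝ → ℝ} {z : ℝ → E d} {r D : ℝ} (hr : 0 < r) (hr1 : r ≤ 1)
    (hD : 0 < D) (hDr : D ≤ r) (hk : ‖k‖ ≤ 1) (hP : JetBound P D 3 (14 / D))
    (hz : JetBound z 1 (3 / (D / r)) (13 / (D * (D / r))))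
    (hdiff : ‖z 0 - (x + (v + (0 : ℝ) • k + (-2 : ℝ) • P 0 • z 0))‖ ≤ r)
    (hμ0 : 0 ≤ 1 - ‖x + (v + (0 : ℝ) • k + (-2 : ℝ) • P 0 • z 0)‖ ^ 2)
    (hμ : 1 - ‖x + (v + (0 : ℝ) • k + (-2 : ℝ) • P 0 • z 0)‖ ^ 2 ≤ 2 * D) :
    TameJet (fun s : ℝ => x + (v + s • k + (-2 : ℝ) • P s • z s)) (200 / (D / r)) := by
  obtain ⟨hP0, p1, p2, hp1, hp2, hP⟩ := hP
  obtain ⟨hz0, z1, z2, hz1, hz2, hz⟩ := hz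
  have hη := (hasJet_const x).add ((hasJet_line v k).add ((hasJet_const (-2 : ℝ)).smul
    (hP.smul hz)))
  simp only [smul_zero, zero_smul, add_zero, zero_add] at hη
  obtain ⟨σ, hσ⟩ : ∃ σ, σ = D / r := ⟨_, rfl⟩
  rw [← hσ] at hz1 hz2 ⊢
  have hσ0 : 0 < σ := by rw [hσ]; positivity
  have hσ1 : σ ≤ 1 := by rw [hσ, div_le_one hr]; exact hDr
  have hrD : r * σ = D := by rw [hσ]; field_simp
  have hinv : 1 ≤ 1 / σ := by rw [le_div_iff₀ hσ0]; linarith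
  set y := x + (v + (0 : ℝ) • k + (-2 : ℝ) • P 0 • z 0) with hy
  -- The dangerous term is -2P''z with P'' of order 1/D. Replacing the impact point z by the end
  -- point y makes it radial, where 1 - |y|² ≤ 2D compensates; the error is P''(z - y), of order
  -- r/D.
  refine ⟨_, _, hη, ?_, -2 * p2,
    (-2 : ℝ) • (P 0 • z2 + (2 : ℝ) • p1 • z1) + (-2 * p2) • (z 0 - y), ?_, ?_, ?_⟩
  · have h1 : ‖P 0 • z1 + p1 • z 0‖ ≤ 6 := by
      refine (norm_add_le _ _).trans ?_
      rw [norm_smul, norm_smul]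
      calc ‖P 0‖ * ‖z1‖ + ‖p1‖ * ‖z 0‖ ≤ D * (3 / σ) + 3 * 1 := by gcongr
        _ = 3 * r + 3 := by rw [← hrD]; field_simp
        _ ≤ 6 := by linarith
    have h2 : ‖k + (-2 : ℝ) • (P 0 • z1 + p1 • z 0)‖ ≤ 13 := by
      refine (norm_add_le _ _).trans ?_
      rw [norm_smul, norm_neg, Real.norm_ofNat]
      linarith
    calc _ ≤ (13 : ℝ) ^ 2 := pow_le_pow_left₀ (norm_nonneg _) h2 2
      _ ≤ 200 * (1 / σ) := by linarith
      _ = 200 / σ := by ring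
  · module
  · rw [abs_mul, abs_neg, Nat.abs_ofNat]
    calc 2 * |p2| * (1 - ‖y‖ ^ 2) ≤ 2 * (14 / D) * (2 * D) := by
          gcongr
          simpa using hp2
      _ = 56 := by field_simp; norm_num
      _ ≤ 200 * (1 / σ) := by linarith
      _ = 200 / σ := by ring
  · refine (norm_add_le _ _).trans ?_
    rw [norm_smul, norm_smul]
    have h1 : ‖P 0 • z2 + (2 : ℝ) • p1 • z1‖ ≤ 31 / σ := by
      refine (norm_add_le _ _).trans ?_
      rw [norm_smul, norm_smul, norm_smul, Real.norm_ofNat]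
      calc ‖P 0‖ * ‖z2‖ + 2 * (‖p1‖ * ‖z1‖) ≤ D * (13 / (D * σ)) + 2 * (3 * (3 / σ)) := by
            gcongr
        _ = 31 / σ := by field_simp; norm_num
    have h2 : ‖-2 * p2‖ * ‖z 0 - y‖ ≤ 28 / σ := by
      rw [norm_mul, norm_neg, Real.norm_ofNat]
      calc 2 * ‖p2‖ * ‖z 0 - y‖ ≤ 2 * (14 / D) * r := by gcongr
        _ = 28 / σ := by rw [← hrD]; field_simp; norm_num
    rw [norm_neg, Real.norm_ofNat]
    calc _ ≤ 2 * (31 / σ) + 28 / σ := by gcongr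
      _ = 90 / σ := by ring
      _ ≤ 200 / σ := by gcongr; norm_num

/-- One reflection of a slow particle. -/
theorem tameJet_branch_one (hx : ‖x‖ < 1) (hv : v ≠ 0) (hk : ‖k‖ ≤ 1)
    (hslow : ‖v‖ ^ 2 < disc x v) (hreg : |⟪x, v⟫ + ‖v‖ ^ 2 - 2 * disc x v| ≤ disc x v) :
    TameJet (fun s : ℝ => branch 1 x (v + s • k)) (200 / (disc x v / ‖v‖)) := by
  have hr : 0 < ‖v‖ := norm_pos_iff.2 hv
  have hD := disc_pos hx hv
  have hDr := disc_le_norm hx v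
  have hr1 : ‖v‖ < 1 := by nlinarith
  have hb := abs_lt.1 (abs_inner_lt_disc hx hv)
  have hδ := one_sub_norm_sq_pos hx
  have hreg' := abs_le.1 hreg
  set r := ‖v‖ with hrdef
  set D := disc x v with hDdef
  set b := ⟪x, v⟫ with hbdef
  set δ := 1 - ‖x‖ ^ 2 with hδdef
  have hδt : δ * r ^ 2 = (D - b) * (D + b) := by
    linear_combination -disc_sq hx (v := v)
  -- A slow particle that has been reflected was moving outwards, so b ≥ 0. This makes δ/(D + b) a
  -- good form of the impact time (D - b)/r²: its denominator is at least D, and r² does not appear.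
  have hg : D ≤ D + b := by linarith
  -- the time of the first impact
  have jg := (jetBound_disc_line hx hv hk).add (jetBound_inner_line hx hv hk)
  rw [← hDdef] at jg
  have jt : JetBound (fun s : ℝ => δ * (disc x (v + s • k) + ⟪x, v + s • k⟫)⁻¹)
      1 (2 / D) (9 / D ^ 2) := by
    obtain ⟨g, hgdef⟩ : ∃ g, g = D + b := ⟨_, rfl⟩
    rw [← hgdef] at hg
    have hg0 : 0 < g := hD.trans_le hg
    have h := (jg.inv (n := g) hg0 (by
      simp only [zero_smul, add_zero]
      rw [← hDdef, ← hbdef, hgdef]; exact le_abs_self _)).const_mul δ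
    rw [abs_of_pos hδ] at h
    have e1 : δ * (1 / g) ≤ 1 := by
      rw [mul_one_div, div_le_one hg0, hgdef]
      nlinarith
    have e1' : 0 ≤ δ * (1 / g) := by positivity
    refine h.mono e1 ?_ ?_
    · calc δ * ((1 + 1) / g ^ 2) = δ * (1 / g) * (2 / g) := by
            field_simp; norm_num
        _ ≤ 1 * (2 / D) := by gcongr
        _ = 2 / D := one_mul _
    · calc δ * (2 * (1 + 1) ^ 2 / g ^ 3 + (1 / D + 0) / g ^ 2)
          = δ * (1 / g) * (8 / g ^ 2 + 1 / D / g) := by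
            field_simp
            ring
        _ ≤ 1 * (8 / D ^ 2 + 1 / D / D) := by gcongr
        _ = 9 / D ^ 2 := by field_simp; norm_num
  have ht0 : δ * (D + b)⁻¹ = (D - b) / r ^ 2 := by
    rw [eq_div_iff (by positivity), ← div_eq_mul_inv, div_mul_eq_mul_div, div_eq_iff (by linarith)]
    exact hδt
  have ht0' : 0 ≤ δ * (D + b)⁻¹ := by
    have : 0 < D + b := by linarith
    positivity
  have ht1 : δ * (D + b)⁻¹ ≤ 1 := by
    rw [ht0, div_le_one (by positivity)]
    linarith
  have jl : JetBound (fun s : ℝ => 1 - δ * (disc x (v + s • k) + ⟪x, v + s • k⟫)⁻¹)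
      1 (2 / D) (9 / D ^ 2) := by
    refine (((jetBound_const (1 : ℝ)).sub jt).of_norm_le (a' := 1) ?_).mono le_rfl (by simp)
      (by simp)
    simp only [zero_smul, add_zero]
    rw [← hDdef, ← hbdef, Real.norm_of_nonneg (by linarith)]
    linarith
  have jP : JetBound (fun s : ℝ => disc x (v + s • k) *
      (1 - δ * (disc x (v + s • k) + ⟪x, v + s • k⟫)⁻¹)) D 3 (14 / D) := by
    refine ((jetBound_disc_line hx hv hk).mul jl).mono ?_ ?_ ?_ <;> rw [← hDdef] <;>
      apply le_of_eq <;> field_simp <;> norm_num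
  have jz : JetBound (fun s : ℝ => x + (δ * (disc x (v + s • k) + ⟪x, v + s • k⟫)⁻¹) •
      (v + s • k)) 1 (3 / (D / r)) (13 / (D * (D / r))) := by
    refine (((jetBound_const x).add (jt.smul ((jetBound_line v k).mono le_rfl hk
      le_rfl))).of_norm_le ?_).mono le_rfl ?_ ?_
    · simp only [zero_smul, add_zero]
      rw [← hDdef, ← hbdef, ht0]
      exact (norm_exitPoint hx hv).le
    · rw [← hrdef]
      have : 1 ≤ r / D := by rw [one_le_div hD]; exact hDr
      calc 0 + (1 * 1 + 2 / D * r) = 1 + 2 * (r / D) := by ring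
        _ ≤ r / D + 2 * (r / D) := by linarith
        _ = _ := by field_simp; norm_num
    · rw [← hrdef]
      have : 1 ≤ r / D := by rw [one_le_div hD]; exact hDr
      calc 0 + (1 * 0 + 2 * (2 / D * 1) + 9 / D ^ 2 * r) = (4 + 9 * (r / D)) / D := by
            field_simp; ring
        _ ≤ (4 * (r / D) + 9 * (r / D)) / D := by gcongr; linarith
        _ = _ := by field_simp; norm_num
  have hEq : (fun s : ℝ => branch 1 x (v + s • k)) =ᶠ[𝓝 0] fun s : ℝ => x + (v + s • k +
      (-2 : ℝ) • (disc x (v + s • k) * (1 - δ * (disc x (v + s • k) + ⟪x, v + s • k⟫)⁻¹)) •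
        (x + (δ * (disc x (v + s • k) + ⟪x, v + s • k⟫)⁻¹) • (v + s • k))) := by
    filter_upwards [eventually_line_ne_zero hv k] with s hs
    have hc : ‖v + s • k‖ ≠ 0 := norm_ne_zero_iff.2 hs
    have h1 := abs_lt.1 (abs_inner_lt_disc hx hs)
    have h2 : δ * (disc x (v + s • k) + ⟪x, v + s • k⟫)⁻¹ =
        (disc x (v + s • k) - ⟪x, v + s • k⟫) / ‖v + s • k‖ ^ 2 := by
      rw [eq_div_iff (by positivity), ← div_eq_mul_inv, div_mul_eq_mul_div,
        div_eq_iff (by linarith)]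
      linear_combination -disc_sq hx (v := v + s • k)
    have h3 := branch_succ_sub hx hs 0
    rw [h2, ← exitPoint]
    rw [zero_add] at h3
    rw [h3, branch_zero, pow_zero, one_apply_eq_self]
    rw [Nat.cast_zero]
    match_scalars <;> first | ring1 | (field_simp; ring1)
  have hEq0 := hEq.self_of_nhds
  simp only [zero_smul, add_zero] at hEq0
  rw [← hDdef, ← hbdef] at hEq0
  set t := δ * (D + b)⁻¹ with htdef
  set z := x + t • v with hzdef
  have hzv : ⟪z, v⟫ = D := by rw [hzdef, ht0]; exact inner_exitPoint hv
  have hz1' : ‖z‖ = 1 := by rw [hzdef, ht0]; exact norm_exitPoint hx hv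
  -- The particle travels from z to the end point at speed r during the remaining time 1 - t ≤ 1.
  have hdiff : ‖z - branch 1 x v‖ ≤ r := by
    have h1 : z - branch 1 x v = (1 - t) • ((2 * D) • z - v) := by
      rw [hEq0, hzdef]
      module
    have h2 : ‖(2 * D) • z - v‖ ^ 2 = r ^ 2 := by
      rw [norm_sub_sq_real, norm_smul, hz1', real_inner_smul_left, hzv,
        Real.norm_of_nonneg (by positivity)]
      ring
    have h3 : ‖(2 * D) • z - v‖ = r := by
      rwa [sq_eq_sq₀ (norm_nonneg _) hr.le] at h2
    rw [h1, norm_smul, h3, Real.norm_of_nonneg (by linarith)]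
    nlinarith
  have hμ : 1 - ‖branch 1 x v‖ ^ 2 ≤ 2 * D := by
    rw [one_sub_norm_branch_sq hx hv 1, ← hrdef, ← hDdef, ← hbdef, div_le_iff₀ (by positivity)]
    push_cast
    -- With e = b + r² - 2D, factor D² - e² = (D - e)(D + e); here D - e ≤ 2D by activity of the
    -- branch and D + e ≤ r² because b ≤ D.
    nlinarith
  have hμ0 : 0 ≤ 1 - ‖branch 1 x v‖ ^ 2 := by
    have := norm_branch_le_one hx hv (N := 1) (by rw [Nat.cast_one, mul_one]; exact hreg)
    nlinarith [norm_nonneg (branch 1 x v)]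
  refine (tameJet_of_reflection hr hr1.le hD hDr hk jP jz ?_ ?_ ?_).congr hEq <;>
    simp only [zero_smul, add_zero] <;> rw [← hDdef, ← hbdef, ← hEq0]
  exacts [hdiff, hμ0, hμ]

end Regimes


/-! ### Chords close to the centre: jets of the isometry and of its powers -/

section SteepChords

variable {d : ℕ} {x v k : E d}

section RankOne

variable {V : Type*} [NormedAddCommGroup V] [InnerProductSpace ℝ V]

theorem JetBound.rankOne {f g : ℝ → V} {a b c a' b' c' : ℝ} (hf : JetBound f a b c)
    (hg : JetBound g a' b' c') : JetBound (fun s => (innerSL ℝ (f s)).smulRight (g s)) (a * a')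
      (a * b' + b * a') (a * c' + 2 * (b * b') + c * a') := by
  refine hf.bilin ((ContinuousLinearMap.smulRightL ℝ V V).comp (innerSL ℝ)) ?_ hg
  refine ContinuousLinearMap.opNorm_le_bound₂ _ zero_le_one fun u w => ?_
  rw [one_mul]
  exact (ContinuousLinearMap.norm_smulRight_apply _ _).trans_le (mul_le_mul_of_nonneg_right
    (innerSL_apply_norm (𝕜 := ℝ) u).le (norm_nonneg w))

theorem JetBound.clm_mul {f g : ℝ → V →L[ℝ] V} {a b c a' b' c' : ℝ} (hf : JetBound f a b c)
    (hg : JetBound g a' b' c') : JetBound (fun s => f s * g s) (a * a')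
      (a * b' + b * a') (a * c' + 2 * (b * b') + c * a') :=
  hf.bilin (ContinuousLinearMap.mul ℝ (V →L[ℝ] V)) (ContinuousLinearMap.opNorm_mul_le ℝ _) hg

theorem JetBound.clm_pow [Nontrivial V] {f : ℝ → V →L[ℝ] V} {b c : ℝ} (hf : JetBound f 1 b c)
    (n : ℕ) : JetBound (fun s => f s ^ n) 1 (n * b) (n * c + n ^ 2 * b ^ 2) :=
  hf.pow n

theorem JetBound.clm_apply {f : ℝ → V →L[ℝ] V} {g : ℝ → V} {a b c a' b' c' : ℝ}
    (hf : JetBound f a b c) (hg : JetBound g a' b' c') : JetBound (fun s => f s (g s)) (a * a')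
      (a * b' + b * a') (a * c' + 2 * (b * b') + c * a') :=
  hf.bilin (ContinuousLinearMap.id ℝ (V →L[ℝ] V)) ContinuousLinearMap.norm_id_le hg

end RankOne

theorem norm_householder_le {κ : ℝ} {z : E d} (h : κ ^ 2 * ‖z‖ ^ 2 = 2 * κ) :
    ‖householder κ z‖ ≤ 1 := by
  refine ContinuousLinearMap.opNorm_le_bound _ zero_le_one fun u => ?_
  rw [one_mul, ← sq_le_sq₀ (norm_nonneg _) (norm_nonneg _), ← real_inner_self_eq_norm_sq,
    ← real_inner_self_eq_norm_sq, inner_householder h]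

theorem JetBound.householder {κ : ℝ → ℝ} {z : ℝ → E d} {b c : ℝ}
    (h : JetBound (fun s => κ s • (innerSL ℝ (z s)).smulRight (z s)) 2 b c)
    (h0 : κ 0 ^ 2 * ‖z 0‖ ^ 2 = 2 * κ 0) :
    JetBound (fun s => householder (κ s) (z s)) 1 b c :=
  (((jetBound_const (ContinuousLinearMap.id ℝ (E d))).sub h).of_norm_le
    (norm_householder_le h0)).mono le_rfl (by simp) (by simp)

/-- Jets of chord reflections for trajectories at distance at most `1/2` from the centre. -/
theorem jetBound_chordRot (hx : ‖x‖ < 1) (hv : v ≠ 0) (hk : ‖k‖ ≤ 1)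
    (hD2 : ‖v‖ / 2 ≤ disc x v) :
    JetBound (fun s : ℝ => chordRot x (v + s • k)) 1 (40 / ‖v‖) (976 / ‖v‖ ^ 2) := by
  have hr : 0 < ‖v‖ := norm_pos_iff.2 hv
  have hDr := disc_le_norm hx v
  have hD := disc_pos hx hv
  have jv := (jetBound_line v k).mono le_rfl hk le_rfl
  have jc := (jetBound_norm_sq_line (v := v) hk).inv (n := ‖v‖ ^ 2) (by positivity)
    (by simp)
  have jD : JetBound (fun s : ℝ => disc x (v + s • k)) ‖v‖ 1 (2 / ‖v‖) :=
    (jetBound_disc_line hx hv hk).mono hDr le_rfl (by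
      rw [div_le_div_iff₀ hD hr]; linarith)
  have jb := (jetBound_inner_line hx hv hk).mono hDr le_rfl le_rfl
  have jt : JetBound (fun s : ℝ => (disc x (v + s • k) - ⟪x, v + s • k⟫) / ‖v + s • k‖ ^ 2)
      (2 / ‖v‖) (6 / ‖v‖ ^ 2) (30 / ‖v‖ ^ 3) := by
    simp only [div_eq_mul_inv (_ - _)]
    refine ((jD.sub jb).mul jc).mono ?_ ?_ ?_ <;> apply le_of_eq <;> field_simp <;> norm_num
  have jz : JetBound (fun s : ℝ => exitPoint x (v + s • k)) 1 (8 / ‖v‖) (42 / ‖v‖ ^ 2) := by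
    refine (((jetBound_const x).add (jt.smul jv)).of_norm_le ?_).mono le_rfl ?_ ?_
    · simp only [zero_smul, add_zero]
      exact (norm_exitPoint hx hv).le
    all_goals apply le_of_eq; field_simp; norm_num
  have jH1 : JetBound (fun s : ℝ => householder 2 (exitPoint x (v + s • k))) 1 (32 / ‖v‖)
      (424 / ‖v‖ ^ 2) := by
    refine JetBound.householder (κ := fun _ => 2) ?_ ?_
    · refine ((jetBound_const (2 : ℝ)).smul (jz.rankOne jz)).mono ?_ ?_ ?_
        <;> rw [Real.norm_ofNat] <;> apply le_of_eq <;> field_simp <;> norm_num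
    · simp only [zero_smul, add_zero]
      rw [norm_exitPoint hx hv]
      norm_num
  have jH2 : JetBound (fun s : ℝ => householder (2 / ‖v + s • k‖ ^ 2) (v + s • k)) 1 (8 / ‖v‖)
      (40 / ‖v‖ ^ 2) := by
    refine JetBound.householder (κ := fun s => 2 / ‖v + s • k‖ ^ 2) ?_ ?_
    · have h := (jc.const_mul 2).smul (jv.rankOne jv)
      simp only [← div_eq_mul_inv] at h
      refine h.mono ?_ ?_ ?_
        <;> rw [Nat.abs_ofNat] <;> apply le_of_eq <;> field_simp <;> norm_num
    · simp only [zero_smul, add_zero]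
      field_simp
  have h := (jH1.clm_mul jH2).neg
  refine h.mono ?_ ?_ ?_ <;> apply le_of_eq <;> field_simp <;> norm_num

/-- Many reflections of a fast particle that moves along chords close to the centre. -/
theorem tameJet_branch_of_steep (hx : ‖x‖ < 1) (hv : v ≠ 0) (hk : ‖k‖ ≤ 1) {N : ℕ}
    (hD2 : ‖v‖ * (4 / 5) ≤ disc x v) (hr1 : 4 / 5 ≤ ‖v‖) (hN : (N : ℝ) ≤ 2 * ‖v‖)
    (hreg : |⟪x, v⟫ + ‖v‖ ^ 2 - 2 * N * disc x v| ≤ disc x v) :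
    TameJet (fun s : ℝ => branch N x (v + s • k)) 15000 := by
  have hr : 0 < ‖v‖ := norm_pos_iff.2 hv
  have hDr := disc_le_norm hx v
  have hD := disc_pos hx hv
  have : Nontrivial (E d) := ⟨v, 0, hv⟩
  have hN0 : (0 : ℝ) ≤ N := Nat.cast_nonneg N
  have jv := (jetBound_line v k).mono le_rfl hk le_rfl
  have jc := (jetBound_norm_sq_line (v := v) hk).inv (n := ‖v‖ ^ 2) (by positivity)
    (by simp)
  have jD : JetBound (fun s : ℝ => disc x (v + s • k)) ‖v‖ 1 (2 / ‖v‖) :=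
    (jetBound_disc_line hx hv hk).mono hDr le_rfl (by
      rw [div_le_div_iff₀ hD hr]; linarith)
  have hinv : 1 / ‖v‖ ≤ 5 / 4 := by rw [div_le_div_iff₀ hr (by norm_num)]; linarith
  -- Each derivative of R costs a factor 1/r while N is at most 2r, so the derivatives of R^N remain
  -- bounded.
  have jR : JetBound (fun s : ℝ => chordRot x (v + s • k) ^ N) 1 80 9000 := by
    refine ((jetBound_chordRot hx hv hk (by linarith)).clm_pow N).mono le_rfl ?_ ?_
    · calc (N : ℝ) * (40 / ‖v‖) ≤ 2 * ‖v‖ * (40 / ‖v‖) := by gcongr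
        _ = 80 := by field_simp; norm_num
    · calc (N : ℝ) * (976 / ‖v‖ ^ 2) + N ^ 2 * (40 / ‖v‖) ^ 2
          ≤ 2 * ‖v‖ * (976 / ‖v‖ ^ 2) + (2 * ‖v‖) ^ 2 * (40 / ‖v‖) ^ 2 := by gcongr
        _ = 1952 * (1 / ‖v‖) + 6400 := by field_simp; ring
        _ ≤ 9000 := by linarith
  have jq : JetBound (fun s : ℝ => 1 - 2 * N * disc x (v + s • k) / ‖v + s • k‖ ^ 2) 5
      (12 / ‖v‖) (64 / ‖v‖ ^ 2) := by
    have h := (jetBound_const (1 : ℝ)).sub ((jD.mul jc).const_mul (2 * N))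
    have h2N : |2 * (N : ℝ)| ≤ 4 * ‖v‖ := by rw [abs_of_nonneg (by positivity)]; linarith
    have key : ∀ A B : ℝ, 0 ≤ A → 4 * ‖v‖ * A ≤ B → |2 * (N : ℝ)| * A ≤ B := fun A B hA hB =>
      (mul_le_mul_of_nonneg_right h2N hA).trans hB
    simp only [← div_eq_mul_inv, ← mul_div_assoc] at h
    refine h.mono ?_ ?_ ?_
    · rw [norm_one, mul_div_assoc]
      have := key (‖v‖ * 1 / ‖v‖ ^ 2) 4 (by positivity) (by apply le_of_eq; field_simp)
      linarith
    · rw [zero_add]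
      refine key _ _ (by positivity) (by apply le_of_eq; field_simp; norm_num)
    · rw [zero_add]
      refine key _ _ (by positivity) (by apply le_of_eq; field_simp; norm_num)
  have jξ : JetBound (fun s : ℝ => x + (1 - 2 * N * disc x (v + s • k) / ‖v + s • k‖ ^ 2) •
      (v + s • k)) 1 17 110 := by
    refine (((jetBound_const x).add (jq.smul jv)).of_norm_le ?_).mono le_rfl ?_ ?_
    · simp only [zero_smul, add_zero]
      rw [← norm_chordRot_pow hx hv N]
      exact norm_branch_le_one hx hv hreg
    · apply le_of_eq
      field_simp
      norm_num
    · calc 0 + (5 * 0 + 2 * (12 / ‖v‖ * 1) + 64 / ‖v‖ ^ 2 * ‖v‖) = 88 * (1 / ‖v‖) := by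
            field_simp; norm_num
        _ ≤ 110 := by linarith
  have h := jR.clm_apply jξ
  exact h.tameJet (by norm_num) (by norm_num)

end SteepChords


/-! ### Polar coordinates for grazing trajectories -/

section Polar

/-- The unit complex number in the direction of `l + i p`. -/
noncomputable def unitC (p l : ℝ) : ℂ := (l + p * Complex.I) / (√(p ^ 2 + l ^ 2) : ℝ)

theorem norm_unitC {p l : ℝ} (hl : 0 < l) : ‖unitC p l‖ = 1 := by
  have h : (0 : ℝ) < √(p ^ 2 + l ^ 2) := Real.sqrt_pos.2 (by positivity)
  rw [unitC, norm_div, Complex.norm_add_mul_I, Complex.norm_real, Real.norm_of_nonneg h.le,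
    add_comm (l ^ 2), div_self h.ne']

theorem norm_unitC_sub_one_le {p l : ℝ} (hl : 0 < l) : ‖unitC p l - 1‖ ≤ 2 * |p| / l := by
  have h : (0 : ℝ) < √(p ^ 2 + l ^ 2) := Real.sqrt_pos.2 (by positivity)
  have h1 : l ≤ √(p ^ 2 + l ^ 2) := Real.le_sqrt_of_sq_le (by linarith [sq_nonneg p])
  have h2 : √(p ^ 2 + l ^ 2) ≤ |p| + l := by
    rw [Real.sqrt_le_left (by positivity), add_sq, sq_abs]
    nlinarith [abs_nonneg p]
  have h3 : unitC p l - 1 =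
      (((l - √(p ^ 2 + l ^ 2) : ℝ) : ℂ) + p * Complex.I) / (√(p ^ 2 + l ^ 2) : ℝ) := by
    rw [unitC, div_sub_one (by exact_mod_cast h.ne')]
    push_cast
    ring
  rw [h3, norm_div, Complex.norm_real, Real.norm_of_nonneg h.le]
  have h4 : ‖((l - √(p ^ 2 + l ^ 2) : ℝ) : ℂ) + p * Complex.I‖ ≤ 2 * |p| := by
    refine (norm_add_le _ _).trans ?_
    rw [norm_mul, Complex.norm_I, mul_one, Complex.norm_real, Complex.norm_real,
      Real.norm_eq_abs, Real.norm_eq_abs, abs_of_nonpos (by linarith)]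
    linarith
  gcongr

/-- The argument of l + ip moves with angular velocity (p'l - pl')/(p² + l²). Phases are
differentiated through these Wronskians, which avoids a choice of the argument. -/
theorem hasDerivAt_unitC {p l p' l' : ℝ → ℝ} {s : ℝ} (hl : 0 < l s)
    (hp' : HasDerivAt p (p' s) s) (hl' : HasDerivAt l (l' s) s) :
    HasDerivAt (fun s => unitC (p s) (l s))
      (((p' s * l s - p s * l' s) / (p s ^ 2 + l s ^ 2) : ℝ) *
        (Complex.I * unitC (p s) (l s))) s := by
  have hpos : 0 < p s ^ 2 + l s ^ 2 := by positivity
  have hn : (0 : ℝ) < √(p s ^ 2 + l s ^ 2) := Real.sqrt_pos.2 hpos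
  have hns : √(p s ^ 2 + l s ^ 2) ^ 2 = p s ^ 2 + l s ^ 2 := Real.sq_sqrt hpos.le
  have h1 := ((hp'.pow 2).add (hl'.pow 2)).sqrt hpos.ne'
  have h2 := (hl'.ofReal_comp.add (hp'.ofReal_comp.mul_const Complex.I)).div h1.ofReal_comp
    (by exact_mod_cast hn.ne')
  refine h2.congr_deriv ?_
  simp only [Pi.add_apply, Pi.pow_apply, unitC]
  have hnsC : ((√(p s ^ 2 + l s ^ 2) : ℝ) : ℂ) ^ 2 = (p s : ℂ) ^ 2 + (l s : ℂ) ^ 2 := by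
    exact_mod_cast hns
  generalize √(p s ^ 2 + l s ^ 2) = n at *
  rw [← hns]
  have hn0 : (n : ℂ) ≠ 0 := by exact_mod_cast hn.ne'
  push_cast
  field_simp
  rw [hnsC]
  ring_nf
  rw [Complex.I_sq]
  ring

theorem hasDerivAt_mul_phase {f g : ℝ → ℂ} {a b s : ℝ}
    (hf : HasDerivAt f (a * (Complex.I * f s)) s) (hg : HasDerivAt g (b * (Complex.I * g s)) s) :
    HasDerivAt (fun s => f s * g s) ((a + b : ℝ) * (Complex.I * (f s * g s))) s := by
  refine (hf.mul hg).congr_deriv ?_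
  push_cast
  ring

theorem hasDerivAt_pow_phase {f : ℝ → ℂ} {a s : ℝ}
    (hf : HasDerivAt f (a * (Complex.I * f s)) s) (n : ℕ) :
    HasDerivAt (fun s => f s ^ n) ((n * a : ℝ) * (Complex.I * f s ^ n)) s := by
  induction n with
  | zero => simpa using hasDerivAt_const s (1 : ℂ)
  | succ n ih =>
    simp only [pow_succ]
    convert hasDerivAt_mul_phase ih hf using 2
    push_cast
    ring

theorem norm_mul_sub_one_le {f g : ℂ} (hf : ‖f‖ = 1) : ‖f * g - 1‖ ≤ ‖f - 1‖ + ‖g - 1‖ := by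
  have : f * g - 1 = (f - 1) + f * (g - 1) := by ring
  rw [this]
  refine (norm_add_le _ _).trans ?_
  rw [norm_mul, hf, one_mul]

theorem norm_pow_sub_one_le {f : ℂ} (hf : ‖f‖ = 1) (n : ℕ) : ‖f ^ n - 1‖ ≤ n * ‖f - 1‖ := by
  induction n with
  | zero => simp
  | succ n ih =>
    rw [pow_succ']
    refine (norm_mul_sub_one_le hf).trans ?_
    push_cast
    linarith

variable {d : ℕ} {x v k : E d}

/-- The position on the final chord, relative to its midpoint, times the speed. -/
noncomputable def chordPos (N : ℕ) (x v : E d) : ℝ := ⟪x, v⟫ + ‖v‖ ^ 2 - 2 * N * disc x v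

/-- The direction of the end point of a branch in the plane of motion. -/
noncomputable def polarDir (N : ℕ) (x v : E d) : ℂ :=
  unitC (disc x v) (angMom x v) ^ (2 * N) * (unitC (chordPos N x v) (angMom x v) *
    unitC (-⟪x, v⟫) (angMom x v))

/-- One minus the squared radius of the end point of a branch. -/
noncomputable def radialGap (N : ℕ) (x v : E d) : ℝ :=
  (disc x v ^ 2 - chordPos N x v ^ 2) / ‖v‖ ^ 2

/-- The unit vector in the plane of motion orthogonal to the initial position. -/
noncomputable def transDir (x v : E d) : E d :=
  (‖x‖ * angMom x v)⁻¹ • (‖x‖ ^ 2 • v - ⟪x, v⟫ • x)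

/-- The vector is the midpoint of the chord through x, that is, the entry point plus half the chord,
and R is known on both summands. Together with v it spans the plane of motion when the angular
momentum is positive. -/
theorem chordRot_apply_orth (hx : ‖x‖ < 1) (hv : v ≠ 0) :
    chordRot x v (x - (⟪x, v⟫ / ‖v‖ ^ 2) • v) =
      (1 - 2 * disc x v ^ 2 / ‖v‖ ^ 2) • (x - (⟪x, v⟫ / ‖v‖ ^ 2) • v) +
        (2 * disc x v / ‖v‖ ^ 2 * (1 - disc x v ^ 2 / ‖v‖ ^ 2)) • v := by
  have hc : ‖v‖ ≠ 0 := norm_ne_zero_iff.2 hv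
  have h1 := chordRot_entryPoint hx hv
  have h2 := chordRot_apply_self (x := x) hv
  have h3 : x - (⟪x, v⟫ / ‖v‖ ^ 2) • v = exitPoint x v - (2 * disc x v / ‖v‖ ^ 2) • v +
      (disc x v / ‖v‖ ^ 2) • v := by
    rw [exitPoint]
    match_scalars <;> ring1
  conv_lhs => rw [h3, map_add, h1, map_smul, h2]
  rw [exitPoint]
  match_scalars <;> ring1

/-- In the plane of motion R is a rotation, namely multiplication by ((l + iD)/r)² where l is the
angular momentum. The end point thus becomes a radius times a product of unit complex numbers, whose
arguments add up. -/
theorem branch_eq_polar (hx : ‖x‖ < 1) (hl : 0 < angMom x v) (N : ℕ) :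
    branch N x v = √(1 - radialGap N x v) • ((polarDir N x v).re • (‖x‖⁻¹ • x) +
      (polarDir N x v).im • transDir x v) := by
  have hlsq := angMom_sq x v
  have hadd := angMom_sq_add_disc_sq hx v
  have hx0 : 0 < ‖x‖ := by
    rw [norm_pos_iff]
    rintro rfl
    simp [angMom] at hl
  have hv : v ≠ 0 := by
    rintro rfl
    simp [angMom] at hl
  have hr : 0 < ‖v‖ := norm_pos_iff.2 hv
  have hRy := chordRot_apply_orth hx hv
  have hRv : chordRot x v v = (1 - 2 * disc x v ^ 2 / ‖v‖ ^ 2) • v -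
      (2 * disc x v) • (x - (⟪x, v⟫ / ‖v‖ ^ 2) • v) := by
    rw [chordRot_apply_self hv, exitPoint]
    match_scalars <;> ring1
  set l := angMom x v with hldef
  set D := disc x v with hDdef
  set b := ⟪x, v⟫ with hbdef
  set r := ‖v‖ with hrdef
  set a := ‖x‖ with hadef
  set y := x - (b / r ^ 2) • v with hy
  set e := chordPos N x v with hedef
  -- the plane of motion as a copy of the complex plane
  let ι : ℂ → E d := fun w => (w.re * r / l) • y + (w.im / r) • v
  have hι : ∀ w : ℂ, chordRot x v (ι w) = ι (((l + D * Complex.I) / r) ^ 2 * w) := by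
    intro w
    have hE : ((l : ℂ) + D * Complex.I) ^ 2 / (r : ℂ) ^ 2 =
        (((l ^ 2 - D ^ 2) / r ^ 2 : ℝ) : ℂ) + ((2 * l * D / r ^ 2 : ℝ) : ℂ) * Complex.I := by
      push_cast
      rw [add_sq, mul_pow, Complex.I_sq]
      ring
    simp only [ι, div_pow, hE, map_add, map_smul, hRy, hRv, Complex.mul_re, Complex.mul_im,
      Complex.add_re, Complex.add_im, Complex.ofReal_re, Complex.ofReal_im, Complex.I_re,
      Complex.I_im, mul_zero, mul_one, sub_zero, add_zero, zero_add]
    have hD2 : D ^ 2 = r ^ 2 - l ^ 2 := by linarith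
    match_scalars
    · field_simp
      rw [hD2]
      ring
    · field_simp
      rw [hD2]
      ring
  have hιN : ∀ (n : ℕ) (w : ℂ), (chordRot x v ^ n) (ι w) =
      ι (((l + D * Complex.I) / r) ^ (2 * n) * w) := by
    intro n
    induction n with
    | zero => intro w; simp
    | succ n ih =>
      intro w
      rw [pow_succ, mul_apply_eq_comp, hι, ih, mul_add, pow_add]
      congr 1
      ring
  have hξ : x + (1 - 2 * N * D / r ^ 2) • v = ι ((l + e * Complex.I) / r) := by
    have h1 : (((l : ℂ) + e * Complex.I) / r).re = l / r := by
      rw [Complex.div_ofReal_re]; simp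
    have h2 : (((l : ℂ) + e * Complex.I) / r).im = e / r := by
      rw [Complex.div_ofReal_im]; simp
    simp only [ι, h1, h2]
    rw [hy, hedef, chordPos]
    match_scalars
    · field_simp
    · field_simp
      ring
  have hgap : (e ^ 2 + l ^ 2) = (1 - radialGap N x v) * r ^ 2 := by
    rw [radialGap, sub_mul, div_mul_cancel₀ _ (by positivity)]
    linarith
  have hgap0 : 0 ≤ 1 - radialGap N x v := by
    have : 0 ≤ (1 - radialGap N x v) * r ^ 2 := by rw [← hgap]; positivity
    exact nonneg_of_mul_nonneg_left this (by positivity)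
  have hs1 : √(D ^ 2 + l ^ 2) = r := by
    rw [add_comm, hadd, Real.sqrt_sq hr.le]
  have hs2 : √((-b) ^ 2 + l ^ 2) = a * r := by
    have : (-b) ^ 2 + l ^ 2 = (a * r) ^ 2 := by rw [hlsq]; ring
    rw [this, Real.sqrt_sq (by positivity)]
  have hs3 : √(e ^ 2 + l ^ 2) = √(1 - radialGap N x v) * r := by
    rw [hgap, Real.sqrt_mul hgap0, Real.sqrt_sq hr.le]
  have hg1 : 0 < √(1 - radialGap N x v) := by
    have : 0 < √(e ^ 2 + l ^ 2) := Real.sqrt_pos.2 (by positivity)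
    rw [hs3] at this
    exact pos_of_mul_pos_left this hr.le
  -- Passing from the frame given by the chord midpoint and v to the frame given by x and its
  -- orthogonal direction is the rotation by the argument of l - ib.
  have hframe : ∀ w : ℂ, ι w = (w * ((l - b * Complex.I) / (a * r))).re • (a⁻¹ • x) +
      (w * ((l - b * Complex.I) / (a * r))).im • transDir x v := by
    intro w
    have h1 : ((l : ℂ) - b * Complex.I) / (a * r) =
        ((l / (a * r) : ℝ) : ℂ) + ((-b / (a * r) : ℝ) : ℂ) * Complex.I := by
      push_cast
      ring
    simp only [h1, ι, transDir, Complex.mul_re, Complex.mul_im,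
      Complex.add_re, Complex.add_im, Complex.ofReal_re, Complex.ofReal_im, Complex.I_re,
      Complex.I_im, mul_zero, mul_one, sub_zero, add_zero, zero_add]
    rw [hy, ← hldef, ← hbdef, ← hadef]
    match_scalars
    · field_simp
      linear_combination (-w.re) * hlsq
    · field_simp
  have hω : ((√(1 - radialGap N x v) : ℝ) : ℂ) * polarDir N x v =
      ((l + D * Complex.I) / r) ^ (2 * N) * ((l + e * Complex.I) / r) *
        ((l - b * Complex.I) / (a * r)) := by
    rw [polarDir, ← hldef, ← hDdef, ← hedef, ← hbdef, unitC, unitC, unitC, hs1, hs2, hs3]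
    have : ((√(1 - radialGap N x v) : ℝ) : ℂ) ≠ 0 := by exact_mod_cast hg1.ne'
    push_cast
    field_simp
    ring
  rw [branch, ← hDdef, ← hrdef, hξ, hιN, hframe, ← hω, Complex.re_ofReal_mul,
    Complex.im_ofReal_mul]
  module

end Polar


/-! ### Chords away from the centre: jets of radius and angle -/

section Grazing

variable {d : ℕ} {x v k : E d} {N : ℕ} {r S : ℝ}

/-- Polar coordinates with a radius close to `1`. -/
theorem tameJet_of_polar {ρ : ℝ → ℝ} {u : ℝ → E d} (hS : 1 ≤ S)
    (hρ : JetBound ρ 1 16 (664 * S ^ 2)) (hu : JetBound u 1 616 (21912 * S))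
    (hρ0 : 1 / 2 ≤ ρ 0) (h0 : 0 ≤ 1 - ‖ρ 0 • u 0‖ ^ 2)
    (h1 : (1 - ‖ρ 0 • u 0‖ ^ 2) * S ^ 2 ≤ 1) :
    TameJet (fun s => ρ s • u s) (400000 * S) := by
  obtain ⟨hρ00, m, q, hm, hq, hρ⟩ := hρ
  obtain ⟨hu0, m', q', hm', hq', hu⟩ := hu
  have hpos : 0 < ρ 0 := by linarith
  -- The second derivative of the radius, of order S², multiplies a vector parallel to the end
  -- point, so it goes into the radial part, where 1 - |η|² ≤ S⁻² absorbs it.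
  refine ⟨_, _, hρ.smul hu, ?_, q / ρ 0, ρ 0 • q' + (2 : ℝ) • m • m', ?_, ?_, ?_⟩
  · have : ‖ρ 0 • m' + m • u 0‖ ≤ 632 := by
      refine (norm_add_le _ _).trans ?_
      rw [norm_smul, norm_smul]
      calc ‖ρ 0‖ * ‖m'‖ + ‖m‖ * ‖u 0‖ ≤ 1 * 616 + 16 * 1 := by gcongr
        _ = 632 := by norm_num
    nlinarith [norm_nonneg (ρ 0 • m' + m • u 0)]
  · change _ = (q / ρ 0) • ρ 0 • u 0 + _
    rw [smul_smul (q / ρ 0), div_mul_cancel₀ _ hpos.ne', add_comm]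
  · rw [abs_div, abs_of_pos hpos, div_mul_eq_mul_div, div_le_iff₀ hpos]
    rw [Real.norm_eq_abs] at hq
    calc |q| * (1 - ‖ρ 0 • u 0‖ ^ 2) ≤ 664 * S ^ 2 * (1 - ‖ρ 0 • u 0‖ ^ 2) := by gcongr
      _ ≤ 664 := by nlinarith
      _ ≤ 400000 * S * ρ 0 := by nlinarith
  · refine (norm_add_le _ _).trans ?_
    rw [norm_smul, norm_smul, norm_smul, Real.norm_ofNat]
    calc ‖ρ 0‖ * ‖q'‖ + 2 * (‖m‖ * ‖m'‖) ≤ 1 * (21912 * S) + 2 * (16 * 616) := by gcongr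
      _ ≤ 400000 * S := by linarith

/-- The scales of a grazing trajectory: `S` is the inverse of half the length of the chords. -/
structure GrazingScale (N : ℕ) (x v : E d) (r S : ℝ) : Prop where
  hx : ‖x‖ < 1
  hv : v ≠ 0
  norm_eq : ‖v‖ = r
  disc_eq : disc x v = r / S
  one_le : 1 ≤ S
  one_le_mul : 1 ≤ r * S
  half_le : r / 2 ≤ angMom x v
  index_le : 2 * (N : ℝ) ≤ 3 * (r * S)
  region : |chordPos N x v| ≤ disc x v

theorem GrazingScale.pos (h : GrazingScale N x v r S) : 0 < r ∧ 0 < S :=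
  ⟨h.norm_eq ▸ norm_pos_iff.2 h.hv, by linarith [h.one_le]⟩

theorem GrazingScale.angMom_pos (h : GrazingScale N x v r S) : 0 < angMom x v := by
  linarith [h.half_le, h.pos.1]

theorem GrazingScale.angMom_le (h : GrazingScale N x v r S) : angMom x v ≤ r := by
  rw [← h.norm_eq, ← sq_le_sq₀ (angMom_nonneg x v) (norm_nonneg v),
    ← angMom_sq_add_disc_sq h.hx]
  linarith [sq_nonneg (disc x v)]

theorem GrazingScale.quarter_le (h : GrazingScale N x v r S) : 1 / 4 ≤ ‖x‖ ^ 2 := by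
  have h1 := angMom_sq x v
  have h2 := h.half_le
  have h3 := h.pos.1
  rw [h.norm_eq] at h1
  have h4 : (r / 2) ^ 2 ≤ angMom x v ^ 2 := by gcongr
  have h5 : 1 / 4 * r ^ 2 ≤ ‖x‖ ^ 2 * r ^ 2 := by nlinarith [sq_nonneg ⟪x, v⟫]
  exact le_of_mul_le_mul_right h5 (by positivity)

theorem GrazingScale.jetBound_disc (h : GrazingScale N x v r S) (hk : ‖k‖ ≤ 1) :
    JetBound (fun s : ℝ => disc x (v + s • k)) (r / S) 1 (S / r) := by
  have := jetBound_disc_line h.hx h.hv hk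
  rwa [h.disc_eq, one_div_div] at this

theorem GrazingScale.jetBound_inner (h : GrazingScale N x v r S) (hk : ‖k‖ ≤ 1) :
    JetBound (fun s : ℝ => ⟪x, v + s • k⟫) (r / S) 1 0 := by
  have := jetBound_inner_line h.hx h.hv hk
  rwa [h.disc_eq] at this

theorem GrazingScale.jetBound_norm_sq (h : GrazingScale N x v r S) (hk : ‖k‖ ≤ 1) :
    JetBound (fun s : ℝ => ‖v + s • k‖ ^ 2) (r ^ 2) (2 * r) 2 := by
  have := jetBound_norm_sq_line (v := v) hk
  rwa [h.norm_eq] at this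

theorem GrazingScale.jetBound_inv_norm_sq (h : GrazingScale N x v r S) (hk : ‖k‖ ≤ 1) :
    JetBound (fun s : ℝ => (‖v + s • k‖ ^ 2)⁻¹) (1 / r ^ 2) (2 / r ^ 3) (10 / r ^ 4) := by
  have hr := h.pos.1
  refine ((h.jetBound_norm_sq hk).inv (n := r ^ 2) (by positivity) (by
    simp [h.norm_eq])).mono ?_ ?_ ?_ <;> (apply le_of_eq; field_simp; try norm_num)

theorem GrazingScale.jetBound_angMom (h : GrazingScale N x v r S) (hk : ‖k‖ ≤ 1) :
    JetBound (fun s : ℝ => angMom x (v + s • k)) r 1 (2 / r) := by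
  refine (jetBound_angMom_line h.hx h.angMom_pos hk).mono h.angMom_le le_rfl ?_
  rw [div_le_div_iff₀ h.angMom_pos h.pos.1]
  linarith [h.half_le]

/-- The size comes from 2N D with N of order rS. The value itself is small only because the branch
is active. -/
theorem GrazingScale.jetBound_chordPos (h : GrazingScale N x v r S) (hk : ‖k‖ ≤ 1) :
    JetBound (fun s : ℝ => chordPos N x (v + s • k)) (r / S) (6 * (r * S)) (5 * S ^ 2) := by
  obtain ⟨hr, hS⟩ := h.pos
  have h1 := h.one_le
  have h2 := h.one_le_mul
  have h3 := h.index_le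
  have hj := ((h.jetBound_inner hk).add (h.jetBound_norm_sq hk)).sub
    ((h.jetBound_disc hk).const_mul (2 * N))
  refine (hj.of_norm_le (a' := r / S) ?_).mono le_rfl ?_ ?_
  · simpa [chordPos, h.disc_eq] using h.region
  · rw [abs_of_nonneg (by positivity)]
    nlinarith
  · rw [abs_of_nonneg (by positivity)]
    calc 0 + 2 + 2 * (N : ℝ) * (S / r) ≤ 0 + 2 + 3 * (r * S) * (S / r) := by gcongr
      _ = 2 + 3 * S ^ 2 := by field_simp; ring
      _ ≤ 5 * S ^ 2 := by nlinarith

theorem GrazingScale.radialGap_nonneg (h : GrazingScale N x v r S) : 0 ≤ radialGap N x v := by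
  have h1 := abs_le.1 h.region
  exact div_nonneg (by nlinarith) (by positivity)

theorem GrazingScale.radialGap_le (h : GrazingScale N x v r S) :
    radialGap N x v ≤ 1 / S ^ 2 := by
  obtain ⟨hr, hS⟩ := h.pos
  rw [radialGap, h.norm_eq, h.disc_eq, div_le_iff₀ (by positivity)]
  have : 1 / S ^ 2 * r ^ 2 = (r / S) ^ 2 := by field_simp
  rw [this]
  linarith [sq_nonneg (chordPos N x v)]

theorem radialGap_mul (hv : v ≠ 0) (hx : ‖x‖ < 1) (N : ℕ) :
    (1 - radialGap N x v) * ‖v‖ ^ 2 = chordPos N x v ^ 2 + angMom x v ^ 2 := by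
  have hr : 0 < ‖v‖ := norm_pos_iff.2 hv
  rw [radialGap, sub_mul, div_mul_cancel₀ _ (by positivity)]
  linarith [angMom_sq_add_disc_sq hx v]

theorem GrazingScale.quarter_le_one_sub (h : GrazingScale N x v r S) :
    1 / 4 ≤ 1 - radialGap N x v := by
  have h1 := radialGap_mul h.hv h.hx N
  have h2 := h.half_le
  have h3 := h.pos.1
  rw [h.norm_eq] at h1
  have h4 : (r / 2) ^ 2 ≤ angMom x v ^ 2 := by gcongr
  have h5 : 1 / 4 * r ^ 2 ≤ (1 - radialGap N x v) * r ^ 2 := by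
    nlinarith [sq_nonneg (chordPos N x v)]
  exact le_of_mul_le_mul_right h5 (by positivity)

/-- The first derivative is bounded uniformly in S: in the derivative of the squared chord position,
the large factor rS is multiplied by the position itself, at most r/S, and then divided by r². -/
theorem GrazingScale.jetBound_radialGap (h : GrazingScale N x v r S) (hk : ‖k‖ ≤ 1) :
    JetBound (fun s : ℝ => radialGap N x (v + s • k)) (1 / S ^ 2) 16 (152 * S ^ 2) := by
  obtain ⟨hr, hS⟩ := h.pos
  have h1 := h.one_le
  have h2 := h.one_le_mul
  have hrS : r / S ≤ r ^ 2 := by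
    rw [div_le_iff₀ hS]; nlinarith
  have jD2 : JetBound (fun s : ℝ => disc x (v + s • k) ^ 2) (r ^ 2 / S ^ 2) (2 * r ^ 2) 4 := by
    have := (h.jetBound_disc hk).mul (h.jetBound_disc hk)
    simp only [← pow_two] at this
    refine this.mono ?_ ?_ ?_
    · apply le_of_eq; field_simp
    · linarith
    · apply le_of_eq; field_simp; norm_num
  have je2 : JetBound (fun s : ℝ => chordPos N x (v + s • k) ^ 2) (r ^ 2 / S ^ 2) (12 * r ^ 2)
      (82 * (r * S) ^ 2) := by
    have := (h.jetBound_chordPos hk).mul (h.jetBound_chordPos hk)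
    simp only [← pow_two] at this
    refine this.mono ?_ ?_ ?_
    · apply le_of_eq; field_simp
    · apply le_of_eq; field_simp; norm_num
    · have : r / S * (5 * S ^ 2) = 5 * (r * S) := by field_simp
      rw [mul_comm (5 * S ^ 2), this]
      nlinarith
  have j1 : JetBound (fun s : ℝ => disc x (v + s • k) ^ 2 - chordPos N x (v + s • k) ^ 2)
      (r ^ 2 / S ^ 2) (14 * r ^ 2) (86 * (r * S) ^ 2) := by
    refine ((jD2.sub je2).of_norm_le (a' := r ^ 2 / S ^ 2) ?_).mono le_rfl (by linarith)
      (by nlinarith)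
    simp only [zero_smul, add_zero]
    have h3 := abs_le.1 h.region
    rw [Real.norm_of_nonneg (by nlinarith), h.disc_eq]
    have : (r / S) ^ 2 = r ^ 2 / S ^ 2 := by rw [div_pow]
    linarith [sq_nonneg (chordPos N x v)]
  have hj := j1.mul (h.jetBound_inv_norm_sq hk)
  simp only [← div_eq_mul_inv] at hj
  have hu : 1 / r ≤ S := by rw [div_le_iff₀ hr]; linarith
  have hu' : 1 / (r * S) ≤ 1 := by rw [div_le_one (by positivity)]; exact h2
  have hu0 : 0 < 1 / (r * S) := by positivity
  have hS1 : 1 / S ≤ 1 := by rw [div_le_one hS]; exact h1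
  have hS0 : 0 < 1 / S := by positivity
  refine hj.mono ?_ ?_ ?_
  · apply le_of_eq; field_simp
  · have : r ^ 2 / S ^ 2 * (2 / r ^ 3) + 14 * r ^ 2 * (1 / r ^ 2) =
        2 * ((1 / (r * S)) * (1 / S)) + 14 := by field_simp
    rw [this]
    nlinarith
  · have : r ^ 2 / S ^ 2 * (10 / r ^ 4) + 2 * (14 * r ^ 2 * (2 / r ^ 3)) +
        86 * (r * S) ^ 2 * (1 / r ^ 2) =
        10 * ((1 / (r * S)) * (1 / (r * S))) + 56 * (1 / r) + 86 * S ^ 2 := by field_simp; ring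
    rw [this]
    nlinarith

theorem GrazingScale.jetBound_radius (h : GrazingScale N x v r S) (hk : ‖k‖ ≤ 1) :
    JetBound (fun s : ℝ => √(1 - radialGap N x (v + s • k))) 1 16 (664 * S ^ 2) := by
  have h1 := h.one_le
  have h2 := h.quarter_le_one_sub
  have hj := ((jetBound_const (1 : ℝ)).sub (h.jetBound_radialGap hk)).sqrt (n := 1 / 2)
    (by norm_num) (by
      simp only [zero_smul, add_zero]
      linarith)
  refine hj.mono ?_ (by norm_num) (by nlinarith)
  simp only [zero_smul, add_zero]
  exact Real.sqrt_le_one.2 (by linarith [h.radialGap_nonneg])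

theorem GrazingScale.norm_polarDir (h : GrazingScale N x v r S) : ‖polarDir N x v‖ = 1 := by
  rw [polarDir, norm_mul, norm_mul, norm_pow, norm_unitC h.angMom_pos, norm_unitC h.angMom_pos,
    norm_unitC h.angMom_pos]
  norm_num

/-- Each of the 2N + 2 unit factors is within 4/S of 1, and both N/S and 1/S are O(r). A slow
particle hence stays near its initial direction, in spite of its reflections. -/
theorem GrazingScale.norm_polarDir_sub_one_le (h : GrazingScale N x v r S) :
    ‖polarDir N x v - 1‖ ≤ 20 * r := by
  obtain ⟨hr, hS⟩ := h.pos
  have hb := (abs_inner_lt_disc h.hx h.hv).le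
  have hl := h.angMom_pos
  have key : ∀ p : ℝ, |p| ≤ disc x v → ‖unitC p (angMom x v) - 1‖ ≤ 4 / S := fun p hp => by
    refine (norm_unitC_sub_one_le hl).trans ?_
    calc 2 * |p| / angMom x v ≤ 2 * (r / S) / (r / 2) := by
          gcongr
          · exact hp.trans h.disc_eq.le
          · exact h.half_le
      _ = 4 / S := by field_simp; norm_num
  have h1 := key _ (abs_of_nonneg (disc_nonneg x v)).le
  have h2 := key _ h.region
  have h3 := key (-⟪x, v⟫) (by rwa [abs_neg])
  have hSr : 1 / S ≤ r := by rw [div_le_iff₀ hS]; exact h.one_le_mul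
  rw [polarDir]
  refine (norm_mul_sub_one_le (by rw [norm_pow, norm_unitC hl, one_pow])).trans ?_
  refine (add_le_add (norm_pow_sub_one_le (norm_unitC hl) _)
    (norm_mul_sub_one_le (norm_unitC hl))).trans ?_
  push_cast
  calc 2 * (N : ℝ) * ‖unitC (disc x v) (angMom x v) - 1‖ +
      (‖unitC (chordPos N x v) (angMom x v) - 1‖ + ‖unitC (-⟪x, v⟫) (angMom x v) - 1‖)
      ≤ 3 * (r * S) * (4 / S) + (4 / S + 4 / S) := by
        have := mul_le_mul h.index_le h1 (norm_nonneg _) (by positivity)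
        linarith
    _ = 12 * r + 8 * (1 / S) := by field_simp; ring
    _ ≤ 20 * r := by linarith

/-- The transverse direction depends on v only through its direction, so its derivatives blow up as
r tends to 0. The coefficient in front of it is O(r), which compensates. -/
theorem GrazingScale.jetBound_transDir (h : GrazingScale N x v r S) (hk : ‖k‖ ≤ 1) :
    JetBound (fun s : ℝ => transDir x (v + s • k)) 1 (24 / r) (128 / r ^ 2) := by
  obtain ⟨hr, hS⟩ := h.pos
  have hx2 : ‖x‖ ^ 2 ≤ 1 := pow_le_one₀ (norm_nonneg _) h.hx.le
  have hx0 : 1 / 2 ≤ ‖x‖ := by nlinarith [h.quarter_le, norm_nonneg x]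
  have hb : |⟪x, v⟫| ≤ r := by
    have := abs_real_inner_le_norm x v
    rw [h.norm_eq] at this
    nlinarith [h.hx]
  have jn : JetBound (fun s : ℝ => ‖x‖ ^ 2 • (v + s • k) - ⟪x, v + s • k⟫ • x) (2 * r) 2 0 := by
    have j1 := (jetBound_const (‖x‖ ^ 2)).smul ((jetBound_line v k).mono le_rfl hk le_rfl)
    have j2 := ((h.jetBound_inner hk).of_norm_le (a' := r) (by simpa using hb)).smul
      (jetBound_const x)
    refine (j1.sub j2).mono ?_ ?_ ?_ <;>
      rw [Real.norm_of_nonneg (by positivity)] <;> nlinarith [norm_nonneg x, h.hx, h.norm_eq]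
  have jl := (h.jetBound_angMom hk).inv (n := r / 2) (by positivity) (by
    simp only [zero_smul, add_zero]
    exact h.half_le.trans (le_abs_self _))
  have hinv : ‖x‖⁻¹ ≤ 2 := by
    rw [inv_le_comm₀ (by linarith) (by norm_num)]
    linarith
  have jf : JetBound (fun s : ℝ => (‖x‖ * angMom x (v + s • k))⁻¹) (4 / r) (8 / r ^ 2)
      (48 / r ^ 3) := by
    have hj := jl.const_mul ‖x‖⁻¹
    simp only [← mul_inv] at hj
    rw [abs_of_nonneg (by positivity)] at hj
    refine hj.mono ?_ ?_ ?_
    · calc ‖x‖⁻¹ * (1 / (r / 2)) ≤ 2 * (1 / (r / 2)) := by gcongr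
        _ = 4 / r := by field_simp; norm_num
    · calc ‖x‖⁻¹ * (1 / (r / 2) ^ 2) ≤ 2 * (1 / (r / 2) ^ 2) := by gcongr
        _ = 8 / r ^ 2 := by field_simp; norm_num
    · calc ‖x‖⁻¹ * (2 * 1 ^ 2 / (r / 2) ^ 3 + 2 / r / (r / 2) ^ 2)
          ≤ 2 * (2 * 1 ^ 2 / (r / 2) ^ 3 + 2 / r / (r / 2) ^ 2) := by gcongr
        _ = 48 / r ^ 3 := by field_simp; norm_num
  refine ((jf.smul jn).of_norm_le (a' := 1) ?_).mono le_rfl ?_ ?_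
  · simp only [zero_smul, add_zero]
    have hl := h.angMom_pos
    rw [norm_smul, norm_inv, norm_mul, norm_norm, Real.norm_of_nonneg hl.le,
      inv_mul_le_iff₀ (by positivity), mul_one, ← sq_le_sq₀ (norm_nonneg _) (by positivity),
      mul_pow, angMom_sq, norm_sub_sq_real, norm_smul, norm_smul, real_inner_smul_left,
      real_inner_smul_right, mul_pow, mul_pow, Real.norm_eq_abs, Real.norm_eq_abs, sq_abs, sq_abs,
      real_inner_comm x v]
    apply le_of_eq
    ring
  · apply le_of_eq; field_simp; norm_num
  · apply le_of_eq; field_simp; norm_num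

/-- Let g be one minus the radial gap and let w_D, w_b, w_c be the Wronskians with l of D, b and r².
The angular velocity is T = r⁻²(-2N w_D (1/g - 1) + (1/g - 1/|x|²) w_b + w_c/g). The rotation by the
N reflections is almost cancelled by the motion along the last chord: the large factor N only meets
1/g - 1, which is O(S⁻²). -/
theorem GrazingScale.jetBound_polarDir (h : GrazingScale N x v r S) (hk : ‖k‖ ≤ 1) :
    JetBound (fun s : ℝ => polarDir N x (v + s • k)) 1 68 (8044 * S) := by
  obtain ⟨hr, hS⟩ := h.pos
  have h1 := h.one_le
  have h2 := h.one_le_mul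
  have ha := h.quarter_le
  have hu : 1 / r ≤ S := by rw [div_le_iff₀ hr]; linarith
  have hS1 : 1 / S ≤ r := by rw [div_le_iff₀ hS]; linarith
  have hS2 : 1 / S ≤ 1 := by rw [div_le_one hS]; exact h1
  have hS0 : 0 < 1 / S := by positivity
  obtain ⟨D', hD', jD'⟩ := (h.jetBound_disc hk).exists_deriv
  obtain ⟨l', hl', jl'⟩ := (h.jetBound_angMom hk).exists_deriv
  obtain ⟨b', hb', jb'⟩ := (h.jetBound_inner hk).exists_deriv
  obtain ⟨c', hc', jc'⟩ := (h.jetBound_norm_sq hk).exists_deriv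
  have hl0 : |angMom x (v + (0 : ℝ) • k)| ≤ r := by
    simpa [abs_of_pos h.angMom_pos] using h.angMom_le
  have wD : JetBound₁ (fun s : ℝ => D' s * angMom x (v + s • k) - disc x (v + s • k) * l' s)
      (2 * r) (3 * S) := by
    refine (JetBound₁.wronskian hD' hl' (h.jetBound_disc hk).1 hl0 jD' jl').mono ?_ ?_
    · have : r / S ≤ r := by rw [div_le_iff₀ hS]; nlinarith
      linarith
    · have : S / r * r + r / S * (2 / r) = S + 2 * (1 / S) := by field_simp
      rw [this]
      linarith
  have wb : JetBound₁ (fun s : ℝ => b' s * angMom x (v + s • k) - ⟪x, v + s • k⟫ * l' s)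
      (2 * r) 2 := by
    refine (JetBound₁.wronskian hb' hl' (h.jetBound_inner hk).1 hl0 jb' jl').mono ?_ ?_
    · have : r / S ≤ r := by rw [div_le_iff₀ hS]; nlinarith
      linarith
    · have : 0 * r + r / S * (2 / r) = 2 * (1 / S) := by field_simp; norm_num
      rw [this]
      linarith
  have wc : JetBound₁ (fun s : ℝ => c' s * angMom x (v + s • k) - ‖v + s • k‖ ^ 2 * l' s)
      (3 * r ^ 2) (4 * r) := by
    refine (JetBound₁.wronskian hc' hl' (h.jetBound_norm_sq hk).1 hl0 jc' jl').mono ?_ ?_ <;>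
      apply le_of_eq
    · ring
    · field_simp; norm_num
  have jμ := (h.jetBound_radialGap hk).jetBound₁
  have jν : JetBound₁ (fun s : ℝ => (1 - radialGap N x (v + s • k))⁻¹) 4 256 := by
    refine (((jetBound_const (1 : ℝ)).sub (h.jetBound_radialGap hk)).inv (n := 1 / 4)
      (by norm_num) ?_).jetBound₁.mono (by norm_num) (by norm_num)
    simp only [zero_smul, add_zero]
    exact h.quarter_le_one_sub.trans (le_abs_self _)
  have jA : JetBound₁ (fun s : ℝ => radialGap N x (v + s • k) *
      (1 - radialGap N x (v + s • k))⁻¹) (4 * (1 / S) ^ 2) 320 := by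
    refine (jμ.mul jν).mono ?_ ?_
    · apply le_of_eq; field_simp
    · have : 1 / S ^ 2 = (1 / S) ^ 2 := by field_simp
      rw [this]
      nlinarith
  -- Both g and |x|² lie within S⁻² of 1 and are at least 1/4, so their inverses differ by at most
  -- 16/S².
  have jB : JetBound₁ (fun s : ℝ => (1 - radialGap N x (v + s • k))⁻¹ + -(‖x‖ ^ 2)⁻¹)
      (16 * (1 / S) ^ 2) 256 := by
    refine ((jν.add (jetBound_const (-(‖x‖ ^ 2)⁻¹)).jetBound₁).of_norm_le ?_).mono le_rfl
      (by norm_num)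
    simp only [zero_smul, add_zero]
    have hg := h.quarter_le_one_sub
    have hμ := h.radialGap_le
    have hμ0 := h.radialGap_nonneg
    have hδ : 1 - ‖x‖ ^ 2 ≤ 1 / S ^ 2 := by
      have := disc_sq h.hx (v := v)
      rw [h.disc_eq, h.norm_eq] at this
      rw [le_div_iff₀ (by positivity)]
      have h3 : (r / S) ^ 2 * S ^ 2 = r ^ 2 := by field_simp
      have h4 : ((1 - ‖x‖ ^ 2) * S ^ 2) * r ^ 2 ≤ 1 * r ^ 2 := by
        have h5 : (1 - ‖x‖ ^ 2) * r ^ 2 * S ^ 2 ≤ (r / S) ^ 2 * S ^ 2 := by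
          gcongr
          linarith [sq_nonneg ⟪x, v⟫]
        linarith
      exact le_of_mul_le_mul_right h4 (by positivity)
    have hδ0 := one_sub_norm_sq_pos h.hx
    have hSS : 1 / S ^ 2 = (1 / S) ^ 2 := by field_simp
    rw [hSS] at hμ hδ
    have : (1 - radialGap N x v)⁻¹ + -(‖x‖ ^ 2)⁻¹ =
        (radialGap N x v - (1 - ‖x‖ ^ 2)) / ((1 - radialGap N x v) * ‖x‖ ^ 2) := by
      have h3 : 1 - radialGap N x v ≠ 0 := by linarith
      have h4 : ‖x‖ ^ 2 ≠ 0 := by linarith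
      generalize ‖x‖ ^ 2 = a at h4 ⊢
      field_simp
      ring
    have hpos : 1 / 16 ≤ (1 - radialGap N x v) * ‖x‖ ^ 2 := by nlinarith
    rw [this, norm_div, Real.norm_of_nonneg (by linarith : 0 ≤ (1 - radialGap N x v) * ‖x‖ ^ 2),
      div_le_iff₀ (by linarith)]
    have h5 : ‖radialGap N x v - (1 - ‖x‖ ^ 2)‖ ≤ (1 / S) ^ 2 := by
      rw [Real.norm_eq_abs, abs_le]
      constructor <;> linarith
    nlinarith [sq_nonneg (1 / S)]
  have jN : JetBound₁ (fun _ : ℝ => -(2 * (N : ℝ))) (3 * (r * S)) 0 := by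
    refine (jetBound_const _).jetBound₁.mono ?_ le_rfl
    rw [norm_neg, Real.norm_of_nonneg (by positivity)]
    exact h.index_le
  have jT := (h.jetBound_inv_norm_sq hk).jetBound₁.mul
    (((jN.mul (wD.mul jA)).add (jB.mul wb)).add (jν.mul wc))
  set T : ℝ → ℝ := fun s => (‖v + s • k‖ ^ 2)⁻¹ *
    (-(2 * (N : ℝ)) * ((D' s * angMom x (v + s • k) - disc x (v + s • k) * l' s) *
      (radialGap N x (v + s • k) * (1 - radialGap N x (v + s • k))⁻¹)) +
    ((1 - radialGap N x (v + s • k))⁻¹ + -(‖x‖ ^ 2)⁻¹) *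
      (b' s * angMom x (v + s • k) - ⟪x, v + s • k⟫ * l' s) +
    (1 - radialGap N x (v + s • k))⁻¹ *
      (c' s * angMom x (v + s • k) - ‖v + s • k‖ ^ 2 * l' s)) with hTdef
  have jT' : JetBound₁ T 68 (3420 * S) := by
    have e0 : 3 * (r * S) * (2 * r * (4 * (1 / S) ^ 2)) + 16 * (1 / S) ^ 2 * (2 * r) +
        4 * (3 * r ^ 2) ≤ 68 * r ^ 2 := by
      have : r * S * (r * (1 / S) ^ 2) = r ^ 2 * (1 / S) := by field_simp
      nlinarith [mul_nonneg hr.le hS0.le, sq_nonneg r]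
    have e1 : 3 * (r * S) * (2 * r * 320 + 3 * S * (4 * (1 / S) ^ 2)) +
        0 * (2 * r * (4 * (1 / S) ^ 2)) +
        (16 * (1 / S) ^ 2 * 2 + 256 * (2 * r)) + (4 * (4 * r) + 256 * (3 * r ^ 2)) ≤
        3284 * (r ^ 2 * S) := by
      have e2 : 3 * S * (4 * (1 / S) ^ 2) = 12 * (1 / S) := by field_simp; norm_num
      have e3 : r * S * (1 / S) ≤ r * S * r := by gcongr
      have e4 : (1 / S) ^ 2 ≤ r * (r * S) := by
        calc (1 / S) ^ 2 ≤ r * 1 := by rw [pow_two]; gcongr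
          _ ≤ r * (r * S) := by gcongr
      have e5 : r * 1 ≤ r * (r * S) := by gcongr
      have e6 : r ^ 2 * 1 ≤ r ^ 2 * S := by gcongr
      rw [e2]
      linarith
    refine jT.mono ?_ ?_
    · refine (mul_le_mul_of_nonneg_left e0 (by positivity)).trans (le_of_eq ?_)
      field_simp
    · refine (add_le_add (mul_le_mul_of_nonneg_left e1 (by positivity))
        (mul_le_mul_of_nonneg_left e0 (by positivity))).trans ?_
      have : 1 / r ^ 2 * (3284 * (r ^ 2 * S)) + 2 / r ^ 3 * (68 * r ^ 2) =
          3284 * S + 136 * (1 / r) := by field_simp; norm_num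
      rw [this]
      linarith
  have hev : ∀ᶠ s : ℝ in 𝓝 0, 0 < angMom x (v + s • k) := by
    have hcont := (h.jetBound_angMom hk).jetBound₁
    obtain ⟨-, m, -, hm⟩ := hcont
    refine hm.continuousAt.eventually (lt_mem_nhds ?_)
    simpa using h.angMom_pos
  have hderiv : ∀ᶠ s : ℝ in 𝓝 0, HasDerivAt (fun s : ℝ => polarDir N x (v + s • k))
      (T s * (Complex.I * polarDir N x (v + s • k))) s := by
    filter_upwards [hD', hl', hb', hc', hev, eventually_line_ne_zero h.hv k]
      with s d1 d2 d3 d4 hpos hne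
    have d5 : HasDerivAt (fun s : ℝ => chordPos N x (v + s • k))
        (b' s + c' s - 2 * N * D' s) s := (d3.add d4).sub (d1.const_mul _)
    have u1 := hasDerivAt_unitC (p := fun s => disc x (v + s • k))
      (l := fun s => angMom x (v + s • k)) hpos d1 d2
    have u2 := hasDerivAt_unitC (p := fun s => chordPos N x (v + s • k))
      (p' := fun s => b' s + c' s - 2 * N * D' s) (l := fun s => angMom x (v + s • k)) hpos d5 d2
    have u3 := hasDerivAt_unitC (p := fun s => -⟪x, v + s • k⟫) (p' := fun s => -b' s)
      (l := fun s => angMom x (v + s • k)) hpos d3.neg d2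
    refine (hasDerivAt_mul_phase (hasDerivAt_pow_phase u1 (2 * N))
      (hasDerivAt_mul_phase u2 u3)).congr_deriv ?_
    congr 2
    have hc : 0 < ‖v + s • k‖ ^ 2 := by
      have := norm_pos_iff.2 hne
      positivity
    have f1 : disc x (v + s • k) ^ 2 + angMom x (v + s • k) ^ 2 = ‖v + s • k‖ ^ 2 := by
      linarith [angMom_sq_add_disc_sq h.hx (v + s • k)]
    have f2 : (-⟪x, v + s • k⟫) ^ 2 + angMom x (v + s • k) ^ 2 = ‖x‖ ^ 2 * ‖v + s • k‖ ^ 2 := by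
      rw [angMom_sq]; ring
    have f3 := radialGap_mul hne h.hx N
    have hg : 1 - radialGap N x (v + s • k) ≠ 0 := by
      intro h0
      rw [h0, zero_mul] at f3
      nlinarith [sq_nonneg (chordPos N x (v + s • k))]
    have hx0 : ‖x‖ ≠ 0 := by
      intro h0
      rw [h0] at ha
      norm_num at ha
    rw [f1, f2, ← f3, hTdef, chordPos]
    push_cast
    obtain ⟨g, hgdef⟩ : ∃ g, g = 1 - radialGap N x (v + s • k) := ⟨_, rfl⟩
    have hgap : radialGap N x (v + s • k) = 1 - g := by linarith
    rw [← hgdef] at hg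
    simp only [hgap, sub_sub_cancel]
    field_simp
    ring
  have hω0 : ‖polarDir N x (v + (0 : ℝ) • k)‖ = 1 := by
    simpa using h.norm_polarDir
  refine JetBound.of_deriv hω0.le hderiv ?_
  have jω : JetBound₁ (fun s : ℝ => Complex.I * polarDir N x (v + s • k)) 1 68 := by
    refine ⟨by rw [norm_mul, Complex.norm_I, one_mul, hω0], _, ?_,
      hderiv.self_of_nhds.const_mul Complex.I⟩
    rw [norm_mul, norm_mul, norm_mul, Complex.norm_I, Complex.norm_real, one_mul, hω0, one_mul,
      mul_one]
    exact jT'.1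
  have hj := jT'.smul jω
  simp only [Complex.real_smul] at hj
  exact hj.mono (by norm_num) (by linarith)

/-- Trajectories along chords at distance at least `1/2` from the centre. -/
theorem GrazingScale.tameJet_branch (h : GrazingScale N x v r S) (hk : ‖k‖ ≤ 1) :
    TameJet (fun s : ℝ => branch N x (v + s • k)) (400000 * S) := by
  obtain ⟨hr, hS⟩ := h.pos
  have h1 := h.one_le
  have hu : 1 / r ≤ S := by rw [div_le_iff₀ hr]; linarith [h.one_le_mul]
  have hx0 : ‖x‖ ≠ 0 := by
    intro h0
    have := h.quarter_le
    rw [h0] at this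
    norm_num at this
  have jω := h.jetBound_polarDir hk
  have jre := jω.clm Complex.reCLM Complex.reCLM_norm.le
  have jim := jω.clm Complex.imCLM Complex.imCLM_norm.le
  simp only [Complex.reCLM_apply, Complex.imCLM_apply] at jre jim
  -- The imaginary part vanishes at the phase 1, so it is O(r); this is the factor that pays for the
  -- derivatives of the transverse direction.
  have jim' := jim.of_norm_le (a' := 20 * r) (by
    simp only [zero_smul, add_zero]
    refine le_trans ?_ h.norm_polarDir_sub_one_le
    have := Complex.abs_im_le_norm (polarDir N x v - 1)
    simpa using this)
  have jt := h.jetBound_transDir hk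
  have jx : JetBound (fun _ : ℝ => ‖x‖⁻¹ • x) 1 0 0 :=
    (jetBound_const _).mono (by rw [norm_smul, norm_inv, norm_norm, inv_mul_cancel₀ hx0]) le_rfl
      le_rfl
  have hev : ∀ᶠ s : ℝ in 𝓝 0, 0 < angMom x (v + s • k) := by
    obtain ⟨-, m, -, hm⟩ := (h.jetBound_angMom hk).jetBound₁
    refine hm.continuousAt.eventually (lt_mem_nhds ?_)
    simpa using h.angMom_pos
  have hbr : (fun s : ℝ => branch N x (v + s • k)) =ᶠ[𝓝 0] fun s : ℝ =>
      √(1 - radialGap N x (v + s • k)) • ((polarDir N x (v + s • k)).re • (‖x‖⁻¹ • x) +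
        (polarDir N x (v + s • k)).im • transDir x (v + s • k)) := by
    filter_upwards [hev] with s hs
    exact branch_eq_polar h.hx hs N
  have hbr0 := hbr.self_of_nhds
  have hgap := one_sub_norm_branch_sq h.hx h.hv N
  have hnorm : ‖(polarDir N x v).re • (‖x‖⁻¹ • x) + (polarDir N x v).im • transDir x v‖ ≤ 1 := by
    have hs := h.quarter_le_one_sub
    have h3 : ‖branch N x v‖ ^ 2 = 1 - radialGap N x v := by
      rw [radialGap, chordPos, ← hgap]
      ring
    rw [branch_eq_polar h.hx h.angMom_pos N, norm_smul, mul_pow, Real.norm_of_nonneg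
      (Real.sqrt_nonneg _), Real.sq_sqrt (by linarith)] at h3
    have h4 := mul_left_cancel₀ (by linarith : 1 - radialGap N x v ≠ 0) (h3.trans (mul_one _).symm)
    nlinarith [norm_nonneg ((polarDir N x v).re • (‖x‖⁻¹ • x) +
      (polarDir N x v).im • transDir x v)]
  have ju : JetBound (fun s : ℝ => (polarDir N x (v + s • k)).re • (‖x‖⁻¹ • x) +
      (polarDir N x (v + s • k)).im • transDir x (v + s • k)) 1 616 (21912 * S) := by
    refine (((jre.smul jx).add (jim'.smul jt)).of_norm_le (a' := 1) ?_).mono le_rfl ?_ ?_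
    · simpa using hnorm
    · apply le_of_eq; field_simp; norm_num
    · have : 20 * r * (128 / r ^ 2) + 2 * (68 * (24 / r)) + 8044 * S * 1 =
          5824 * (1 / r) + 8044 * S := by field_simp; norm_num
      rw [this]
      linarith
  refine (tameJet_of_polar h1 (h.jetBound_radius hk) ju ?_ ?_ ?_).congr hbr
  · simp only [zero_smul, add_zero]
    exact Real.le_sqrt_of_sq_le (by linarith [h.quarter_le_one_sub])
  · simp only [zero_smul, add_zero] at hbr0 ⊢
    rw [← hbr0, hgap]
    exact h.radialGap_nonneg
  · simp only [zero_smul, add_zero] at hbr0 ⊢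
    rw [← hbr0, hgap, ← le_div_iff₀ (by positivity)]
    exact h.radialGap_le

end Grazing


/-! ### Second differences along trajectories -/

section SecondDifferences

/-- A function that is twice differentiable in a pointwise sense with a uniform bound has bounded
second differences. -/
theorem le_secondDiff_of_pointwise {f : ℝ → ℝ} {K : ℝ}
    (h : ∀ s, ∃ m, ∀ᶠ t in 𝓝 (0 : ℝ), |f (s + t) - f s - t * m| ≤ K * t ^ 2) (s t : ℝ) :
    f (s + t) + f (s - t) - 2 * f s ≥ -(2 * K * t ^ 2) := by
  have hcont : Continuous f := by
    rw [continuous_iff_continuousAt]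
    intro s
    obtain ⟨m, hm⟩ := h s
    have h1 : Tendsto (fun t : ℝ => f (s + t) - f s - t * m) (𝓝 0) (𝓝 0) := by
      refine squeeze_zero_norm' hm ?_
      have : Continuous fun t : ℝ => K * t ^ 2 := by fun_prop
      simpa using this.tendsto 0
    have h2 : Tendsto (fun t : ℝ => f (s + t)) (𝓝 0) (𝓝 (f s)) := by
      have h3 : Tendsto (fun t : ℝ => f s + t * m) (𝓝 0) (𝓝 (f s)) := by
        have : Continuous fun t : ℝ => f s + t * m := by fun_prop
        simpa using this.tendsto 0
      have := h1.add h3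
      simp only [zero_add] at this
      refine this.congr fun t => by ring
    have h3 : Tendsto (fun u : ℝ => u - s) (𝓝 s) (𝓝 0) := by
      have : Continuous fun u : ℝ => u - s := by fun_prop
      simpa using this.tendsto s
    refine (h2.comp h3).congr fun u => ?_
    simp
  wlog ht : 0 < t generalizing t
  · rcases (not_lt.1 ht).eq_or_lt with rfl | ht
    · simp; ring_nf; exact le_rfl
    · have := this (-t) (by linarith)
      rw [sub_neg_eq_add, ← sub_eq_add_neg] at this
      nlinarith
  by_contra! hlt
  -- a quadratic perturbation with an interior maximum
  obtain ⟨ε, hε, hlt'⟩ : ∃ ε > 0, f (s + t) + f (s - t) - 2 * f s < -(2 * (K + ε) * t ^ 2) := by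
    refine ⟨(-(2 * K * t ^ 2) - (f (s + t) + f (s - t) - 2 * f s)) / (4 * t ^ 2),
      div_pos (by linarith) (by positivity), ?_⟩
    have : 2 * (K + (-(2 * K * t ^ 2) - (f (s + t) + f (s - t) - 2 * f s)) / (4 * t ^ 2)) * t ^ 2 =
        2 * K * t ^ 2 + (-(2 * K * t ^ 2) - (f (s + t) + f (s - t) - 2 * f s)) / 2 := by
      field_simp
      ring
    rw [this]
    linarith
  set B := (f (s + t) - f (s - t)) / (2 * t) with hB
  set A := (f (s + t) + f (s - t)) / 2 with hA
  -- Subtracting the chord and adding the parabola makes g vanish at both ends and be positive at s.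
  -- At an interior maximum u, the second differences of f are at most -2(K + ε)τ², against the
  -- pointwise lower bound -2Kτ².
  set g : ℝ → ℝ := fun u => f u - (A + B * (u - s)) + (K + ε) * ((u - s) ^ 2 - t ^ 2) with hg
  have hBt : B * t = (f (s + t) - f (s - t)) / 2 := by rw [hB]; field_simp
  have hg1 : g (s + t) = 0 := by
    simp only [hg, add_sub_cancel_left]
    rw [hBt, hA]; ring
  have hg2 : g (s - t) = 0 := by
    simp only [hg, sub_sub_cancel_left]
    rw [mul_neg, hBt, hA]; ring
  have hg3 : 0 < g s := by
    simp only [hg, sub_self]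
    rw [hA]; linarith
  have hgc : Continuous g := by
    simp only [hg]; fun_prop
  obtain ⟨u, hu, hmax⟩ := isCompact_Icc.exists_isMaxOn (s := Icc (s - t) (s + t))
    ⟨s, by constructor <;> linarith⟩ hgc.continuousOn
  have hu0 : 0 < g u := hg3.trans_le (hmax ⟨by linarith, by linarith⟩)
  have hu1 : s - t < u := lt_of_le_of_ne hu.1 (by rintro rfl; linarith)
  have hu2 : u < s + t := lt_of_le_of_ne hu.2 (by rintro rfl; linarith)
  obtain ⟨m, hm⟩ := h u
  have hm' : ∀ᶠ τ in 𝓝 (0 : ℝ), |f (u - τ) - f u + τ * m| ≤ K * τ ^ 2 := by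
    have h0 : Tendsto (fun τ : ℝ => -τ) (𝓝 0) (𝓝 0) := by
      simpa using (continuous_neg (G := ℝ)).tendsto 0
    filter_upwards [h0.eventually hm] with τ hτ
    simpa [sub_eq_add_neg] using hτ
  have hsmall : ∀ᶠ τ in 𝓝[>] (0 : ℝ), 0 < τ ∧ τ < u - (s - t) ∧ τ < s + t - u := by
    filter_upwards [self_mem_nhdsWithin, mem_nhdsWithin_of_mem_nhds
      (gt_mem_nhds (by linarith : 0 < u - (s - t))), mem_nhdsWithin_of_mem_nhds
      (gt_mem_nhds (by linarith : 0 < s + t - u))] with τ h1 h2 h3 using ⟨h1, h2, h3⟩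
  obtain ⟨τ, ⟨⟨hτ0, hτ1, hτ2⟩, h1⟩, h2⟩ := ((hsmall.and
    (mem_nhdsWithin_of_mem_nhds hm)).and (mem_nhdsWithin_of_mem_nhds hm')).exists
  have h3 : g (u + τ) ≤ g u := hmax ⟨by linarith, by linarith⟩
  have h4 : g (u - τ) ≤ g u := hmax ⟨by linarith, by linarith⟩
  have h5 := (abs_le.1 h1).1
  have h6 := (abs_le.1 h2).1
  simp only [hg] at h3 h4
  have : 0 < ε * τ ^ 2 := by positivity
  nlinarith

theorem abs_secondDiff_le_of_pointwise {f : ℝ → ℝ} {K : ℝ}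
    (h : ∀ s, ∃ m, ∀ᶠ t in 𝓝 (0 : ℝ), |f (s + t) - f s - t * m| ≤ K * t ^ 2) (s t : ℝ) :
    |f (s + t) + f (s - t) - 2 * f s| ≤ 2 * K * t ^ 2 := by
  have h1 := le_secondDiff_of_pointwise h s t
  have h2 := le_secondDiff_of_pointwise (f := fun s => -f s) (fun s => by
    obtain ⟨m, hm⟩ := h s
    refine ⟨-m, ?_⟩
    filter_upwards [hm] with t ht
    rw [← abs_neg]
    convert ht using 2
    ring) s t
  rw [abs_le]
  constructor <;> linarith

/-- Taylor's formula with Peano remainder. -/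
theorem HasJet.taylor {V : Type*} [NormedAddCommGroup V] [NormedSpace ℝ V] {f : ℝ → V} {m q : V}
    (h : HasJet f m q) {ε : ℝ} (hε : 0 < ε) :
    ∀ᶠ s in 𝓝 (0 : ℝ), ‖f s - f 0 - s • m - (s ^ 2 / 2) • q‖ ≤ ε * s ^ 2 := by
  obtain ⟨f', h1, rfl, h3⟩ := h
  have h4 := (hasDerivAt_iff_isLittleO.1 h3).def hε
  simp only [sub_zero] at h4
  obtain ⟨δ, hδ, hball⟩ := Metric.eventually_nhds_iff_ball.1 (h1.and h4)
  filter_upwards [Metric.ball_mem_nhds (0 : ℝ) hδ] with s hs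
  have hsub : closedBall (0 : ℝ) |s| ⊆ ball 0 δ := by
    refine closedBall_subset_ball ?_
    simpa using hs
  have hd : ∀ t ∈ closedBall (0 : ℝ) |s|, HasDerivWithinAt
      (fun t => f t - f 0 - t • f' 0 - (t ^ 2 / 2) • q) (f' t - f' 0 - t • q)
      (closedBall (0 : ℝ) |s|) t := fun t ht => by
    have h5 := (((hball t (hsub ht)).1.sub_const (f 0)).sub
      ((hasDerivAt_id t).smul_const (f' 0))).sub
        (((hasDerivAt_pow 2 t).div_const 2).smul_const q)
    refine (h5.congr_deriv ?_).hasDerivWithinAt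
    simp
  have hb : ∀ t ∈ closedBall (0 : ℝ) |s|, ‖f' t - f' 0 - t • q‖ ≤ ε * |s| := fun t ht => by
    refine ((hball t (hsub ht)).2).trans ?_
    have : ‖t‖ ≤ |s| := by simpa using ht
    gcongr
  have := (convex_closedBall (0 : ℝ) |s|).norm_image_sub_le_of_norm_hasDerivWithin_le hd hb
    (x := 0) (y := s) (by simp) (by simp)
  simp only [zero_smul, sub_zero, sub_self] at this
  refine (this.trans_eq ?_).trans' (by simp)
  rw [Real.norm_eq_abs, mul_assoc, ← sq, sq_abs]

/-! ### Uniform expansions of test functions along lines of velocities -/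

variable {d : ℕ} {x v k : E d}

/-- Every branch that is active at `v` has a tame jet. -/
theorem tameJet_branch (hx : ‖x‖ < 1) (hv : v ≠ 0) (hk : ‖k‖ ≤ 1) {N : ℕ}
    (hreg : |⟪x, v⟫ + ‖v‖ ^ 2 - 2 * N * disc x v| ≤ disc x v) :
    TameJet (fun s : ℝ => branch N x (v + s • k)) (400000 / √(1 - ‖x‖ ^ 2)) := by
  have hr : 0 < ‖v‖ := norm_pos_iff.2 hv
  have hD := disc_pos hx hv
  have hDr := disc_le_norm hx v
  have hδ := one_sub_norm_sq_pos hx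
  have hb := abs_lt.1 (abs_inner_lt_disc hx hv)
  have hsδ : 0 < √(1 - ‖x‖ ^ 2) := Real.sqrt_pos.2 hδ
  have hS : ‖v‖ / disc x v ≤ 1 / √(1 - ‖x‖ ^ 2) := by
    rw [div_le_div_iff₀ hD hsδ, one_mul, disc]
    apply Real.le_sqrt_of_sq_le
    rw [mul_pow, Real.sq_sqrt hδ.le]
    linarith [sq_nonneg ⟪x, v⟫]
  have hS1 : 1 ≤ ‖v‖ / disc x v := by rw [one_le_div hD]; exact hDr
  -- The natural scale is S = r/D, the inverse of half the chord length, and D² ≥ δr² bounds it by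
  -- 1/√δ.
  suffices TameJet (fun s : ℝ => branch N x (v + s • k)) (400000 * (‖v‖ / disc x v)) from
    this.mono (by
      rw [div_eq_mul_one_div 400000 √(1 - ‖x‖ ^ 2)]
      gcongr)
  have hreg' := abs_le.1 hreg
  rcases N.eq_zero_or_pos with rfl | hN
  · exact (tameJet_branch_zero x v hk).mono (by linarith)
  have hN1 : (1 : ℝ) ≤ N := by exact_mod_cast hN
  rcases lt_or_ge (‖v‖ ^ 2) (disc x v) with hslow | hfast
  -- An active branch satisfies (2N - 1)D ≤ b + r², which is below 2D when r² < D.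
  · have hN2 : N = 1 := by
      have : (N : ℝ) < 2 := by nlinarith
      have : N < 2 := by exact_mod_cast this
      omega
    subst hN2
    rw [Nat.cast_one, mul_one] at hreg
    refine (tameJet_branch_one hx hv hk hslow hreg).mono ?_
    rw [div_div_eq_mul_div, mul_div_assoc]
    linarith
  rcases le_or_gt (‖v‖ / 2) (angMom x v) with hl | hl
  · refine GrazingScale.tameJet_branch (N := N) (r := ‖v‖) ⟨hx, hv, rfl, ?_, hS1, ?_, hl, ?_, ?_⟩ hk
    · field_simp
    · rw [← mul_div_assoc, one_le_div hD, ← sq]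
      exact hfast
    · rw [← mul_div_assoc, ← mul_div_assoc, le_div_iff₀ hD]
      nlinarith
    · exact hreg
  -- Angular momentum below r/2 means D² ≥ 3r²/4, and 4/5 is a rational constant below √3/2. Since D
  -- ≤ r², this also forces r ≥ 4/5.
  · have h1 := angMom_sq_add_disc_sq hx v
    have h2 : angMom x v ^ 2 ≤ (‖v‖ / 2) ^ 2 := pow_le_pow_left₀ (angMom_nonneg x v) hl.le 2
    have h3 : ‖v‖ * (4 / 5) ≤ disc x v := by
      rw [← sq_le_sq₀ (by positivity) hD.le]
      nlinarith
    have h4 : 4 / 5 ≤ ‖v‖ := by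
      have : ‖v‖ * (4 / 5) ≤ ‖v‖ * ‖v‖ := by nlinarith
      exact le_of_mul_le_mul_left this hr
    refine (tameJet_branch_of_steep hx hv hk h3 h4 ?_ hreg).mono (by linarith)
    have : (N : ℝ) * disc x v ≤ 2 * ‖v‖ * disc x v := by nlinarith
    exact le_of_mul_le_mul_right this hD

/-- Near the velocity `0` there are no reflections. -/
theorem eta_of_small (hx : ‖x‖ < 1) (h : 2 * ‖v‖ < 1 - ‖x‖ ^ 2) : eta x v = branch 0 x v := by
  by_cases hv : v = 0
  · rw [hv, eta_zero, branch_zero, add_zero]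
  have hb := abs_lt.1 (abs_inner_lt_disc hx hv)
  have hD := disc_le_norm hx v
  have hr : 0 < ‖v‖ := norm_pos_iff.2 hv
  rw [eta_eq_branch hx hv, branchIndex_eq hx hv (N := 0)]
  · push_cast
    nlinarith
  · push_cast
    have h1 : (disc x v - ⟪x, v⟫) * (disc x v + ⟪x, v⟫) = (1 - ‖x‖ ^ 2) * ‖v‖ ^ 2 := by
      linear_combination disc_sq hx (v := v)
    by_contra! h2
    have h3 : (disc x v - ⟪x, v⟫) * (disc x v + ⟪x, v⟫) ≤ ‖v‖ ^ 2 * (disc x v + ⟪x, v⟫) :=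
      mul_le_mul_of_nonneg_right (by linarith) (by linarith)
    have h4 : 0 < ‖v‖ ^ 2 := by positivity
    nlinarith

/-- A function on the closed unit ball with a first order expansion with quadratic remainder,
whose derivative is bounded, and almost tangential near the sphere. -/
structure NeumannExpansion (φ : E d → ℝ) (L : E d → E d →L[ℝ] ℝ) (C : ℝ) : Prop where
  taylor : ∀ y ∈ closedBall (0 : E d) 1, ∀ z ∈ closedBall (0 : E d) 1,
    |φ z - φ y - L y (z - y)| ≤ C * ‖z - y‖ ^ 2
  norm_le : ∀ y ∈ closedBall (0 : E d) 1, ‖L y‖ ≤ C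
  radial_le : ∀ y ∈ closedBall (0 : E d) 1, |L y y| ≤ C * (1 - ‖y‖ ^ 2)

theorem NeumannExpansion.nonneg {φ : E d → ℝ} {L : E d → E d →L[ℝ] ℝ} {C : ℝ}
    (h : NeumannExpansion φ L C) : 0 ≤ C :=
  (norm_nonneg _).trans (h.norm_le 0 (by simp))

/-- The second order term is the derivative of φ applied to the second derivative of η. On its
radial part αη the smallness of the radial derivative of φ meets the bound on |α|(1 - |η|²); on the
remainder the bound on the derivative of φ suffices. -/
theorem NeumannExpansion.comp_tameJet {φ : E d → ℝ} {L : E d → E d →L[ℝ] ℝ} {C K : ℝ}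
    (h : NeumannExpansion φ L C) {η : ℝ → E d} (hη : TameJet η K) (hK : 1 ≤ K)
    (h0 : ‖η 0‖ ≤ 1) : ∃ m, HasDerivAt η m 0 ∧ ∀ᶠ s in 𝓝 (0 : ℝ), ‖η s‖ ≤ 1 →
      |φ (η s) - φ (η 0) - s * L (η 0) m| ≤ 8 * C * K * s ^ 2 := by
  obtain ⟨m, q, hjet, hm, α, w, hq, hα, hw⟩ := hη
  have hC := h.nonneg
  have h0' : η 0 ∈ closedBall (0 : E d) 1 := by simpa using h0
  have hLq : |L (η 0) q| ≤ 2 * C * K := by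
    rw [hq, map_add, map_smul, smul_eq_mul]
    have h1 : |L (η 0) w| ≤ C * K := by
      refine ((L (η 0)).le_of_opNorm_le (h.norm_le _ h0') w).trans ?_
      gcongr
    have h2 : |α * L (η 0) (η 0)| ≤ C * K := by
      rw [abs_mul]
      calc |α| * |L (η 0) (η 0)| ≤ |α| * (C * (1 - ‖η 0‖ ^ 2)) := by
            gcongr
            exact h.radial_le _ h0'
        _ = C * (|α| * (1 - ‖η 0‖ ^ 2)) := by ring
        _ ≤ C * K := by gcongr
    refine (abs_add_le _ _).trans ?_
    linarith
  refine ⟨m, hjet.hasDerivAt, ?_⟩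
  have hlip : ∀ᶠ s in 𝓝 (0 : ℝ), ‖η s - η 0‖ ^ 2 ≤ 4 * K * s ^ 2 := by
    have h1 := (hasDerivAt_iff_isLittleO.1 hjet.hasDerivAt).def (c := 1) one_pos
    filter_upwards [h1] with s hs
    simp only [sub_zero, one_mul] at hs
    have h2 : ‖η s - η 0‖ ≤ |s| * (1 + ‖m‖) := by
      have : η s - η 0 = (η s - η 0 - s • m) + s • m := by abel
      rw [this]
      refine (norm_add_le _ _).trans ?_
      rw [norm_smul, Real.norm_eq_abs] at *
      linarith
    calc ‖η s - η 0‖ ^ 2 ≤ (|s| * (1 + ‖m‖)) ^ 2 := pow_le_pow_left₀ (norm_nonneg _) h2 2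
      _ = s ^ 2 * (1 + ‖m‖) ^ 2 := by rw [mul_pow, sq_abs]
      _ ≤ s ^ 2 * (4 * K) := by
        gcongr
        nlinarith [sq_nonneg (‖m‖ - 1)]
      _ = 4 * K * s ^ 2 := by ring
  filter_upwards [hlip, hjet.taylor one_pos] with s h1 h2 hs
  have h3 := h.taylor (η 0) h0' (η s) (by simpa using hs)
  have h4 : |L (η 0) (η s - η 0 - s • m - (s ^ 2 / 2) • q)| ≤ C * (1 * s ^ 2) := by
    refine ((L (η 0)).le_of_opNorm_le (h.norm_le _ h0') _).trans ?_
    gcongr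
  have h5 : φ (η s) - φ (η 0) - s * L (η 0) m = (φ (η s) - φ (η 0) - L (η 0) (η s - η 0)) +
      L (η 0) (η s - η 0 - s • m - (s ^ 2 / 2) • q) + s ^ 2 / 2 * L (η 0) q := by
    simp only [map_sub, map_smul, smul_eq_mul]
    ring
  have h6 : |s ^ 2 / 2 * L (η 0) q| ≤ s ^ 2 / 2 * (2 * C * K) := by
    rw [abs_mul, abs_of_nonneg (by positivity : 0 ≤ s ^ 2 / 2)]
    gcongr
  rw [h5]
  have h7 : C * ‖η s - η 0‖ ^ 2 ≤ C * (4 * K * s ^ 2) := by gcongr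
  have h8 : C * s ^ 2 * 1 ≤ C * s ^ 2 * K := by gcongr
  have h9 : 0 ≤ C * s ^ 2 * K := by positivity
  refine (abs_add_three _ _ _).trans ?_
  linarith

/-- At a velocity for which the particle is on the sphere at time `1`, the derivatives of both
branches differ by a normal vector. -/
theorem hasDerivAt_branch_succ (hx : ‖x‖ < 1) (hv : v ≠ 0) (hk : ‖k‖ ≤ 1) {j : ℕ} {m m' : E d}
    (hm : HasDerivAt (fun s : ℝ => branch j x (v + s • k)) m 0)
    (hm' : HasDerivAt (fun s : ℝ => branch (j + 1) x (v + s • k)) m' 0)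
    (h : ⟪x, v⟫ + ‖v‖ ^ 2 = (2 * j + 1) * disc x v) :
    ∃ κ : ℝ, m' = m + κ • branch j x v := by
  have hr : 0 < ‖v‖ := norm_pos_iff.2 hv
  set lam : ℝ → ℝ := fun s => (⟪x, v + s • k⟫ + ‖v + s • k‖ ^ 2 -
    (2 * j + 1) * disc x (v + s • k)) / ‖v + s • k‖ ^ 2 with hlam
  set Z : ℝ → E d := fun s => (chordRot x (v + s • k) ^ j) (exitPoint x (v + s • k)) with hZ
  have hlam0 : lam 0 = 0 := by simp [hlam, h]
  obtain ⟨-, b₁, -, hb⟩ := (jetBound_inner_line hx hv hk).jetBound₁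
  obtain ⟨-, c₁, -, hc⟩ := (jetBound_norm_sq_line (v := v) hk).jetBound₁
  obtain ⟨-, D₁, -, hD⟩ := (jetBound_disc_line hx hv hk).jetBound₁
  have hc0 : ‖v + (0 : ℝ) • k‖ ^ 2 ≠ 0 := by simpa using hv
  have hdl := ((hb.add hc).sub (hD.const_mul (2 * j + 1 : ℝ))).div hc hc0
  obtain ⟨l₁, hl₁⟩ : ∃ l₁, HasDerivAt lam l₁ 0 := ⟨_, hdl⟩
  have hpos : ∀ s : ℝ, v + s • k ≠ 0 → branch j x (v + s • k) = Z s + lam s •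
      (chordRot x (v + s • k) ^ j) (v + s • k) := by
    intro s hs
    have hcs : ‖v + s • k‖ ≠ 0 := norm_ne_zero_iff.2 hs
    rw [branch, hZ, ← map_smul, ← map_add]
    congr 1
    simp only [exitPoint, hlam]
    match_scalars <;> first | ring1 | (field_simp; ring1)
  have hne := eventually_line_ne_zero hv k
  -- Continuity of the reflection point follows from that of the branch, since the two differ by the
  -- remaining time, which tends to 0, times a vector of norm |v + sk|. Continuity is enough for the
  -- derivative of the product because the other factor vanishes at 0.
  have hZc : Tendsto Z (𝓝 0) (𝓝 (branch j x v)) := by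
    have h1 : Tendsto (fun s : ℝ => branch j x (v + s • k)) (𝓝 0) (𝓝 (branch j x v)) := by
      simpa using hm.continuousAt.tendsto
    have h2 : Tendsto (fun s : ℝ => lam s • (chordRot x (v + s • k) ^ j) (v + s • k)) (𝓝 0)
        (𝓝 0) := by
      rw [tendsto_zero_iff_norm_tendsto_zero]
      have h3 : Tendsto (fun s : ℝ => ‖lam s‖ * ‖v + s • k‖) (𝓝 0) (𝓝 0) := by
        have h4 : Tendsto (fun s : ℝ => ‖v + s • k‖) (𝓝 0) (𝓝 ‖v + (0 : ℝ) • k‖) := by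
          have : Continuous fun s : ℝ => ‖v + s • k‖ := by fun_prop
          exact this.tendsto 0
        have h5 := hl₁.continuousAt.tendsto.norm.mul h4
        rw [hlam0] at h5
        simpa using h5
      refine h3.congr' ?_
      filter_upwards [hne] with s hs
      rw [norm_smul, norm_chordRot_pow hx hs]
    have h3 := h1.sub h2
    rw [sub_zero] at h3
    refine h3.congr' ?_
    filter_upwards [hne] with s hs
    rw [hpos s hs, add_sub_cancel_right]
  have hdisc : Tendsto (fun s : ℝ => disc x (v + s • k)) (𝓝 0) (𝓝 (disc x v)) := by
    simpa using hD.continuousAt.tendsto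
  -- the difference of the branches is a product with a vanishing factor
  have hdiff : HasDerivAt (fun s : ℝ => branch (j + 1) x (v + s • k) - branch j x (v + s • k))
      (-(2 * disc x v * l₁) • branch j x v) 0 := by
    rw [hasDerivAt_iff_tendsto_slope_zero]
    have h1 := hasDerivAt_iff_tendsto_slope_zero.1 hl₁
    have h2 := (((hdisc.const_mul 2).mono_left nhdsWithin_le_nhds).mul h1).neg.smul
      (hZc.mono_left (nhdsWithin_le_nhds (s := {0}ᶜ)))
    refine h2.congr' ?_
    have h0 : branch (j + 1) x (v + (0 : ℝ) • k) - branch j x (v + (0 : ℝ) • k) = 0 := by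
      have h3 : v + (0 : ℝ) • k ≠ 0 := by simpa using hv
      rw [branch_succ_sub hx h3]
      have h4 : (⟪x, v + (0 : ℝ) • k⟫ + ‖v + (0 : ℝ) • k‖ ^ 2 -
        (2 * j + 1) * disc x (v + (0 : ℝ) • k)) / ‖v + (0 : ℝ) • k‖ ^ 2 = 0 := hlam0
      rw [h4]
      simp
    filter_upwards [mem_nhdsWithin_of_mem_nhds hne] with s hs
    simp only [zero_add]
    rw [h0, hlam0, branch_succ_sub hx hs]
    change _ = s⁻¹ • (branch j x (v + s • k) - (2 * disc x (v + s • k) * lam s) • Z s -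
      branch j x (v + s • k) - 0)
    simp only [smul_eq_mul, sub_zero]
    module
  have h1 := (hm'.sub hm).unique hdiff
  exact ⟨_, by rw [← h1]; abel⟩

/-- The pointwise expansion of second order along trajectories. -/
theorem NeumannExpansion.exists_expansion {φ : E d → ℝ} {L : E d → E d →L[ℝ] ℝ} {C : ℝ}
    (h : NeumannExpansion φ L C) (hx : ‖x‖ < 1) (v : E d) (hk : ‖k‖ ≤ 1) :
    ∃ m, ∀ᶠ s in 𝓝 (0 : ℝ), |φ (eta x (v + s • k)) - φ (eta x v) - s * m| ≤
      8 * C * (400000 / √(1 - ‖x‖ ^ 2)) * s ^ 2 := by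
  have hδ := one_sub_norm_sq_pos hx
  have hK : 1 ≤ 400000 / √(1 - ‖x‖ ^ 2) := by
    rw [one_le_div (Real.sqrt_pos.2 hδ)]
    exact (Real.sqrt_le_one.2 (by nlinarith)).trans (by norm_num)
  by_cases hv : v = 0
  · obtain ⟨m, -, hm⟩ := h.comp_tameJet ((tameJet_branch_zero x v hk).mono hK) hK
      (by simp [branch_zero, hv, hx.le])
    refine ⟨L (eta x v) m, ?_⟩
    have hsm : ∀ᶠ s : ℝ in 𝓝 0, 2 * ‖v + s • k‖ < 1 - ‖x‖ ^ 2 := by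
      have h1 : Continuous fun s : ℝ => 2 * ‖v + s • k‖ := by fun_prop
      exact h1.continuousAt.eventually (gt_mem_nhds (by simpa [hv] using hδ))
    filter_upwards [hm, hsm] with s h1 h2
    have h3 := eta_of_small hx h2
    have h4 := eta_of_small hx (hsm.self_of_nhds)
    rw [← h3, ← h4] at h1
    simpa using h1 (norm_eta_le_one hx _)
  have hD := disc_pos hx hv
  have hspec := branchIndex_spec hx hv
  have heta := eta_eq_branch hx hv
  have hne := eventually_line_ne_zero hv k
  obtain ⟨-, b₁, -, hb⟩ := (jetBound_inner_line hx hv hk).jetBound₁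
  obtain ⟨-, c₁, -, hc⟩ := (jetBound_norm_sq_line (v := v) hk).jetBound₁
  obtain ⟨-, D₁, -, hDd⟩ := (jetBound_disc_line hx hv hk).jetBound₁
  have hgap : ∀ n : ℝ, ContinuousAt (fun s : ℝ => ⟪x, v + s • k⟫ + ‖v + s • k‖ ^ 2 -
      n * disc x (v + s • k)) 0 := fun n =>
    (hb.continuousAt.add hc.continuousAt).sub (hDd.continuousAt.const_mul n)
  have hup : ∀ n : ℝ, 0 < ⟪x, v⟫ + ‖v‖ ^ 2 - n * disc x v → ∀ᶠ s : ℝ in 𝓝 0,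
      0 < ⟪x, v + s • k⟫ + ‖v + s • k‖ ^ 2 - n * disc x (v + s • k) := fun n hn =>
    (hgap n).eventually (lt_mem_nhds (by simpa using hn))
  have hdown : ∀ n : ℝ, ⟪x, v⟫ + ‖v‖ ^ 2 - n * disc x v < 0 → ∀ᶠ s : ℝ in 𝓝 0,
      ⟪x, v + s • k⟫ + ‖v + s • k‖ ^ 2 - n * disc x (v + s • k) < 0 := fun n hn =>
    (hgap n).eventually (gt_mem_nhds (by simpa using hn))
  obtain ⟨N, hN⟩ : ∃ N, N = branchIndex x v := ⟨_, rfl⟩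
  rw [← hN] at hspec heta
  have hreg : |⟪x, v⟫ + ‖v‖ ^ 2 - 2 * N * disc x v| ≤ disc x v :=
    abs_le.2 ⟨by linarith, by linarith⟩
  have hjet := tameJet_branch hx hv hk hreg
  obtain ⟨m, hm, hexp⟩ := h.comp_tameJet hjet hK
    (by simpa using norm_branch_le_one hx hv hreg)
  simp only [zero_smul, add_zero] at hexp
  rw [← heta] at hexp
  refine ⟨L (eta x v) m, ?_⟩
  -- The index counts a reflection at time exactly 1, so only the lower inequality can be an
  -- equality. In that case branch N - 1 is active at v too and takes over for some nearby
  -- velocities.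
  rcases hspec.1.lt_or_eq with hlt | heq
  · filter_upwards [hexp, hne, hup (2 * N - 1) (by linarith), hdown (2 * N + 1) (by linarith)]
      with s h1 h2 h3 h4
    have h5 := branchIndex_eq hx h2 (N := N) (by linarith) (by linarith)
    have h6 := eta_eq_branch hx h2
    rw [h5] at h6
    rw [← h6] at h1
    exact h1 (norm_eta_le_one hx _)
  · obtain ⟨j, rfl⟩ : ∃ j, N = j + 1 := by
      refine Nat.exists_eq_succ_of_ne_zero ?_
      rintro rfl
      have := abs_lt.1 (abs_inner_lt_disc hx hv)
      push_cast at heq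
      nlinarith [norm_nonneg v]
    push_cast at heq hspec
    have hreg' : |⟪x, v⟫ + ‖v‖ ^ 2 - 2 * j * disc x v| ≤ disc x v :=
      abs_le.2 ⟨by linarith, by linarith⟩
    have hbr : branch (j + 1) x v = branch j x v := by
      rw [branch_succ_sub hx hv]
      have : ⟪x, v⟫ + ‖v‖ ^ 2 - (2 * j + 1) * disc x v = 0 := by linarith
      rw [this]
      simp
    obtain ⟨m', hm', hexp'⟩ := h.comp_tameJet (tameJet_branch hx hv hk hreg') hK
      (by simpa using norm_branch_le_one hx hv hreg')
    simp only [zero_smul, add_zero] at hexp'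
    rw [← hbr, ← heta] at hexp'
    obtain ⟨κ, hκ⟩ := hasDerivAt_branch_succ hx hv hk hm' hm (by linarith)
    have hsph : ‖branch j x v‖ ^ 2 = 1 := by
      have h1 := one_sub_norm_branch_sq hx hv j
      have h2 : ⟪x, v⟫ + ‖v‖ ^ 2 - 2 * j * disc x v = disc x v := by linarith
      rw [h2, sub_self, zero_div] at h1
      linarith
    have hLm : L (eta x v) m = L (eta x v) m' := by
      have h1 : eta x v = branch j x v := heta.trans hbr
      have h2 := h.radial_le (branch j x v) (by
        simpa using norm_branch_le_one hx hv hreg')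
      rw [hsph, sub_self, mul_zero, abs_nonpos_iff] at h2
      rw [hκ, h1, map_add, map_smul, h2, smul_zero, add_zero]
    filter_upwards [hexp, hexp', hne, hup (2 * j - 1) (by linarith),
      hdown (2 * (j + 1) + 1) (by linarith)] with s h1 h1' h2 h3 h4
    have h6 := eta_eq_branch hx h2
    rcases le_or_gt 0 (⟪x, v + s • k⟫ + ‖v + s • k‖ ^ 2 - (2 * j + 1) * disc x (v + s • k))
      with h7 | h7
    · rw [branchIndex_eq hx h2 (N := j + 1) (by push_cast; linarith)
        (by push_cast; linarith)] at h6
      rw [← h6] at h1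
      exact h1 (norm_eta_le_one hx _)
    · rw [branchIndex_eq hx h2 (N := j) (by linarith) (by linarith)] at h6
      rw [← h6] at h1'
      rw [hLm]
      exact h1' (norm_eta_le_one hx _)

/-- Second differences of a test function along trajectories. -/
theorem NeumannExpansion.abs_secondDiff_le {φ : E d → ℝ} {L : E d → E d →L[ℝ] ℝ} {C : ℝ}
    (h : NeumannExpansion φ L C) (hx : ‖x‖ < 1) (v k : E d) :
    |φ (eta x (v + k)) + φ (eta x (v - k)) - 2 * φ (eta x v)| ≤
      2 * (8 * C * (400000 / √(1 - ‖x‖ ^ 2))) * ‖k‖ ^ 2 := by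
  by_cases hk : k = 0
  · simp only [hk, add_zero, sub_zero, norm_zero]
    ring_nf
    simp
  have hk0 : ‖k‖ ≠ 0 := norm_ne_zero_iff.2 hk
  have hu : ‖‖k‖⁻¹ • k‖ ≤ 1 := by rw [norm_smul, norm_inv, norm_norm, inv_mul_cancel₀ hk0]
  have key := abs_secondDiff_le_of_pointwise
    (f := fun s : ℝ => φ (eta x (v + s • (‖k‖⁻¹ • k))))
    (K := 8 * C * (400000 / √(1 - ‖x‖ ^ 2))) (fun s => by
      obtain ⟨m, hm⟩ := h.exists_expansion hx (v + s • (‖k‖⁻¹ • k)) hu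
      refine ⟨m, ?_⟩
      filter_upwards [hm] with t ht
      rwa [add_assoc, ← add_smul] at ht) 0 ‖k‖
  simpa [smul_smul, hk0, ← sub_eq_add_neg] using key

end SecondDifferences


/-! ### Test functions have Neumann expansions -/

section TestFunctions

variable {d : ℕ}

/-- A smooth function on the closed unit ball with vanishing normal derivative on the unit sphere
has a Neumann expansion. -/
theorem exists_neumannExpansion {φ : E d → ℝ} (hφ : ContDiffOn ℝ ∞ φ (closedBall 0 1))
    (hn : ∀ x ∈ sphere (0 : E d) 1, fderivWithin ℝ φ (closedBall 0 1) x x = 0) :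
    ∃ C, NeumannExpansion φ (fderivWithin ℝ φ (closedBall 0 1)) C := by
  set B := closedBall (0 : E d) 1 with hB
  set L := fderivWithin ℝ φ B with hL
  have hconv : Convex ℝ B := convex_closedBall 0 1
  have hcpt : IsCompact B := isCompact_closedBall 0 1
  have hud : UniqueDiffOn ℝ B := uniqueDiffOn_convex hconv
    ⟨0, mem_interior.2 ⟨ball 0 1, ball_subset_closedBall, isOpen_ball, by simp⟩⟩
  have hL1 : ContDiffOn ℝ 1 L B := hφ.fderivWithin hud (by norm_cast)
  obtain ⟨C₁, hC₁⟩ := hcpt.exists_bound_of_continuousOn hL1.continuousOn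
  obtain ⟨C₂, hC₂⟩ := hcpt.exists_bound_of_continuousOn (hL1.continuousOn_fderivWithin hud le_rfl)
  have hlip : ∀ y ∈ B, ∀ z ∈ B, ‖L z - L y‖ ≤ C₂ * ‖z - y‖ := fun y hy z hz =>
    hconv.norm_image_sub_le_of_norm_fderivWithin_le (hL1.differentiableOn one_ne_zero) hC₂ hy hz
  have h0 : (0 : E d) ∈ B := by simp [hB]
  have hC₂0 : 0 ≤ C₂ := (norm_nonneg _).trans (hC₂ 0 h0)
  refine ⟨max C₁ C₂, ⟨fun y hy z hz => ?_, fun y hy => (hC₁ y hy).trans (le_max_left _ _),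
    fun y hy => ?_⟩⟩
  · have hseg : segment ℝ y z ⊆ B := hconv.segment_subset hy hz
    have key := Convex.norm_image_sub_le_of_norm_hasFDerivWithin_le' (f := φ) (f' := L)
      (φ := L y) (s := segment ℝ y z) (C := C₂ * ‖z - y‖)
      (fun w hw => ((hφ.differentiableOn (by simp)) w (hseg hw)).hasFDerivWithinAt.mono hseg)
      (fun w hw => (hlip y hy w (hseg hw)).trans (by
        gcongr
        exact norm_sub_le_of_mem_segment hw))
      (convex_segment y z) (left_mem_segment ℝ y z) (right_mem_segment ℝ y z)
    rw [Real.norm_eq_abs] at key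
    refine key.trans ?_
    rw [mul_assoc, ← sq]
    gcongr
    exact le_max_right _ _
  · have hy1 : ‖y‖ ≤ 1 := by simpa [hB] using hy
    have hy0 := norm_nonneg y
    by_cases hyz : y = 0
    · simp only [hyz, map_zero, abs_zero, norm_zero]
      have : 0 ≤ max C₁ C₂ := hC₂0.trans (le_max_right _ _)
      simpa using this
    have hyn : ‖y‖ ≠ 0 := norm_ne_zero_iff.2 hyz
    -- The radial derivative at y is compared with the one at the projection of y to the sphere,
    -- which is zero; the Lipschitz bound for the derivative turns the distance 1 - |y| into the
    -- estimate.
    set z := ‖y‖⁻¹ • y with hz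
    have hz1 : ‖z‖ = 1 := by rw [hz, norm_smul, norm_inv, norm_norm, inv_mul_cancel₀ hyn]
    have hzB : z ∈ B := by simp [hB, hz1]
    have hyz' : y = ‖y‖ • z := by rw [hz, smul_smul, mul_inv_cancel₀ hyn, one_smul]
    have hLz : L z y = 0 := by
      rw [hyz', map_smul, hn z (by simp [hz1]), smul_zero]
    have hd : ‖y - z‖ = 1 - ‖y‖ := by
      have : y - z = (‖y‖ - 1) • z := by rw [sub_smul, one_smul, ← hyz']
      rw [this, norm_smul, hz1, mul_one, Real.norm_eq_abs, abs_of_nonpos (by linarith)]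
      ring
    have h1 : |L y y| ≤ C₂ * (1 - ‖y‖) * ‖y‖ := by
      have : L y y = (L y - L z) y := by simp [hLz]
      rw [this, ← Real.norm_eq_abs, ← hd]
      exact ((L y - L z).le_opNorm y).trans (by gcongr; exact hlip z hzB y hy)
    refine h1.trans ?_
    have h2 : C₂ * (1 - ‖y‖) * ‖y‖ ≤ C₂ * (1 - ‖y‖ ^ 2) := by
      rw [mul_assoc]
      gcongr
      nlinarith
    exact h2.trans (mul_le_mul_of_nonneg_right (le_max_right _ _) (by nlinarith))

theorem IsTestFunction.contDiffOn {T : ℝ} {ψ : ℝ → E d → ℝ} (hψ : IsTestFunction T ψ) {t : ℝ}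
    (ht : t ∈ Ico 0 T) : ContDiffOn ℝ ∞ (ψ t) (closedBall 0 1) :=
  hψ.smooth.comp (f := fun y : E d => (t, y)) (by fun_prop) fun _ hy => ⟨ht, hy⟩

end TestFunctions


/-! ### The principal value of functions with controlled second differences -/

section PrincipalValue

variable {d : ℕ}

theorem indicator_truncation_translate (g : E d → ℝ) (s : ℝ) (v : E d) (ε : ℝ) (k : E d) :
    {w : E d | ε < ‖v - w‖}.indicator
      (fun w => (g v - g w) / ‖v - w‖ ^ ((d : ℝ) + 2 * s)) (v + k) =
    {k : E d | ε < ‖k‖}.indicator (fun k => (g v - g (v + k)) / ‖k‖ ^ ((d : ℝ) + 2 * s)) k := by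
  simp [indicator]

variable [NeZero d] {s γ : ℝ}

/-- In polar coordinates the integrand is r^(γ-2s-1) on (0,1] and r^(-1-2s) beyond 1. -/
theorem integrable_min_rpow_div (hs : 0 < s) (hγ : 2 * s < γ) :
    Integrable fun k : E d => min 1 (‖k‖ ^ γ) / ‖k‖ ^ ((d : ℝ) + 2 * s) := by
  have hd : 1 ≤ d := NeZero.one_le
  have hdr : ((d - 1 : ℕ) : ℝ) = (d : ℝ) - 1 := by push_cast [hd]; ring
  rw [integrable_fun_norm_addHaar volume
    (f := fun r : ℝ => min 1 (r ^ γ) / r ^ ((d : ℝ) + 2 * s)), finrank_euclideanSpace_fin,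
    ← Ioc_union_Ioi_eq_Ioi zero_le_one]
  refine IntegrableOn.union ?_ ?_
  · have h1 : IntegrableOn (fun r : ℝ => r ^ (γ - 2 * s - 1)) (Ioc 0 1) := by
      rw [integrableOn_Ioc_iff_integrableOn_Ioo, intervalIntegral.integrableOn_Ioo_rpow_iff one_pos]
      linarith
    refine h1.congr_fun (fun r hr => ?_) measurableSet_Ioc
    have hr0 : 0 < r := hr.1
    simp only
    rw [min_eq_right (Real.rpow_le_one hr0.le hr.2 (by linarith)), smul_eq_mul,
      ← Real.rpow_natCast, hdr, ← Real.rpow_sub hr0, ← Real.rpow_add hr0]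
    congr 1
    ring
  · refine (integrableOn_Ioi_rpow_of_lt (a := -1 - 2 * s) (by linarith) one_pos).congr_fun
      (fun r hr => ?_) measurableSet_Ioi
    have hr1 : (1 : ℝ) < r := hr
    have hr0 : 0 < r := by linarith
    simp only
    rw [min_eq_left (Real.one_le_rpow hr1.le (by linarith)), smul_eq_mul, one_div,
      ← Real.rpow_natCast, hdr, ← Real.rpow_neg hr0.le, ← Real.rpow_add hr0]
    congr 1
    ring

variable {g : E d → ℝ} {M : ℝ}

/-- Away from the origin the numerator is bounded, so a multiple of the previous integrable function
dominates. The exponent 2s + 1 is just one admissible choice of γ. -/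
theorem integrable_indicator_truncation (hs : 0 < s) (hg : Measurable g) (hM : ∀ v, |g v| ≤ M)
    (v : E d) {ε : ℝ} (hε : 0 < ε) :
    Integrable ({k : E d | ε < ‖k‖}.indicator
      fun k => (g v - g (v + k)) / ‖k‖ ^ ((d : ℝ) + 2 * s)) := by
  have hmeas : MeasurableSet {k : E d | ε < ‖k‖} := measurableSet_lt (by fun_prop) (by fun_prop)
  have hM0 : 0 ≤ M := (abs_nonneg _).trans (hM v)
  have hm0 : 0 < min 1 (ε ^ (2 * s + 1)) := lt_min one_pos (Real.rpow_pos_of_pos hε _)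
  refine ((integrable_min_rpow_div (γ := 2 * s + 1) hs (by linarith)).const_mul
    (2 * M / min 1 (ε ^ (2 * s + 1)))).mono' (Measurable.aestronglyMeasurable ?_)
    (Eventually.of_forall fun k => ?_)
  · exact Measurable.indicator (by fun_prop) hmeas
  · have hb : 0 ≤ 2 * M / min 1 (ε ^ (2 * s + 1)) *
        (min 1 (‖k‖ ^ (2 * s + 1)) / ‖k‖ ^ ((d : ℝ) + 2 * s)) := by positivity
    by_cases hk : ε < ‖k‖
    · rw [indicator_of_mem (by exact hk), norm_div, Real.norm_eq_abs, Real.norm_eq_abs,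
        abs_of_nonneg (Real.rpow_nonneg (norm_nonneg k) _), mul_div_assoc']
      gcongr
      have h1 : |g v - g (v + k)| ≤ 2 * M :=
        (abs_sub _ _).trans (by linarith [hM v, hM (v + k)])
      refine h1.trans ?_
      rw [div_mul_eq_mul_div, le_div_iff₀ hm0]
      gcongr
    · rw [indicator_of_notMem (by exact hk), norm_zero]
      exact hb

theorem integrableOn_truncation (hs : 0 < s) (hg : Measurable g) (hM : ∀ v, |g v| ≤ M)
    (v : E d) {ε : ℝ} (hε : 0 < ε) :
    IntegrableOn (fun w : E d => (g v - g w) / ‖v - w‖ ^ ((d : ℝ) + 2 * s))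
      {w : E d | ε < ‖v - w‖} := by
  rw [← integrable_indicator_iff (measurableSet_lt (by fun_prop) (by fun_prop))]
  have h := (integrable_indicator_truncation hs hg hM v hε).comp_sub_right v
  refine h.congr (Eventually.of_forall fun w => ?_)
  simp only
  rw [← indicator_truncation_translate, add_sub_cancel]

/-- The integral is averaged with its image under k ↦ -k. This is legitimate because the truncated
integral converges absolutely, and it replaces first differences by second differences. -/
theorem truncFracLaplacian_eq (hs : 0 < s) (hg : Measurable g) (hM : ∀ v, |g v| ≤ M)
    (v : E d) {ε : ℝ} (hε : 0 < ε) :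
    truncFracLaplacian s g v ε = fracConst d s * (-(∫ k : E d, {k : E d | ε < ‖k‖}.indicator
      (fun k => (g (v + k) + g (v - k) - 2 * g v) / ‖k‖ ^ ((d : ℝ) + 2 * s)) k) / 2) := by
  rw [truncFracLaplacian, ← integral_indicator (measurableSet_lt (by fun_prop) (by fun_prop)),
    ← integral_add_left_eq_self _ v]
  simp only [indicator_truncation_translate]
  congr 1
  have hi := integrable_indicator_truncation hs hg hM v hε
  have h1 := integral_add hi hi.comp_neg
  rw [integral_neg_eq_self
    ({k : E d | ε < ‖k‖}.indicator fun k => (g v - g (v + k)) / ‖k‖ ^ ((d : ℝ) + 2 * s))] at h1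
  rw [eq_div_iff two_ne_zero, mul_two, ← h1, ← integral_neg]
  congr 1
  ext k
  by_cases hk : ε < ‖k‖
  · simp [indicator, hk, ← sub_eq_add_neg]
    ring
  · simp [indicator, hk]

/-- If the second differences of a bounded function `g` at `v` are `O(min(1,|k|^γ))` with
`γ > 2s`, then the principal value defining `(-Δ)^s g (v)` exists and is controlled. -/
theorem fracLaplacianExists_of_secondDiff (hs : 0 < s) (hγ : 2 * s < γ) (hg : Measurable g)
    (hM : ∀ v, |g v| ≤ M) {v : E d} {C : ℝ}
    (hC : ∀ k, |g (v + k) + g (v - k) - 2 * g v| ≤ C * min 1 (‖k‖ ^ γ)) :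
    FracLaplacianExists s g v ∧ |fracLaplacian s g v| ≤ |fracConst d s| *
      (C * ∫ k : E d, min 1 (‖k‖ ^ γ) / ‖k‖ ^ ((d : ℝ) + 2 * s)) := by
  set D : E d → ℝ := fun k => (g (v + k) + g (v - k) - 2 * g v) / ‖k‖ ^ ((d : ℝ) + 2 * s) with hD
  set b : E d → ℝ := fun k => C * (min 1 (‖k‖ ^ γ) / ‖k‖ ^ ((d : ℝ) + 2 * s)) with hb
  have hbi : Integrable b := (integrable_min_rpow_div hs hγ).const_mul C
  have hDb : ∀ k, ‖D k‖ ≤ b k := fun k => by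
    rw [hD, hb]
    simp only
    rw [norm_div, Real.norm_eq_abs, Real.norm_eq_abs,
      abs_of_nonneg (Real.rpow_nonneg (norm_nonneg k) _), mul_div_assoc']
    gcongr
    exact hC k
  have hDm : Measurable D := by fun_prop
  have hlim : Tendsto (fun ε : ℝ => ∫ k : E d, {k : E d | ε < ‖k‖}.indicator D k) (𝓝[>] (0 : ℝ))
      (𝓝 (∫ k, D k)) := by
    refine tendsto_integral_filter_of_dominated_convergence b
      (Eventually.of_forall fun ε => (hDm.indicator
        (measurableSet_lt (by fun_prop) (by fun_prop))).aestronglyMeasurable)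
      (Eventually.of_forall fun ε => Eventually.of_forall fun k =>
        (norm_indicator_le_norm_self D k).trans (hDb k)) hbi (Eventually.of_forall fun k => ?_)
    by_cases hk : k = 0
    · have : D k = 0 := by
        have hpos : (d : ℝ) + 2 * s ≠ 0 := by positivity
        simp [hD, hk, Real.zero_rpow hpos]
      simp [indicator, this]
    · refine tendsto_const_nhds.congr' ?_
      have : ∀ᶠ ε in 𝓝[>] (0 : ℝ), ε < ‖k‖ :=
        nhdsWithin_le_nhds (Iio_mem_nhds (norm_pos_iff.2 hk))
      filter_upwards [this] with ε hε
      rw [indicator_of_mem (by exact hε)]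
  have hlim' : Tendsto (truncFracLaplacian s g v) (𝓝[>] (0 : ℝ))
      (𝓝 (fracConst d s * (-(∫ k, D k) / 2))) := by
    refine ((hlim.neg.div_const 2).const_mul (fracConst d s)).congr' ?_
    filter_upwards [self_mem_nhdsWithin] with ε hε
    rw [truncFracLaplacian_eq hs hg hM v hε]
  have hval : fracLaplacian s g v = fracConst d s * (-(∫ k, D k) / 2) := hlim'.limUnder_eq
  refine ⟨⟨fun ε hε => integrableOn_truncation hs hg hM v hε, hval ▸ hlim'⟩, ?_⟩
  rw [hval, abs_mul, ← integral_const_mul]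
  gcongr
  have h2 : |∫ k, D k| ≤ ∫ k, b k :=
    norm_integral_le_of_norm_le hbi (Eventually.of_forall hDb)
  rw [abs_div, abs_neg, abs_two]
  linarith [abs_nonneg (∫ k, D k)]

/-- With q = δ^(-1/4) r the hypotheses read S ≤ M and S ≤ Kq², and min(1, q²) ≤ q^γ for 0 ≤ γ ≤ 2.
When r^γ ≥ 1, the bound M is enough since δ^(-γ/4) ≥ 1. -/
theorem le_rpow_mul_min_of_le {S M K δ r γ : ℝ} (hδ : 0 < δ) (hδ1 : δ ≤ 1) (hr : 0 ≤ r)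
    (hγ0 : 0 ≤ γ) (hγ2 : γ ≤ 2) (hK : 0 ≤ K) (hM : 0 ≤ M) (h1 : S ≤ M)
    (h2 : S ≤ K / √δ * r ^ 2) : S ≤ (M + K) * δ ^ (-(γ / 4)) * min 1 (r ^ γ) := by
  have hδγ : 1 ≤ δ ^ (-(γ / 4)) := Real.one_le_rpow_of_pos_of_le_one_of_nonpos hδ hδ1 (by linarith)
  rw [mul_assoc]
  rcases le_total 1 (r ^ γ) with h | h
  · rw [min_eq_left h, mul_one]
    nlinarith
  rw [min_eq_right h]
  set q := δ ^ (-(1 / 4 : ℝ)) * r with hq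
  have hδ4 : 0 < δ ^ (-(1 / 4 : ℝ)) := Real.rpow_pos_of_pos hδ _
  have hq0 : 0 ≤ q := by positivity
  have hqγ : δ ^ (-(γ / 4)) * r ^ γ = q ^ γ := by
    rw [hq, Real.mul_rpow hδ4.le hr, ← Real.rpow_mul hδ.le]
    ring_nf
  have hq2 : q ^ 2 = 1 / √δ * r ^ 2 := by
    rw [hq, mul_pow, ← Real.rpow_natCast (δ ^ _), ← Real.rpow_mul hδ.le, Real.sqrt_eq_rpow,
      one_div (δ ^ _), ← Real.rpow_neg hδ.le]
    norm_num
  rw [hqγ]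
  have hqn : 0 ≤ q ^ γ := Real.rpow_nonneg hq0 _
  rcases le_total q 1 with hq1 | hq1
  · have h3 : q ^ 2 ≤ q ^ γ := by
      rcases hq0.eq_or_lt with h0 | h0
      · rw [← h0, sq, mul_zero]
        exact Real.rpow_nonneg le_rfl _
      · rw [← Real.rpow_two]
        exact Real.rpow_le_rpow_of_exponent_ge h0 hq1 hγ2
    have h4 : S ≤ K * q ^ 2 := by rw [hq2]; convert h2 using 1; ring
    nlinarith
  · have h3 : 1 ≤ q ^ γ := Real.one_le_rpow hq1 hγ0
    nlinarith

/-- In polar coordinates the singularity sits at radius 1 only, where 1 - r² ≥ 1 - r reduces it to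
an integrable power of 1 - r. -/
theorem memLp_one_sub_norm_sq_rpow {p a : ℝ} (hp : 0 < p) (ha : 0 ≤ a) (hpa : p * a < 1) (K : ℝ) :
    MemLp (fun x : E d => K * (1 - ‖x‖ ^ 2) ^ (-a)) (ENNReal.ofReal p)
      (volume.restrict (ball 0 1)) := by
  have hmeas : Measurable fun x : E d => (1 - ‖x‖ ^ 2) ^ (-a) := by fun_prop
  refine MemLp.const_mul ?_ K
  rw [← integrable_norm_rpow_iff hmeas.aestronglyMeasurable (by simpa using hp)
    ENNReal.ofReal_ne_top, ENNReal.toReal_ofReal hp.le]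
  refine (integrableOn_fun_norm_addHaar volume
    (f := fun r : ℝ => ‖(1 - r ^ 2) ^ (-a)‖ ^ p)).2 ?_
  have h1 : IntegrableOn (fun r : ℝ => (1 - r) ^ (-(a * p))) (Ioo 0 1) := by
    have h := (intervalIntegral.intervalIntegrable_rpow' (a := 0) (b := 1) (r := -(a * p))
      (by linarith)).comp_sub_left 1
    rw [sub_zero, sub_self] at h
    exact (intervalIntegrable_iff_integrableOn_Ioo_of_le zero_le_one).1 h.symm
  refine h1.mono' (Measurable.aestronglyMeasurable (by fun_prop)) ?_
  filter_upwards [ae_restrict_mem measurableSet_Ioo] with r hr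
  have hr1 : 0 < 1 - r := by linarith [hr.2]
  have hr2 : 1 - r ≤ 1 - r ^ 2 := by nlinarith [hr.1]
  have hr3 : 0 < 1 - r ^ 2 := by linarith
  rw [norm_smul, norm_pow, Real.norm_eq_abs, abs_of_pos hr.1, Real.norm_eq_abs,
    Real.abs_rpow_of_nonneg (norm_nonneg _), Real.norm_eq_abs, abs_abs,
    abs_of_pos (Real.rpow_pos_of_pos hr3 _), ← Real.rpow_mul hr3.le, neg_mul]
  calc r ^ (Module.finrank ℝ (E d) - 1) * (1 - r ^ 2) ^ (-(a * p))
      ≤ 1 * (1 - r ^ 2) ^ (-(a * p)) := by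
        gcongr
        exact pow_le_one₀ hr.1.le hr.2.le
    _ ≤ (1 - r) ^ (-(a * p)) := by
        rw [one_mul]
        exact Real.rpow_le_rpow_of_nonpos hr1 hr2 (by nlinarith)

end PrincipalValue


/-! ### Measurability -/

section Measurability

variable {d : ℕ}

theorem measurable_disc : Measurable fun q : E d × E d => disc q.1 q.2 := by
  unfold disc
  fun_prop

theorem measurable_chordRot_apply {w : E d × E d → E d} (hw : Measurable w) :
    Measurable fun q => chordRot q.1 q.2 (w q) := by
  have := measurable_disc (d := d)
  simp only [chordRot, exitPoint, neg_apply, mul_apply_eq_comp,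
    householder_apply]
  fun_prop

theorem measurable_chordRot_pow_apply (N : ℕ) {w : E d × E d → E d} (hw : Measurable w) :
    Measurable fun q => (chordRot q.1 q.2 ^ N) (w q) := by
  induction N with
  | zero => simpa using hw
  | succ N ih =>
    simp only [pow_succ', mul_apply_eq_comp]
    exact measurable_chordRot_apply ih

theorem measurable_branch (N : ℕ) : Measurable fun q : E d × E d => branch N q.1 q.2 := by
  have := measurable_disc (d := d)
  unfold branch
  exact measurable_chordRot_pow_apply N (by fun_prop)

theorem measurable_branchIndex : Measurable fun q : E d × E d => branchIndex q.1 q.2 := by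
  have := measurable_disc (d := d)
  unfold branchIndex
  exact Nat.measurable_floor.comp (by fun_prop)

/-- On the open ball, the end point of the trajectories is a measurable function of the data. -/
theorem exists_measurable_eta : ∃ H : E d × E d → E d, Measurable H ∧
    ∀ x : E d, ‖x‖ < 1 → ∀ v, eta x v = H (x, v) := by
  have h2 : Measurable fun q : E d × E d => branch (branchIndex q.1 q.2) q.1 q.2 :=
    Measurable.comp (g := fun r : (E d × E d) × ℕ => branch r.2 r.1.1 r.1.2)
      (f := fun q => (q, branchIndex q.1 q.2))
      (measurable_from_prod_countable_left measurable_branch)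
      (measurable_id.prodMk measurable_branchIndex)
  classical
  refine ⟨fun q => if q.2 = 0 then q.1 else branch (branchIndex q.1 q.2) q.1 q.2,
    Measurable.ite (measurableSet_eq_fun measurable_snd measurable_const) measurable_fst h2,
    fun x hx v => ?_⟩
  by_cases hv : v = 0
  · simp only [hv, eta_zero, if_true]
  · rw [eta_eq_branch hx hv]
    simp only [hv, if_false]

/-- On the open ball, a continuous function evaluated along trajectories is a measurable function
of the data. -/
theorem exists_measurable_comp_eta {φ : E d → ℝ} (hφ : ContinuousOn φ (closedBall 0 1)) :
    ∃ G : E d × E d → ℝ, Measurable G ∧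
      ∀ x : E d, ‖x‖ < 1 → ∀ v, φ (eta x v) = G (x, v) := by
  classical
  obtain ⟨H, hH, hHeta⟩ := exists_measurable_eta (d := d)
  -- φ is continuous only on the closed ball; its extension by 0 is Borel, and trajectories never
  -- leave the ball.
  refine ⟨fun q => (closedBall 0 1).piecewise φ 0 (H q),
    (hφ.measurable_piecewise continuousOn_const measurableSet_closedBall).comp hH,
    fun x hx v => ?_⟩
  simp only
  rw [← hHeta x hx v, piecewise_eq_of_mem _ _ _ (by simpa using norm_eta_le_one hx v)]

theorem stronglyMeasurable_truncFracLaplacian [NeZero d] (s ε : ℝ) {G : E d × E d → ℝ}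
    (hG : Measurable G) : StronglyMeasurable fun q : E d × E d =>
      truncFracLaplacian s (fun w => G (q.1, w)) q.2 ε := by
  unfold truncFracLaplacian
  refine StronglyMeasurable.const_mul ?_ _
  have hm : Measurable fun r : (E d × E d) × E d =>
      {r : (E d × E d) × E d | ε < ‖r.1.2 - r.2‖}.indicator
      (fun r => (G r.1 - G (r.1.1, r.2)) / ‖r.1.2 - r.2‖ ^ ((d : ℝ) + 2 * s)) r :=
    Measurable.indicator (by fun_prop) (measurableSet_lt (by fun_prop) (by fun_prop))
  convert hm.stronglyMeasurable.integral_prod_right' (ν := (volume : Measure (E d))) using 2 with q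
  rw [← integral_indicator (measurableSet_lt (by fun_prop) (by fun_prop))]
  rfl

end Measurability


/-! ### The fractional Laplacian along trajectories -/

section MainEstimate

variable {d : ℕ}

theorem ae_weightedMeasure_norm_fst_lt (F : E d → ℝ) :
    ∀ᵐ q ∂weightedMeasure F, ‖q.1‖ < 1 := by
  unfold weightedMeasure
  refine Measure.quasiMeasurePreserving_fst.ae (p := fun x : E d => ‖x‖ < 1) ?_
  filter_upwards [ae_restrict_mem measurableSet_ball] with x hx
  simpa using hx

variable [NeZero d] {s γ : ℝ}

/-- The principal value exists along trajectories, and it is bounded by a negative power of the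
distance to the boundary. -/
theorem NeumannExpansion.exists_fracLaplacian_bound {φ : E d → ℝ} {L : E d → E d →L[ℝ] ℝ} {C : ℝ}
    (h : NeumannExpansion φ L C) (hφ : ContinuousOn φ (closedBall 0 1)) (hs : 0 < s)
    (hγ : 2 * s < γ) (hγ2 : γ ≤ 2) :
    ∃ K, ∀ x : E d, ‖x‖ < 1 → ∀ v, FracLaplacianExists s (fun w => φ (eta x w)) v ∧
      |fracLaplacian s (fun w => φ (eta x w)) v| ≤ K * (1 - ‖x‖ ^ 2) ^ (-(γ / 4)) := by
  obtain ⟨M, hM⟩ := (isCompact_closedBall (0 : E d) 1).exists_bound_of_continuousOn hφ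
  obtain ⟨G, hG, hGeta⟩ := exists_measurable_comp_eta hφ
  have hM0 : 0 ≤ M := (norm_nonneg _).trans (hM 0 (by simp))
  have hC := h.nonneg
  refine ⟨|fracConst d s| * ((4 * M + 2 * (8 * C * 400000)) *
    ∫ k : E d, min 1 (‖k‖ ^ γ) / ‖k‖ ^ ((d : ℝ) + 2 * s)), fun x hx v => ?_⟩
  have hb : ∀ w, |φ (eta x w)| ≤ M := fun w => hM _ (by simpa using norm_eta_le_one hx w)
  have hm : Measurable fun w => φ (eta x w) := by
    simp only [hGeta x hx]
    fun_prop
  obtain ⟨h1, h2⟩ := fracLaplacianExists_of_secondDiff (v := v)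
    (C := (4 * M + 2 * (8 * C * 400000)) * (1 - ‖x‖ ^ 2) ^ (-(γ / 4))) hs hγ hm hb fun k => by
      refine le_rpow_mul_min_of_le (one_sub_norm_sq_pos hx) (by nlinarith [norm_nonneg x])
        (norm_nonneg k) (by linarith) hγ2 (by positivity) (by positivity) ?_ ?_
      · have := abs_le.1 (hb (v + k))
        have := abs_le.1 (hb (v - k))
        have := abs_le.1 (hb v)
        exact abs_le.2 ⟨by linarith, by linarith⟩
      · refine (h.abs_secondDiff_le hx v k).trans (le_of_eq ?_)
        ring
  exact ⟨h1, h2.trans (le_of_eq (by ring))⟩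

/-- Since the principal value exists everywhere in the ball, it is the limit of the truncations at
1/(n+1), and these are measurable as parametric integrals. -/
theorem aestronglyMeasurable_fracLaplacian {φ : E d → ℝ} (hφ : ContinuousOn φ (closedBall 0 1))
    (h : ∀ x : E d, ‖x‖ < 1 → ∀ v, FracLaplacianExists s (fun w => φ (eta x w)) v)
    {μ : Measure (E d × E d)} (hμ : ∀ᵐ q ∂μ, ‖q.1‖ < 1) :
    AEStronglyMeasurable (fun q : E d × E d => fracLaplacian s (fun w => φ (eta q.1 w)) q.2) μ := by
  obtain ⟨G, hG, hGeta⟩ := exists_measurable_comp_eta hφ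
  refine aestronglyMeasurable_of_tendsto_ae atTop (f := fun (n : ℕ) (q : E d × E d) =>
    truncFracLaplacian s (fun w => G (q.1, w)) q.2 (1 / ((n : ℝ) + 1)))
    (fun n => (stronglyMeasurable_truncFracLaplacian s _ hG).aestronglyMeasurable) ?_
  filter_upwards [hμ] with q hq
  have h1 := (h q.1 hq q.2).2
  simp only [hGeta q.1 hq] at h1 ⊢
  exact h1.comp (tendsto_nhdsWithin_iff.2 ⟨tendsto_one_div_add_atTop_nhds_zero_nat,
    Eventually.of_forall fun n => mem_Ioi.2 Nat.one_div_pos_of_nat⟩)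

/-- The bound depends on x alone, and the measure F(v) dv is finite, so the claim reduces to
integrability of a power of 1 - |x|² over the ball. -/
theorem memLp_fracLaplacian {φ : E d → ℝ} (hφ : ContinuousOn φ (closedBall 0 1)) {K p : ℝ}
    (h : ∀ x : E d, ‖x‖ < 1 → ∀ v, FracLaplacianExists s (fun w => φ (eta x w)) v ∧
      |fracLaplacian s (fun w => φ (eta x w)) v| ≤ K * (1 - ‖x‖ ^ 2) ^ (-(γ / 4)))
    (hγ : 0 ≤ γ) (hp : 0 < p) (hpγ : p * (γ / 4) < 1) {F : E d → ℝ} (hF : Integrable F) :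
    MemLp (fun q : E d × E d => fracLaplacian s (fun w => φ (eta q.1 w)) q.2)
      (ENNReal.ofReal p) (weightedMeasure F) := by
  have : IsFiniteMeasure (volume.withDensity fun v => ENNReal.ofReal (F v)) :=
    isFiniteMeasure_withDensity_ofReal hF.2
  have hae := ae_weightedMeasure_norm_fst_lt F
  refine ((memLp_one_sub_norm_sq_rpow hp (by positivity) hpγ K).comp_fst _).mono'
    (aestronglyMeasurable_fracLaplacian hφ (fun x hx v => (h x hx v).1) hae) ?_
  filter_upwards [hae] with q hq using (h q.1 hq q.2).2

end MainEstimate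

end SpecularBall

theorem mainTheorem7 (d : ℕ) [NeZero d] (s : ℝ) (hs : s ∈ Set.Ioo (0 : ℝ) 1)
    (ν : ℝ) (hν : 0 < ν)
    (F : SpecularBall.E d → ℝ) (hF : SpecularBall.IsEquilibrium s ν F)
    (T : ℝ) (hT : 0 < T)
    (ψ : ℝ → SpecularBall.E d → ℝ) (hψ : SpecularBall.IsTestFunction T ψ) :
    ∃ p : ℝ, 2 < p ∧ ∀ t ∈ Set.Ico (0 : ℝ) T,
      (∀ x ∈ Metric.ball (0 : SpecularBall.E d) 1, ∀ v : SpecularBall.E d,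
        SpecularBall.FracLaplacianExists s (fun w => ψ t (SpecularBall.eta x w)) v) ∧
      MeasureTheory.MemLp
        (fun q : SpecularBall.E d × SpecularBall.E d =>
          SpecularBall.fracLaplacian s (fun w => ψ t (SpecularBall.eta q.1 w)) q.2)
        (ENNReal.ofReal p) (SpecularBall.weightedMeasure F) := by
  obtain ⟨hs0, hs1⟩ := hs
  have hp : 2 < 1 + 2 / (1 + s) := by
    have : 1 < 2 / (1 + s) := by rw [lt_div_iff₀ (by linarith)]; linarith
    linarith
  have hpγ : (1 + 2 / (1 + s)) * ((1 + s) / 4) < 1 := by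
    have : (1 + 2 / (1 + s)) * ((1 + s) / 4) = (1 + s) / 4 + 1 / 2 := by
      field_simp
      ring
    linarith
  -- With γ = 1 + s, the midpoint of 2s and 2, the admissible exponents are p < 4/(1 + s). The
  -- choice here is the midpoint of 2 and 4/(1 + s), and it depends neither on the test function nor
  -- on t.
  refine ⟨1 + 2 / (1 + s), hp, fun t ht => ?_⟩
  have hsmooth := hψ.contDiffOn ht
  obtain ⟨C, hC⟩ := SpecularBall.exists_neumannExpansion hsmooth (hψ.neumann t ht)
  obtain ⟨K, hK⟩ := hC.exists_fracLaplacian_bound hsmooth.continuousOn hs0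
    (γ := 1 + s) (by linarith) (by linarith)
  exact ⟨fun x hx v => (hK x (by simpa using hx) v).1,
    SpecularBall.memLp_fracLaplacian hsmooth.continuousOn hK (by linarith) (by linarith) hpγ
      hF.integrable⟩
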